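/- **Setting.** Let $\Omega=(a,b)$ with $-\infty<a<b<\infty$; all functions are real-valued. For $0<\mu<1$ and $w\in L^2(\mathbb R)$ put $|w|_{H^\mu(\mathbb R)}^2=\int_{\mathbb R}|\omega|^{2\mu}|\hat w(\omega)|^2\,d\omega$, with $\hat w(\omega)=\int_{\mathbb R} e^{-i\omega x}w(x)\,dx$. For $u\in L^2(\Omega)$ put $$|u|_{H^\mu(\Omega)}=\inf\{|w|_{H^\mu(\mathbb R)}: w\in H^\mu(\mathbb R),\ w|_\Omega=u\},\qquad \|u\|_{H^\mu(\Omega)}^2=\|u\|_{L^2(\Omega)}^2+|u|^2_{H^\mu(\Omega)}.$$ $H_0^\mu(\Omega)$ is the closure of $C_0^\infty(\Omega)$ in $\|\cdot\|_{H^\mu(\Omega)}$, and $H^{-\mu}(\Omega)$ is its dual with the dual norm. For $f\in H^{-\mu}(\Omega)$, $e^{\lambda x}f$ denotes the functional $v\mapsto\langle f,e^{\lambda x}v\rangle$. For $0<\mu<1$ and $\lambda\ge0$ let $${}_a\mathbb D_x^{\mu,\lambda}u(x)=\frac{e^{-\lambda x}}{\Gamma(1-\mu)}\frac{d}{dx}\int_a^x\frac{e^{\lambda\xi}u(\xi)}{(x-\xi)^{\mu}}\,d\xi,\qquad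 {}_x\mathbb D_b^{\mu,\lambda}u(x)=-\frac{e^{\lambda x}}{\Gamma(1-\mu)}\frac{d}{dx}\int_x^b\frac{e^{-\lambda\xi}u(\xi)}{(\xi-x)^{\mu}}\,d\xi,$$ and write ${}_aD_x^\mu={}_a\mathbb D_x^{\mu,0}$, ${}_xD_b^\mu={}_x\mathbb D_b^{\mu,0}$. With $(\cdot,\cdot)$ the inner product of $L^2(\Omega)$, define $$A_1(u,v)=-\big({}_a\mathbb D_x^{\frac\alpha2,\lambda}u,{}_x\mathbb D_b^{\frac\alpha2,\lambda}v\big)+\alpha\lambda^{\alpha-1}\big({}_aD_x^{\frac\alpha2}u,{}_xD_b^{1-\frac\alpha2}v\big)+\lambda^\alpha(u,v),$$ $$A_2(u_1,v_1)=-\big({}_aD_x^{\frac\alpha2}u_1,{}_xD_b^{\frac\alpha2}v_1\big)+\alpha\lambda^{\alpha-1}\big({}_aD_x^{\frac\alpha2}u_1,{}_xD_b^{1-\frac\alpha2}v_1\big)+(1-\alpha)\lambda^\alpha(u_1,v_1).$$ **Lemma.** Let $1<\alpha<2$. There is a constant $C$, depending only on $\alpha,a,b$, such that the following holds for every $\lambda\ge0$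 with $$\lambda^\alpha<\frac{|\cos(\frac{\pi\alpha}2)|\,\Gamma(\frac\alpha2+1)^2}{2\pi(\alpha-1)(b-a)^\alpha}$$ and every $f\in H^{-\alpha/2}(\Omega)$. The functional $e^{\lambda x}f$ is bounded on $H_0^{\alpha/2}(\Omega)$, and: 1. (Petrov–Galerkin formulation of $-{}_a\mathbb D_x^{\alpha,\lambda}u+\lambda^\alpha u+\alpha\lambda^{\alpha-1}u'=f$.) There is exactly one $u\in e^{-\lambda x}H_0^{\alpha/2}(\Omega)$ with $A_1(u,v)=\langle f,v\rangle$ for all $v\in e^{\lambda x}H_0^{\alpha/2}(\Omega)$. 2. (Galerkin formulation of $-{}_aD_x^{\alpha}u_1+\alpha\lambda^{\alpha-1}u_1'+(1-\alpha)\lambda^\alpha u_1=e^{\lambda x}f$.) There is exactly one $u_1\in H_0^{\alpha/2}(\Omega)$ with $A_2(u_1,v_1)=\langle e^{\lambda x}f,v_1\rangle$ for all $v_1\in H_0^{\alpha/2}(\Omega)$. 3. Both solutions satisfy the estimate: $\|u\|_{H^{\alpha/2}(\Omega)}\le C\|e^{\lambda x}f\|_{H^{-\alpha/2}(\Omega)}$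 and $\|u_1\|_{H^{\alpha/2}(\Omega)}\le C\|e^{\lambda x}f\|_{H^{-\alpha/2}(\Omega)}$. -/

import Mathlib

open MeasureTheory Set
open scoped ENNReal NNReal FourierTransform ContDiff

namespace TemperedFrac

noncomputable section

/-- Real `L²(Ω)`, `Ω = (a, b)`. -/
abbrev L2 (a b : ℝ) : Type := Lp ℝ 2 (volume.restrict (Ioo a b))

/-! ### Tempered Riemann-Liouville derivatives of order `0 < μ < 1` -/

/-- Left tempered Riemann-Liouville derivative on `(a, ·)`, for `0 ≤ μ < 1`:
`e^{-λx} / Γ(1-μ) · d/dx ∫_a^x e^{λξ} u(ξ) (x-ξ)^{-μ} dξ`.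
If `u` is the class of a function of `H₀^μ(a,b)`, `0 < μ < 1`, the integral is an absolutely
continuous function of `x` with derivative in `L²(a,b)`; so the derivative exists almost everywhere
in `(a,b)`, and the result is the value at `u` of the continuous extension
`H₀^μ(a,b) → L²(a,b)` of the operator on `C₀^∞(a,b)`. -/
def leftDeriv (a μ lam : ℝ) (u : ℝ → ℝ) (x : ℝ) : ℝ :=
  Real.exp (-lam * x) / Real.Gamma (1 - μ) *
    deriv (fun y => ∫ ξ in a..y, Real.exp (lam * ξ) * u ξ / (y - ξ) ^ μ) x

/-- Right tempered Riemann-Liouville derivative on `(·, b)`, for `0 ≤ μ < 1`: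
`- e^{λx} / Γ(1-μ) · d/dx ∫_x^b e^{-λξ} u(ξ) (ξ-x)^{-μ} dξ`. -/
def rightDeriv (b μ lam : ℝ) (u : ℝ → ℝ) (x : ℝ) : ℝ :=
  -(Real.exp (lam * x) / Real.Gamma (1 - μ)) *
    deriv (fun y => ∫ ξ in y..b, Real.exp (-lam * ξ) * u ξ / (ξ - y) ^ μ) x

/-! ### Fractional Sobolev spaces -/

/-- The weight `|t|^μ` times the Fourier transform `ŵ(t) = ∫ e^{-itx} w(x) dx`.
Mathlib's transform is `𝓕 w ξ = ∫ e^{-2πiξx} w(x) dx`, whence the argument `t / 2π`. -/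
def weightedFourier (μ : ℝ) (w : Lp ℂ 2 (volume : Measure ℝ)) (t : ℝ) : ℂ :=
  (|t| ^ μ) • (𝓕 w : Lp ℂ 2 (volume : Measure ℝ)) ((2 * Real.pi)⁻¹ * t)

/-- `|w|_{H^μ(ℝ)} = (∫ |t|^{2μ} |ŵ(t)|² dt)^{1/2}`, which is `∞` if `w ∉ H^μ(ℝ)`. -/
def seminormLine (μ : ℝ) (w : Lp ℂ 2 (volume : Measure ℝ)) : ℝ≥0∞ :=
  eLpNorm (weightedFourier μ w) 2 volume

/-- `|u|_{H^μ(Ω)}`: the infimum of `|w|_{H^μ(ℝ)}` over the `w` that restrict to `u` on `Ω`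
(`∞` if no such `w` lies in `H^μ(ℝ)`, that is, if `u ∉ H^μ(Ω)`). -/
def seminormOn (a b μ : ℝ) (u : L2 a b) : ℝ≥0∞ :=
  ⨅ (w : Lp ℂ 2 (volume : Measure ℝ))
    (_ : ∀ᵐ x ∂(volume.restrict (Ioo a b)), w x = ((u x : ℝ) : ℂ)), seminormLine μ w

/-- `‖u‖_{H^μ(Ω)} = (‖u‖²_{L²(Ω)} + |u|²_{H^μ(Ω)})^{1/2}`. -/
def sobolevNorm (a b μ : ℝ) (u : L2 a b) : ℝ≥0∞ :=
  (‖u‖ₑ ^ (2 : ℝ) + seminormOn a b μ u ^ (2 : ℝ)) ^ (1 / 2 : ℝ)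

/-- The (classes of) real functions in `C₀^∞(Ω)`. -/
def testFunctions (a b : ℝ) : Submodule ℝ (L2 a b) where
  carrier := {u | ∃ φ : ℝ → ℝ, ContDiff ℝ ∞ φ ∧ HasCompactSupport φ ∧ tsupport φ ⊆ Ioo a b ∧
    u =ᵐ[volume.restrict (Ioo a b)] φ}
  zero_mem' := ⟨0, contDiff_const, HasCompactSupport.zero, by simp [tsupport], Lp.coeFn_zero _ _ _⟩
  add_mem' := by
    rintro u v ⟨φ, h1, h2, h3, h4⟩ ⟨ψ, k1, k2, k3, k4⟩
    refine ⟨φ + ψ, h1.add k1, h2.add k2, ?_, (Lp.coeFn_add u v).trans (h4.add k4)⟩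
    exact (tsupport_add φ ψ).trans (union_subset h3 k3)
  smul_mem' := by
    rintro c u ⟨φ, h1, h2, h3, h4⟩
    refine ⟨c • φ, contDiff_const.smul h1, h2.smul_left, ?_,
      (Lp.coeFn_smul c u).trans (h4.const_smul c)⟩
    exact (tsupport_smul_subset_right (fun _ => c) φ).trans h3

theorem aestronglyMeasurable_weightedFourier (μ : ℝ) (w : Lp ℂ 2 (volume : Measure ℝ)) :
    AEStronglyMeasurable (weightedFourier μ w) volume := by
  have hq : Measure.QuasiMeasurePreserving (fun t : ℝ => (2 * Real.pi)⁻¹ * t) volume volume := by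
    refine ⟨measurable_const_mul _, ?_⟩
    rw [Real.map_volume_mul_left (inv_ne_zero (by positivity))]
    exact Measure.smul_absolutelyContinuous
  have h1 : Measurable fun t : ℝ => |t| ^ μ := by fun_prop
  exact h1.aestronglyMeasurable.smul
    ((Lp.aestronglyMeasurable (𝓕 w : Lp ℂ 2 (volume : Measure ℝ))).comp_quasiMeasurePreserving hq)

theorem ae_scale {p : ℝ → Prop} (h : ∀ᵐ x, p x) : ∀ᵐ t : ℝ, p ((2 * Real.pi)⁻¹ * t) := by
  have hq : Measure.QuasiMeasurePreserving (fun t : ℝ => (2 * Real.pi)⁻¹ * t) volume volume := by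
    refine ⟨measurable_const_mul _, ?_⟩
    rw [Real.map_volume_mul_left (inv_ne_zero (by positivity))]
    exact Measure.smul_absolutelyContinuous
  exact hq.ae h

theorem seminormLine_add (μ : ℝ) (w z : Lp ℂ 2 (volume : Measure ℝ)) :
    seminormLine μ (w + z) ≤ seminormLine μ w + seminormLine μ z := by
  have h : weightedFourier μ (w + z) =ᵐ[volume] weightedFourier μ w + weightedFourier μ z := by
    filter_upwards [ae_scale (Lp.coeFn_add (𝓕 w : Lp ℂ 2 (volume : Measure ℝ)) (𝓕 z))] with t ht
    simp only [weightedFourier, Pi.add_apply, FourierTransform.fourier_add] at ht ⊢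
    rw [ht, smul_add]
  rw [seminormLine, eLpNorm_congr_ae h]
  exact eLpNorm_add_le (aestronglyMeasurable_weightedFourier μ w)
    (aestronglyMeasurable_weightedFourier μ z) (by norm_num)

theorem seminormLine_smul (μ : ℝ) (c : ℂ) (w : Lp ℂ 2 (volume : Measure ℝ)) :
    seminormLine μ (c • w) ≤ ‖c‖ₑ * seminormLine μ w := by
  have h : weightedFourier μ (c • w) =ᵐ[volume] c • weightedFourier μ w := by
    filter_upwards [ae_scale (Lp.coeFn_smul c (𝓕 w : Lp ℂ 2 (volume : Measure ℝ)))] with t ht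
    simp only [weightedFourier, Pi.smul_apply, FourierTransform.fourier_smul] at ht ⊢
    rw [ht, smul_comm]
  rw [seminormLine, eLpNorm_congr_ae h]
  exact eLpNorm_const_smul_le

theorem seminormOn_add (a b μ : ℝ) (u v : L2 a b) :
    seminormOn a b μ (u + v) ≤ seminormOn a b μ u + seminormOn a b μ v := by
  simp only [seminormOn, ENNReal.iInf_add, ENNReal.add_iInf]
  refine le_iInf fun z => le_iInf fun hz => le_iInf fun w => le_iInf fun hw => ?_
  refine (iInf₂_le (w + z) ?_).trans (seminormLine_add μ w z)
  filter_upwards [hw, hz, ae_restrict_of_ae (Lp.coeFn_add w z), Lp.coeFn_add u v]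
    with x h1 h2 h3 h4
  rw [h3, h4, Pi.add_apply, Pi.add_apply, h1, h2, Complex.ofReal_add]

theorem seminormOn_smul (a b μ : ℝ) (c : ℝ) (hc : c ≠ 0) (u : L2 a b) :
    seminormOn a b μ (c • u) ≤ ‖c‖ₑ * seminormOn a b μ u := by
  have hc' : ‖c‖ₑ ≠ 0 := by simpa using hc
  simp only [seminormOn]
  rw [ENNReal.mul_iInf_of_ne hc' (by simp)]
  refine le_iInf fun w => ?_
  rw [ENNReal.mul_iInf_of_ne hc' (by simp)]
  refine le_iInf fun hw => ?_
  have h : ‖(c : ℂ)‖ₑ = ‖c‖ₑ := by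
    simp [enorm_eq_nnnorm]
  rw [← h]
  refine (iInf₂_le ((c : ℂ) • w) ?_).trans (seminormLine_smul μ c w)
  filter_upwards [hw, ae_restrict_of_ae (Lp.coeFn_smul (c : ℂ) w), Lp.coeFn_smul c u]
    with x h1 h2 h3
  rw [h2, h3, Pi.smul_apply, Pi.smul_apply, h1, smul_eq_mul, smul_eq_mul, Complex.ofReal_mul]

theorem sobolevNorm_add (a b μ : ℝ) (u v : L2 a b) :
    sobolevNorm a b μ (u + v) ≤ sobolevNorm a b μ u + sobolevNorm a b μ v := by
  have key := ENNReal.Lp_add_le (Finset.univ : Finset (Fin 2))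
    ![‖u‖ₑ, seminormOn a b μ u] ![‖v‖ₑ, seminormOn a b μ v] (p := 2) (by norm_num)
  simp only [Fin.sum_univ_two, Matrix.cons_val_zero, Matrix.cons_val_one] at key
  refine le_trans ?_ key
  unfold sobolevNorm
  gcongr
  · exact enorm_add_le u v
  · exact seminormOn_add a b μ u v

theorem sobolevNorm_smul (a b μ : ℝ) (c : ℝ) (hc : c ≠ 0) (u : L2 a b) :
    sobolevNorm a b μ (c • u) ≤ ‖c‖ₑ * sobolevNorm a b μ u := by
  have h : ‖c‖ₑ * sobolevNorm a b μ u
      = ((‖c‖ₑ * ‖u‖ₑ) ^ (2 : ℝ) + (‖c‖ₑ * seminormOn a b μ u) ^ (2 : ℝ)) ^ (1 / 2 : ℝ) := by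
    rw [ENNReal.mul_rpow_of_nonneg _ _ (by norm_num), ENNReal.mul_rpow_of_nonneg _ _ (by norm_num),
      ← mul_add, ENNReal.mul_rpow_of_nonneg _ _ (by norm_num), ← ENNReal.rpow_mul]
    norm_num [sobolevNorm]
  rw [h]
  unfold sobolevNorm
  gcongr
  · exact (enorm_smul c u).le
  · exact seminormOn_smul a b μ c hc u

theorem sobolevNorm_zero (a b μ : ℝ) : sobolevNorm a b μ 0 = 0 := by
  have h0 : seminormLine μ 0 = 0 := by
    have := seminormLine_smul μ 0 0
    simpa using this
  have h : seminormOn a b μ 0 = 0 := by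
    refine le_antisymm ((iInf₂_le 0 ?_).trans h0.le) bot_le
    filter_upwards [ae_restrict_of_ae (Lp.coeFn_zero ℂ 2 (volume : Measure ℝ)),
      Lp.coeFn_zero ℝ 2 (volume.restrict (Ioo a b))] with x h1 h2
    rw [h1, h2]
    simp
  simp [sobolevNorm, h]

/-- `H₀^μ(Ω)`: the closure of `C₀^∞(Ω)` with respect to `‖·‖_{H^μ(Ω)}`. -/
def H0 (a b μ : ℝ) : Submodule ℝ (L2 a b) where
  carrier := {u | ∀ ε : ℝ≥0∞, 0 < ε → ∃ φ ∈ testFunctions a b, sobolevNorm a b μ (u - φ) < ε}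
  zero_mem' := fun ε hε => ⟨0, zero_mem _, by simpa [sobolevNorm_zero] using hε⟩
  add_mem' := by
    intro u v hu hv ε hε
    obtain ⟨φ, hφ, h1⟩ := hu (ε / 2) (ENNReal.half_pos hε.ne')
    obtain ⟨ψ, hψ, h2⟩ := hv (ε / 2) (ENNReal.half_pos hε.ne')
    refine ⟨φ + ψ, add_mem hφ hψ, ?_⟩
    rw [add_sub_add_comm]
    refine (sobolevNorm_add a b μ _ _).trans_lt ?_
    exact (ENNReal.add_lt_add h1 h2).trans_eq (ENNReal.add_halves ε)
  smul_mem' := by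
    intro c u hu ε hε
    rcases eq_or_ne c 0 with rfl | hc
    · exact ⟨0, zero_mem _, by simpa [sobolevNorm_zero] using hε⟩
    · have hc' : ‖c‖ₑ ≠ 0 := by simpa using hc
      obtain ⟨φ, hφ, h1⟩ := hu (ε / ‖c‖ₑ) (ENNReal.div_pos hε.ne' (by simp))
      refine ⟨c • φ, Submodule.smul_mem _ _ hφ, ?_⟩
      rw [← smul_sub]
      refine (sobolevNorm_smul a b μ c hc _).trans_lt ?_
      rw [mul_comm]
      exact (ENNReal.lt_div_iff_mul_lt (Or.inl hc') (Or.inl (by simp))).1 h1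

/-- The dual norm `sup {|F v| : v ∈ H₀^μ(Ω), ‖v‖_{H^μ(Ω)} ≤ 1}` of `H^{-μ}(Ω)`. -/
def dualNorm {a b μ : ℝ} (F : H0 a b μ → ℝ) : ℝ≥0∞ :=
  ⨆ (v : H0 a b μ) (_ : sobolevNorm a b μ v ≤ 1), ‖F v‖ₑ

/-- `H^{-μ}(Ω)`, the space of bounded linear functionals on `H₀^μ(Ω)`. -/
structure HNeg (a b μ : ℝ) where
  toLin : H0 a b μ →ₗ[ℝ] ℝ
  bounded : dualNorm toLin < ⊤

open Classical in
/-- The duality pairing `⟨f, v⟩` of `f ∈ H^{-μ}(Ω)` with `v ∈ H₀^μ(Ω)`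
(the value outside `H₀^μ(Ω)` is irrelevant). -/
def HNeg.pair {a b μ : ℝ} (f : HNeg a b μ) (v : L2 a b) : ℝ :=
  if h : v ∈ H0 a b μ then f.toLin ⟨v, h⟩ else 0

/-! ### Multiplication by exponentials -/

theorem memLp_exp_mul (a b rho : ℝ) (u : L2 a b) :
    MemLp (fun x => Real.exp (rho * x) * u x) 2 (volume.restrict (Ioo a b)) := by
  refine (Lp.memLp u).of_le_mul (c := Real.exp (|rho| * max |a| |b|)) ?_ ?_
  · exact (by fun_prop : Continuous fun x : ℝ => Real.exp (rho * x)).aestronglyMeasurable.mul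
      (Lp.aestronglyMeasurable u)
  · refine (ae_restrict_iff' measurableSet_Ioo).2 (Filter.Eventually.of_forall fun x hx => ?_)
    rw [norm_mul, Real.norm_eq_abs (Real.exp _), abs_of_pos (Real.exp_pos _)]
    refine mul_le_mul_of_nonneg_right (Real.exp_le_exp.2 ?_) (norm_nonneg _)
    calc rho * x ≤ |rho * x| := le_abs_self _
      _ = |rho| * |x| := abs_mul _ _
      _ ≤ |rho| * max |a| |b| := by
        gcongr
        exact abs_le_max_abs_abs hx.1.le hx.2.le

/-- Multiplication by `e^{ρx}` on `L²(Ω)`. -/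
def expMul (a b rho : ℝ) : L2 a b →ₗ[ℝ] L2 a b where
  toFun u := (memLp_exp_mul a b rho u).toLp _
  map_add' u v := by
    apply Lp.ext
    filter_upwards [(memLp_exp_mul a b rho (u + v)).coeFn_toLp,
      (memLp_exp_mul a b rho u).coeFn_toLp, (memLp_exp_mul a b rho v).coeFn_toLp,
      Lp.coeFn_add u v,
      Lp.coeFn_add ((memLp_exp_mul a b rho u).toLp _) ((memLp_exp_mul a b rho v).toLp _)]
      with x h1 h2 h3 h4 h5
    rw [h1, h5, Pi.add_apply, h2, h3, h4, Pi.add_apply]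
    ring
  map_smul' c u := by
    apply Lp.ext
    filter_upwards [(memLp_exp_mul a b rho (c • u)).coeFn_toLp,
      (memLp_exp_mul a b rho u).coeFn_toLp, Lp.coeFn_smul c u,
      Lp.coeFn_smul c ((memLp_exp_mul a b rho u).toLp _)]
      with x h1 h2 h3 h4
    rw [RingHom.id_apply, h1, h4, Pi.smul_apply, h2, h3, Pi.smul_apply, smul_eq_mul, smul_eq_mul]
    ring

/-- The functional `e^{ρx} f`, given by `⟨e^{ρx} f, v⟩ = ⟨f, e^{ρx} v⟩` for `v ∈ H₀^μ(Ω)`. -/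
def expMulDual {a b μ : ℝ} (rho : ℝ) (f : HNeg a b μ) (v : H0 a b μ) : ℝ :=
  f.pair (expMul a b rho v)

/-! ### The bilinear forms and the two weak formulations -/

/-- The `L²(a,b)` inner product of two real functions. -/
def ip (a b : ℝ) (f g : ℝ → ℝ) : ℝ := ∫ x in Ioo a b, f x * g x

/-- The bilinear form of `-ₐD^{α,λ} u = f`:
`-(ₐ𝔻^{α/2,λ} u, 𝔻_b^{α/2,λ} v) + αλ^{α-1} (ₐD^{α/2} u, D_b^{1-α/2} v) + λ^α (u, v)`. -/
def formA1 (a b α lam : ℝ) (u v : L2 a b) : ℝ :=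
  -ip a b (leftDeriv a (α / 2) lam u) (rightDeriv b (α / 2) lam v)
    + α * lam ^ (α - 1) * ip a b (leftDeriv a (α / 2) 0 u) (rightDeriv b (1 - α / 2) 0 v)
    + lam ^ α * ip a b u v

/-- The bilinear form of the companion equation
`-ₐD^α u₁ + αλ^{α-1} u₁' + (1-α)λ^α u₁ = e^{λx} f`. -/
def formA2 (a b α lam : ℝ) (u v : L2 a b) : ℝ :=
  -ip a b (leftDeriv a (α / 2) 0 u) (rightDeriv b (α / 2) 0 v)
    + α * lam ^ (α - 1) * ip a b (leftDeriv a (α / 2) 0 u) (rightDeriv b (1 - α / 2) 0 v)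
    + (1 - α) * lam ^ α * ip a b u v

/-- Petrov-Galerkin formulation: `u ∈ e^{-λx} H₀^{α/2}(Ω)` and `A₁(u, v) = ⟨f, v⟩` for all
`v ∈ e^{λx} H₀^{α/2}(Ω)`. -/
def IsPetrovGalerkinSolution {a b α : ℝ} (lam : ℝ) (f : HNeg a b (α / 2)) (u : L2 a b) : Prop :=
  u ∈ (H0 a b (α / 2)).map (expMul a b (-lam)) ∧
    ∀ v ∈ (H0 a b (α / 2)).map (expMul a b lam), formA1 a b α lam u v = f.pair v

/-- Galerkin formulation of the companion equation: `u₁ ∈ H₀^{α/2}(Ω)` and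
`A₂(u₁, v₁) = ⟨e^{λx} f, v₁⟩` for all `v₁ ∈ H₀^{α/2}(Ω)`. -/
def IsGalerkinSolution {a b α : ℝ} (lam : ℝ) (f : HNeg a b (α / 2)) (u : L2 a b) : Prop :=
  u ∈ H0 a b (α / 2) ∧
    ∀ v : H0 a b (α / 2), formA2 a b α lam u v = expMulDual lam f v

end

end TemperedFrac

namespace TemperedFrac

noncomputable section

/-! Exponentials conjugate the tempering away. With u = e^{-λx}u₁ and v = e^{λx}v₁ the form A₁
becomes A₂ (`formA1_expMul`): the factors cancel in the first and last products, while the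
untempered middle product drops by λ(u₁, v₁), and αλ^{α-1}·λ turns the coefficient λ^α into
(1-α)λ^α. Multiplication by e^{ρx} maps H₀ into itself with a bound uniform for bounded ρ
(`exists_sobolevNorm_expMul_le`), so the two formulations are one problem, solved by Lax-Milgram. On
the Fourier side A₂(u, v) is, up to normalization, ∫ p û conj(v̂) with p = -(iω)^α + αλ^{α-1}iω +
(1-α)λ^α (`formA2_eq_fourierForm`). The first order term is imaginary, so Re p = |cos(πα/2)||ω|^α -
(α-1)λ^α. By a Poincaré inequality for functions supported in (a, b) (`poincare`) and the smallness
of λ^α, half of the leading term absorbs the negative one (`coercive_formA2`). Two gaps must be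
bridged. The Sobolev norm is an infimum over all extensions, whereas the Fourier argument uses the
extension by zero. For s = α/2 > 1/2 a fractional Hardy inequality (`exists_hardy`), applied through
Gagliardo double integrals (`gagliardo_eq`), makes the two comparable on test functions, and Fatou's
lemma carries this to the closure (`exists_energy_le_of_mem_H0`). Moreover, the fractional
derivatives are pointwise derivatives of integrals; `fourierInv_ae_eq_deriv` identifies them almost
everywhere with the multipliers (±iω)^σ. For Lax-Milgram, weighted Fourier transforms turn H₀ with
the energy norm into a closed subspace of L²(ℝ) (`isClosed_weightedRange`), on which the form is
given by a bounded multiplier. -/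

/-! ### The Fourier transform on L², multipliers and translations -/

/-- Complex `L²(ℝ)`. -/
abbrev CL2 : Type := Lp ℂ 2 (volume : Measure ℝ)

/-- Both sides give the same integral against every smooth compactly supported G, namely ∫ (𝓕 G) f:
for the L² transform through tempered distributions, for the integral transform by Fubini. -/
theorem fourier_toLp_ae_eq {f : ℝ → ℂ} (h1 : Integrable f) (h2 : MemLp f 2) :
    (𝓕 (h2.toLp f) : CL2) =ᵐ[volume] 𝓕 f := by
  refine ae_eq_of_integral_contDiff_smul_eq ((Lp.memLp _).locallyIntegrable (by norm_num))
    ?_ fun g hg hc => ?_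
  · exact (VectorFourier.fourierIntegral_continuous Real.continuous_fourierChar
      (innerSL ℝ).continuous₂ h1).locallyIntegrable
  have hg₁ : HasCompactSupport (Complex.ofRealCLM ∘ g) := hc.comp_left rfl
  have hg₂ : ContDiff ℝ ∞ (Complex.ofRealCLM ∘ g) := by fun_prop
  set G := hg₁.toSchwartzMap hg₂ with hG
  have e1 : ∫ x, g x • (𝓕 (h2.toLp f) : CL2) x =
      Lp.toTemperedDistribution (𝓕 (h2.toLp f) : CL2) G := by
    simp [hG]
  have e2 : Lp.toTemperedDistribution (𝓕 (h2.toLp f) : CL2) G = ∫ x, (𝓕 G) x • (h2.toLp f) x := by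
    rw [← Lp.fourier_toTemperedDistribution_eq, TemperedDistribution.fourier_apply,
      Lp.toTemperedDistribution_apply]
  have e3 : ∫ x, (𝓕 G) x • (h2.toLp f) x = ∫ x, (𝓕 (G : ℝ → ℂ)) x • f x := by
    refine integral_congr_ae ?_
    filter_upwards [h2.coeFn_toLp] with x hx
    rw [hx, SchwartzMap.fourier_coe]
  have e4 := VectorFourier.integral_fourierIntegral_smul_eq_flip (L := innerₗ ℝ)
    Real.continuous_fourierChar (innerSL ℝ).continuous₂
    (μ := volume) (ν := volume) (f := (G : ℝ → ℂ)) (g := f) G.integrable h1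
  rw [e1, e2, e3]
  refine e4.trans ?_
  refine integral_congr_ae (Filter.Eventually.of_forall fun x => ?_)
  simp only [flip_innerₗ]
  simp only [hG, HasCompactSupport.toSchwartzMap_toFun, Function.comp_apply]
  rfl

/-- The same duality argument with the pairing `-innerₗ ℝ`, whose Fourier integral is the inverse
transform. -/
theorem fourierInv_toLp_ae_eq {f : ℝ → ℂ} (h1 : Integrable f) (h2 : MemLp f 2) :
    (𝓕⁻ (h2.toLp f) : CL2) =ᵐ[volume] 𝓕⁻ f := by
  refine ae_eq_of_integral_contDiff_smul_eq ((Lp.memLp _).locallyIntegrable (by norm_num))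
    ?_ fun g hg hc => ?_
  · exact (VectorFourier.fourierIntegral_continuous Real.continuous_fourierChar
      (-innerSL ℝ : ℝ →L[ℝ] ℝ →L[ℝ] ℝ).continuous₂ h1).locallyIntegrable
  have hg₁ : HasCompactSupport (Complex.ofRealCLM ∘ g) := hc.comp_left rfl
  have hg₂ : ContDiff ℝ ∞ (Complex.ofRealCLM ∘ g) := by fun_prop
  set G := hg₁.toSchwartzMap hg₂ with hG
  have e1 : ∫ x, g x • (𝓕⁻ (h2.toLp f) : CL2) x =
      Lp.toTemperedDistribution (𝓕⁻ (h2.toLp f) : CL2) G := by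
    simp [hG]
  have e2 : Lp.toTemperedDistribution (𝓕⁻ (h2.toLp f) : CL2) G = ∫ x, (𝓕⁻ G) x • (h2.toLp f) x := by
    rw [← Lp.fourierInv_toTemperedDistribution_eq, TemperedDistribution.fourierInv_apply,
      Lp.toTemperedDistribution_apply]
  have e3 : ∫ x, (𝓕⁻ G) x • (h2.toLp f) x = ∫ x, (𝓕⁻ (G : ℝ → ℂ)) x • f x := by
    refine integral_congr_ae ?_
    filter_upwards [h2.coeFn_toLp] with x hx
    rw [hx, SchwartzMap.fourierInv_coe]
  have e4 := VectorFourier.integral_fourierIntegral_smul_eq_flip (L := -innerₗ ℝ)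
    Real.continuous_fourierChar (-innerSL ℝ : ℝ →L[ℝ] ℝ →L[ℝ] ℝ).continuous₂
    (μ := volume) (ν := volume) (f := (G : ℝ → ℂ)) (g := f) G.integrable h1
  rw [e1, e2, e3]
  refine e4.trans ?_
  refine integral_congr_ae (Filter.Eventually.of_forall fun x => ?_)
  rw [show (-innerₗ ℝ).flip = -innerₗ ℝ by
    ext; simp]
  simp only [hG, HasCompactSupport.toSchwartzMap_toFun, Function.comp_apply]
  rfl

/-- Multiplication by a bounded measurable function, as a bounded operator on `L²`. -/
def mulL (q : ℝ → ℂ) (hq : MemLp q ∞ (volume : Measure ℝ)) : CL2 →L[ℂ] CL2 :=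
  (ContinuousLinearMap.lsmul ℂ ℂ).holderL volume ∞ 2 2 (hq.toLp q)

theorem coeFn_mulL {q : ℝ → ℂ} (hq : MemLp q ∞ (volume : Measure ℝ)) (w : CL2) :
    mulL q hq w =ᵐ[volume] fun x => q x * w x := by
  filter_upwards [(ContinuousLinearMap.lsmul ℂ ℂ).coeFn_holder (r := 2) (hq.toLp q) w,
    hq.coeFn_toLp] with x h1 h2
  rw [← h2]
  exact h1

/-- Translation `w ↦ w(· + h)`. -/
def translate (h : ℝ) : CL2 →L[ℂ] CL2 :=
  (Lp.compMeasurePreservingₗᵢ ℂ (fun x : ℝ => x + h)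
    (measurePreserving_add_right volume h)).toContinuousLinearMap

theorem coeFn_translate (h : ℝ) (w : CL2) :
    translate h w =ᵐ[volume] fun x => w (x + h) :=
  Lp.coeFn_compMeasurePreserving w (measurePreserving_add_right volume h)

theorem memLp_fourierChar (h : ℝ) :
    MemLp (fun ξ : ℝ => (Real.fourierChar (h * ξ) : ℂ)) ∞ (volume : Measure ℝ) := by
  refine memLp_top_of_bound (Continuous.aestronglyMeasurable (by
    exact continuous_subtype_val.comp (Real.continuous_fourierChar.comp (by fun_prop)))) 1
    (Filter.Eventually.of_forall fun x => ?_)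
  exact (Circle.norm_coe _).le

/-- Both sides are continuous in w, so the shift formula for Fourier integrals of Schwartz functions
suffices by density. -/
theorem fourier_translate (h : ℝ) (w : CL2) :
    𝓕 (translate h w) = mulL _ (memLp_fourierChar h) (𝓕 w) := by
  refine DenseRange.induction_on (p := fun w : CL2 => 𝓕 (translate h w) =
      mulL _ (memLp_fourierChar h) (𝓕 w))
    (SchwartzMap.denseRange_toLpCLM (p := 2) (E := ℝ) (F := ℂ) ENNReal.ofNat_ne_top) w
    (isClosed_eq ?_ ?_) fun φ => ?_
  · exact (Lp.fourierTransformₗᵢ ℝ ℂ).continuous.comp (translate h).continuous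
  · exact (mulL _ (memLp_fourierChar h)).continuous.comp (Lp.fourierTransformₗᵢ ℝ ℂ).continuous
  have hφ1 : Integrable (φ : ℝ → ℂ) := φ.integrable
  have hφ2 : MemLp (φ : ℝ → ℂ) 2 := φ.memLp 2
  have hψ1 : Integrable (fun x => φ (x + h)) := hφ1.comp_add_right h
  have hψ2 : MemLp (fun x => φ (x + h)) 2 :=
    hφ2.comp_measurePreserving (measurePreserving_add_right volume h)
  have e1 : translate h (SchwartzMap.toLpCLM ℝ ℂ 2 volume φ) = hψ2.toLp _ := by
    apply Lp.ext
    have := (measurePreserving_add_right volume h).quasiMeasurePreserving.ae_eq_comp hφ2.coeFn_toLp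
    filter_upwards [coeFn_translate h (SchwartzMap.toLpCLM ℝ ℂ 2 volume φ), hψ2.coeFn_toLp, this]
      with x h1 h2 h3
    rw [h1, h2]
    exact h3
  have e2 : SchwartzMap.toLpCLM ℝ ℂ 2 volume φ = hφ2.toLp _ := rfl
  rw [e1, e2]
  apply Lp.ext
  filter_upwards [fourier_toLp_ae_eq hψ1 hψ2, coeFn_mulL (memLp_fourierChar h) (𝓕 (hφ2.toLp _)),
    fourier_toLp_ae_eq hφ1 hφ2] with ξ h1 h2 h3
  rw [h1, h2, h3]
  have := congrFun (VectorFourier.fourierIntegral_comp_add_right Real.fourierChar volume (innerₗ ℝ)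
    (φ : ℝ → ℂ) h) ξ
  refine Eq.trans this ?_
  simp [Circle.smul_def, mul_comm]
  rfl

/-! ### Gagliardo and Fourier energies on the line -/

theorem lintegral_comp_mul_left {c : ℝ} (hc : c ≠ 0) {F : ℝ → ℝ≥0∞} (hF : Measurable F) :
    ∫⁻ t, F (c * t) = ENNReal.ofReal |c⁻¹| * ∫⁻ t, F t := by
  rw [← lintegral_map hF (measurable_const_mul c), Real.map_volume_mul_left hc,
    lintegral_smul_measure, smul_eq_mul]

theorem enorm_sq_eq_lintegral {X E : Type*} [MeasurableSpace X] {ν : Measure X}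
    [NormedAddCommGroup E] (w : Lp E 2 ν) : ‖w‖ₑ ^ 2 = ∫⁻ x, ‖w x‖ₑ ^ 2 ∂ν := by
  rw [Lp.enorm_def, eLpNorm_eq_lintegral_rpow_enorm_toReal (by norm_num) (by norm_num),
    ← ENNReal.rpow_natCast, ← ENNReal.rpow_mul]
  norm_num

theorem eLpNorm_two_sq {X E : Type*} [MeasurableSpace X] {ν : Measure X}
    [NormedAddCommGroup E] (w : X → E) : eLpNorm w 2 ν ^ 2 = ∫⁻ x, ‖w x‖ₑ ^ 2 ∂ν := by
  rw [eLpNorm_eq_lintegral_rpow_enorm_toReal (by norm_num) (by norm_num),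
    ← ENNReal.rpow_natCast, ← ENNReal.rpow_mul]
  norm_num

/-- The energy `∫ |2πξ|^{2s} |𝓕 w ξ|² dξ`. -/
def fourierEnergy (s : ℝ) (w : CL2) : ℝ≥0∞ :=
  ∫⁻ ξ, ENNReal.ofReal (|2 * Real.pi * ξ| ^ (2 * s)) * ‖(𝓕 w : CL2) ξ‖ₑ ^ 2

theorem measurable_coeFn (w : CL2) : Measurable (w : ℝ → ℂ) :=
  (Lp.stronglyMeasurable w).measurable

/-- Substitution t = 2πξ; the factor 2π is its Jacobian. -/
theorem seminormLine_sq (s : ℝ) (w : CL2) :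
    seminormLine s w ^ 2 = ENNReal.ofReal (2 * Real.pi) * fourierEnergy s w := by
  have hpi : (0 : ℝ) < 2 * Real.pi := by positivity
  rw [seminormLine, eLpNorm_two_sq]
  have h := lintegral_comp_mul_left (c := (2 * Real.pi)⁻¹) (inv_ne_zero hpi.ne')
    (F := fun ξ => ENNReal.ofReal (|2 * Real.pi * ξ| ^ (2 * s)) * ‖(𝓕 w : CL2) ξ‖ₑ ^ 2)
    (by have := measurable_coeFn (𝓕 w : CL2); fun_prop)
  rw [inv_inv, abs_of_pos hpi] at h
  rw [fourierEnergy, ← h]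
  refine lintegral_congr fun t => ?_
  rw [weightedFourier, enorm_smul, mul_pow]
  congr 1
  rw [← mul_assoc, mul_inv_cancel₀ hpi.ne', one_mul, mul_comm 2 s, Real.rpow_mul (abs_nonneg _),
    Real.enorm_of_nonneg (by positivity), ← ENNReal.ofReal_pow (by positivity)]
  norm_num

theorem lintegral_even {F : ℝ → ℝ≥0∞} (hF : ∀ z, F (-z) = F z) :
    ∫⁻ z, F z = 2 * ∫⁻ z in Ioi 0, F z := by
  have h1 : ∫⁻ z in Iio 0, F z = ∫⁻ z in Ioi 0, F z := by
    have := (Measure.measurePreserving_neg (volume : Measure ℝ)).setLIntegral_comp_preimage_emb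
      (MeasurableEquiv.neg ℝ).measurableEmbedding F (Ioi 0)
    rw [← this]
    simp [hF]
  have h2 : ∫⁻ z in Ici 0, F z = ∫⁻ z in Ioi 0, F z := setLIntegral_congr Ioi_ae_eq_Ici.symm
  rw [← lintegral_add_compl F (measurableSet_Iio (a := (0 : ℝ))), compl_Iio, h1, h2, two_mul]

/-- The truncated kernel mass `∫ min(1, z²) |z|^{-1-2s} dz`. -/
def kernelMass (s : ℝ) : ℝ≥0∞ :=
  ∫⁻ z : ℝ, ENNReal.ofReal (min 1 (z ^ 2)) * ENNReal.ofReal (|z| ^ (-1 - 2 * s))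

/-- Near 0 the integrand is at most z^{1-2s}, integrable because s < 1; at infinity it is at most
z^{-1-2s}, integrable because s > 0. -/
theorem kernelMass_lt_top {s : ℝ} (h0 : 0 < s) (h1 : s < 1) : kernelMass s < ⊤ := by
  rw [kernelMass, lintegral_even (by simp)]
  refine ENNReal.mul_lt_top (by norm_num) ?_
  rw [← Ioo_union_Ici_eq_Ioi (zero_lt_one' ℝ)]
  refine (lintegral_union_le _ _ _).trans_lt (ENNReal.add_lt_top.2 ⟨?_, ?_⟩)
  · have h := (intervalIntegral.integrableOn_Ioo_rpow_iff (s := 1 - 2 * s) zero_lt_one).2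
      (by linarith)
    refine lt_of_le_of_lt ?_ h.lintegral_lt_top
    refine setLIntegral_mono' measurableSet_Ioo fun z hz => ?_
    rw [← ENNReal.ofReal_mul (by positivity)]
    refine ENNReal.ofReal_le_ofReal ?_
    rw [abs_of_pos hz.1]
    calc min 1 (z ^ 2) * z ^ (-1 - 2 * s) ≤ z ^ 2 * z ^ (-1 - 2 * s) := by
          gcongr
          · exact Real.rpow_nonneg hz.1.le _
          · exact min_le_right _ _
      _ = z ^ (1 - 2 * s) := by
          rw [← Real.rpow_natCast, ← Real.rpow_add hz.1]; norm_num; ring_nf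
  · rw [setLIntegral_congr Ioi_ae_eq_Ici.symm]
    have h := integrableOn_Ioi_rpow_of_lt (a := -1 - 2 * s) (by linarith) zero_lt_one
    refine lt_of_le_of_lt ?_ h.lintegral_lt_top
    refine setLIntegral_mono' measurableSet_Ioi fun z hz => ?_
    rw [← ENNReal.ofReal_mul (by positivity)]
    refine ENNReal.ofReal_le_ofReal ?_
    have hz0 : (0 : ℝ) < z := lt_trans zero_lt_one hz
    rw [abs_of_pos hz0]
    exact mul_le_of_le_one_left (Real.rpow_nonneg hz0.le _) (min_le_left _ _)

/-- The constant relating the Gagliardo and the Fourier seminorm. -/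
def gagliardoConst (s : ℝ) : ℝ≥0∞ :=
  ∫⁻ z : ℝ, ENNReal.ofReal (|z| ^ (-1 - 2 * s)) * ‖Complex.exp (Complex.I * z) - 1‖ₑ ^ 2

/-- Comparison with `kernelMass` through |e^{iz} - 1|² ≤ 4 min(1, z²). -/
theorem gagliardoConst_lt_top {s : ℝ} (h0 : 0 < s) (h1 : s < 1) : gagliardoConst s < ⊤ := by
  refine lt_of_le_of_lt (b := ENNReal.ofReal 4 * kernelMass s) ?_
    (ENNReal.mul_lt_top (by simp) (kernelMass_lt_top h0 h1))
  rw [kernelMass, ← lintegral_const_mul _ (by fun_prop)]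
  refine lintegral_mono fun z => ?_
  rw [← mul_assoc, mul_comm]
  gcongr
  rw [← ENNReal.ofReal_mul (by norm_num), ← ofReal_norm, ← ENNReal.ofReal_pow (norm_nonneg _)]
  refine ENNReal.ofReal_le_ofReal ?_
  have h2 := Real.norm_exp_I_mul_ofReal_sub_one_le (x := z)
  have h3 : ‖Complex.exp (Complex.I * z) - 1‖ ≤ 2 := by
    refine (norm_sub_le _ _).trans ?_
    rw [mul_comm, Complex.norm_exp_ofReal_mul_I]; norm_num
  rw [mul_min_of_nonneg _ _ (by norm_num)]
  refine le_min ?_ ?_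
  · nlinarith [norm_nonneg (Complex.exp (Complex.I * z) - 1)]
  · have := pow_le_pow_left₀ (norm_nonneg _) h2 2
    rw [Real.norm_eq_abs, sq_abs] at this
    nlinarith [sq_nonneg z]

/-- The integrand is positive on (1, 2), since |e^{iz} - 1| = 2|sin(z/2)|. Nonvanishing allows this
constant to be cancelled when energies are compared. -/
theorem gagliardoConst_ne_zero (s : ℝ) : gagliardoConst s ≠ 0 := by
  intro h
  have h' := (lintegral_eq_zero_iff (by fun_prop)).1 h
  have h2 : ∀ᵐ z : ℝ, z ∉ Ioo (1 : ℝ) 2 := by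
    filter_upwards [h'] with z hz hz'
    have h0 : (0 : ℝ) < z := by linarith [hz'.1]
    simp only [Pi.zero_apply, mul_eq_zero, ENNReal.ofReal_eq_zero] at hz
    rcases hz with hz | hz
    · exact absurd hz (not_le.2 (Real.rpow_pos_of_pos (abs_pos.2 h0.ne') _))
    · rw [← ofReal_norm, Complex.norm_exp_I_mul_ofReal_sub_one] at hz
      have hs : 0 < Real.sin (z / 2) :=
        Real.sin_pos_of_pos_of_lt_pi (by linarith) (by linarith [hz'.2, Real.pi_gt_three])
      have : 0 < ‖2 * Real.sin (z / 2)‖ := by rw [norm_pos_iff]; positivity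
      simp at hz
      linarith
  have h3 : volume (Ioo (1 : ℝ) 2) = 0 := by
    simpa only [not_not, ofPred_mem_eq] using ae_iff.1 h2
  norm_num at h3

/-- The Gagliardo energy of a function on the line. -/
def gagliardo (s : ℝ) (w : ℝ → ℂ) : ℝ≥0∞ :=
  ∫⁻ x, ∫⁻ y, ENNReal.ofReal (|x - y| ^ (-1 - 2 * s)) * ‖w x - w y‖ₑ ^ 2

theorem gagliardo_congr_ae {s : ℝ} {w z : ℝ → ℂ} (h : w =ᵐ[volume] z) :
    gagliardo s w = gagliardo s z := by
  refine lintegral_congr_ae ?_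
  filter_upwards [h] with x hx
  refine lintegral_congr_ae ?_
  filter_upwards [h] with y hy
  rw [hx, hy]

/-- Plancherel for w(· + h) - w, whose transform is (e^{2πihξ} - 1) times that of w. -/
theorem lintegral_translate_sub (h : ℝ) (w : CL2) :
    ∫⁻ x, ‖w (x + h) - w x‖ₑ ^ 2
      = ∫⁻ ξ, ‖Complex.exp (Complex.I * ((2 * Real.pi * ξ * h : ℝ) : ℂ)) - 1‖ₑ ^ 2
          * ‖(𝓕 w : CL2) ξ‖ₑ ^ 2 := by
  have e1 : ∫⁻ x, ‖w (x + h) - w x‖ₑ ^ 2 = ‖translate h w - w‖ₑ ^ 2 := by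
    rw [enorm_sq_eq_lintegral]
    refine lintegral_congr_ae ?_
    filter_upwards [Lp.coeFn_sub (translate h w) w, coeFn_translate h w] with x h1 h2
    rw [h1, Pi.sub_apply, h2]
  have e2 : ‖translate h w - w‖ₑ = ‖(𝓕 (translate h w) - 𝓕 w : CL2)‖ₑ := by
    have : (𝓕 (translate h w) - 𝓕 w : CL2) = 𝓕 (translate h w - w) :=
      ((Lp.fourierTransformₗᵢ ℝ ℂ).map_sub _ _).symm
    rw [this, ← ofReal_norm, ← ofReal_norm, Lp.norm_fourier_eq]
  rw [e1, e2, fourier_translate, enorm_sq_eq_lintegral]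
  refine lintegral_congr_ae ?_
  filter_upwards [Lp.coeFn_sub (mulL _ (memLp_fourierChar h) (𝓕 w : CL2)) (𝓕 w : CL2),
    coeFn_mulL (memLp_fourierChar h) (𝓕 w : CL2)] with ξ h1 h2
  rw [h1, Pi.sub_apply, h2, ← mul_pow, ← enorm_mul, sub_mul, one_mul, Real.fourierChar_apply,
    show ((2 * Real.pi * (h * ξ) : ℝ) : ℂ) * Complex.I
      = Complex.I * ((2 * Real.pi * ξ * h : ℝ) : ℂ) by push_cast; ring]

/-- Scaling z = 2πξh. At ξ = 0 both sides vanish, because 0^{2s} = 0. -/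
theorem lintegral_kernel_exp (s ξ : ℝ) (hs : 0 < s) :
    ∫⁻ h : ℝ, ENNReal.ofReal (|h| ^ (-1 - 2 * s)) *
        ‖Complex.exp (Complex.I * ((2 * Real.pi * ξ * h : ℝ) : ℂ)) - 1‖ₑ ^ 2
      = ENNReal.ofReal (|2 * Real.pi * ξ| ^ (2 * s)) * gagliardoConst s := by
  rcases eq_or_ne ξ 0 with rfl | hξ
  · simp [Real.zero_rpow (show 2 * s ≠ 0 by positivity)]
  set c := 2 * Real.pi * ξ with hc
  have hc0 : c ≠ 0 := by positivity
  have hF : Measurable fun z : ℝ => ENNReal.ofReal (|z| ^ (-1 - 2 * s)) *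
      ‖Complex.exp (Complex.I * z) - 1‖ₑ ^ 2 := by fun_prop
  have h := lintegral_comp_mul_left hc0 hF
  have e : ∀ t : ℝ, ENNReal.ofReal (|c * t| ^ (-1 - 2 * s)) *
      ‖Complex.exp (Complex.I * ((c * t : ℝ) : ℂ)) - 1‖ₑ ^ 2
      = ENNReal.ofReal (|c| ^ (-1 - 2 * s)) * (ENNReal.ofReal (|t| ^ (-1 - 2 * s)) *
      ‖Complex.exp (Complex.I * ((c * t : ℝ) : ℂ)) - 1‖ₑ ^ 2) := fun t => by
    rw [abs_mul, Real.mul_rpow (abs_nonneg _) (abs_nonneg _), ENNReal.ofReal_mul (by positivity),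
      mul_assoc]
  rw [lintegral_congr e, lintegral_const_mul _ (by fun_prop)] at h
  have hp : ENNReal.ofReal (|c| ^ (1 + 2 * s)) * ENNReal.ofReal (|c| ^ (-1 - 2 * s)) = 1 := by
    rw [← ENNReal.ofReal_mul (by positivity), ← Real.rpow_add (abs_pos.2 hc0)]
    simp
  have hq : ENNReal.ofReal (|c| ^ (1 + 2 * s)) * ENNReal.ofReal |c⁻¹|
      = ENNReal.ofReal (|c| ^ (2 * s)) := by
    rw [← ENNReal.ofReal_mul (by positivity), abs_inv, ← Real.rpow_neg_one |c|,
      ← Real.rpow_add (abs_pos.2 hc0)]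
    congr 2; ring
  rw [gagliardoConst, ← hq, mul_assoc, ← h, ← mul_assoc, hp, one_mul]

/-- Set y = x + h and integrate in x first: Plancherel applies for each fixed h. After a second
interchange the h-integral is computed by scaling. -/
theorem gagliardo_eq {s : ℝ} (hs : 0 < s) (w : CL2) :
    gagliardo s w = gagliardoConst s * fourierEnergy s w := by
  have hw := measurable_coeFn w
  have hw' := measurable_coeFn (𝓕 w : CL2)
  have e1 : gagliardo s w = ∫⁻ x, ∫⁻ h : ℝ, ENNReal.ofReal (|h| ^ (-1 - 2 * s)) *
      ‖w (x + h) - w x‖ₑ ^ 2 := by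
    refine lintegral_congr fun x => ?_
    rw [← lintegral_add_left_eq_self _ x]
    refine lintegral_congr fun h => ?_
    rw [sub_add_cancel_left, abs_neg, ← enorm_neg, neg_sub]
  rw [e1, lintegral_lintegral_swap (by fun_prop)]
  have e2 : ∀ h : ℝ, ∫⁻ x, ENNReal.ofReal (|h| ^ (-1 - 2 * s)) * ‖w (x + h) - w x‖ₑ ^ 2
      = ∫⁻ ξ, ENNReal.ofReal (|h| ^ (-1 - 2 * s)) *
        ‖Complex.exp (Complex.I * ((2 * Real.pi * ξ * h : ℝ) : ℂ)) - 1‖ₑ ^ 2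
          * ‖(𝓕 w : CL2) ξ‖ₑ ^ 2 := fun h => by
    simp only [mul_assoc (ENNReal.ofReal _)]
    rw [lintegral_const_mul _ (by fun_prop), lintegral_const_mul _ (by fun_prop),
      lintegral_translate_sub]
  rw [lintegral_congr e2, lintegral_lintegral_swap (by fun_prop), fourierEnergy,
    ← lintegral_const_mul _ (by fun_prop)]
  refine lintegral_congr fun ξ => ?_
  rw [lintegral_mul_const _ (by fun_prop), lintegral_kernel_exp s ξ hs]
  ring

theorem enorm_add_sq_le (x y : ℂ) : ‖x + y‖ₑ ^ 2 ≤ 2 * (‖x‖ₑ ^ 2 + ‖y‖ₑ ^ 2) := by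
  refine (pow_le_pow_left' (enorm_add_le x y) 2).trans ?_
  have := ENNReal.rpow_add_le_mul_rpow_add_rpow ‖x‖ₑ ‖y‖ₑ (p := 2) (by norm_num)
  norm_num at this
  exact_mod_cast this

/-- Product rule h(x)w(x) - h(y)w(y) = h(x)(w(x) - w(y)) + (h(x) - h(y))w(y). Boundedness and the
Lipschitz bound give |h(x) - h(y)|² ≤ 4M² min(1, |x-y|²), which tames the kernel in the second term.
-/
theorem gagliardo_mul_le {s : ℝ} {M : ℝ} {h : ℝ → ℝ}
    (hb : ∀ x, |h x| ≤ M) (hl : ∀ x y, |h x - h y| ≤ M * |x - y|) {w : ℝ → ℂ}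
    (hw : Measurable w) :
    gagliardo s (fun x => h x * w x) ≤ ENNReal.ofReal (8 * M ^ 2) *
      (gagliardo s w + kernelMass s * ∫⁻ x, ‖w x‖ₑ ^ 2) := by
  have hM : 0 ≤ M := (abs_nonneg _).trans (hb 0)
  have pt : ∀ x y : ℝ, ENNReal.ofReal (|x - y| ^ (-1 - 2 * s)) * ‖(h x : ℂ) * w x - h y * w y‖ₑ ^ 2
      ≤ ENNReal.ofReal (8 * M ^ 2) * (ENNReal.ofReal (|x - y| ^ (-1 - 2 * s)) * ‖w x - w y‖ₑ ^ 2
        + ENNReal.ofReal (min 1 ((x - y) ^ 2)) * ENNReal.ofReal (|x - y| ^ (-1 - 2 * s))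
          * ‖w y‖ₑ ^ 2) := by
    intro x y
    have e : (h x : ℂ) * w x - h y * w y = h x * (w x - w y) + ((h x - h y : ℝ) : ℂ) * w y := by
      push_cast; ring
    have b1 : ‖(h x : ℂ)‖ₑ ^ 2 ≤ ENNReal.ofReal (M ^ 2) := by
      rw [← ofReal_norm, ← ENNReal.ofReal_pow (norm_nonneg _), Complex.norm_real]
      exact ENNReal.ofReal_le_ofReal (pow_le_pow_left₀ (norm_nonneg _) (hb x) 2)
    have b2 : ‖((h x - h y : ℝ) : ℂ)‖ₑ ^ 2
        ≤ ENNReal.ofReal (4 * M ^ 2) * ENNReal.ofReal (min 1 ((x - y) ^ 2)) := by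
      rw [← ofReal_norm, ← ENNReal.ofReal_pow (norm_nonneg _), Complex.norm_real,
        ← ENNReal.ofReal_mul (by positivity)]
      refine ENNReal.ofReal_le_ofReal ?_
      rw [Real.norm_eq_abs, mul_min_of_nonneg _ _ (by positivity), sq_abs]
      refine le_min ?_ ?_
      · have := abs_le.1 (hb x); have := abs_le.1 (hb y); nlinarith
      · have := pow_le_pow_left₀ (abs_nonneg _) (hl x y) 2
        rw [mul_pow, sq_abs, sq_abs] at this
        nlinarith [mul_nonneg (sq_nonneg M) (sq_nonneg (x - y))]
    rw [e]
    calc ENNReal.ofReal (|x - y| ^ (-1 - 2 * s)) *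
          ‖h x * (w x - w y) + ((h x - h y : ℝ) : ℂ) * w y‖ₑ ^ 2
        ≤ ENNReal.ofReal (|x - y| ^ (-1 - 2 * s)) * (2 * (ENNReal.ofReal (M ^ 2) * ‖w x - w y‖ₑ ^ 2
          + ENNReal.ofReal (4 * M ^ 2) * ENNReal.ofReal (min 1 ((x - y) ^ 2)) * ‖w y‖ₑ ^ 2)) := by
          gcongr
          refine (enorm_add_sq_le _ _).trans ?_
          rw [enorm_mul, enorm_mul, mul_pow, mul_pow]
          gcongr
      _ ≤ ENNReal.ofReal (|x - y| ^ (-1 - 2 * s)) *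
          (2 * (ENNReal.ofReal (4 * M ^ 2) * ‖w x - w y‖ₑ ^ 2
          + ENNReal.ofReal (4 * M ^ 2) * ENNReal.ofReal (min 1 ((x - y) ^ 2)) * ‖w y‖ₑ ^ 2)) := by
          gcongr
          nlinarith [sq_nonneg M]
      _ = _ := by
          rw [show 8 * M ^ 2 = 2 * (4 * M ^ 2) by ring, ENNReal.ofReal_mul (by norm_num)]
          norm_num
          ring
  calc gagliardo s (fun x => h x * w x)
      ≤ ∫⁻ x, ∫⁻ y, ENNReal.ofReal (8 * M ^ 2) *
        (ENNReal.ofReal (|x - y| ^ (-1 - 2 * s)) * ‖w x - w y‖ₑ ^ 2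
        + ENNReal.ofReal (min 1 ((x - y) ^ 2)) * ENNReal.ofReal (|x - y| ^ (-1 - 2 * s))
          * ‖w y‖ₑ ^ 2) := lintegral_mono fun x => lintegral_mono fun y => pt x y
    _ = ENNReal.ofReal (8 * M ^ 2) * (gagliardo s w + ∫⁻ x, ∫⁻ y : ℝ,
        ENNReal.ofReal (min 1 ((x - y) ^ 2)) * ENNReal.ofReal (|x - y| ^ (-1 - 2 * s))
          * ‖w y‖ₑ ^ 2) := by
        rw [gagliardo, ← lintegral_add_left (by fun_prop), ← lintegral_const_mul _ (by fun_prop)]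
        refine lintegral_congr fun x => ?_
        rw [lintegral_const_mul _ (by fun_prop), lintegral_add_left (by fun_prop)]
    _ = _ := by
        rw [lintegral_lintegral_swap (by fun_prop), ← lintegral_const_mul _ (by fun_prop)]
        congr 2
        refine lintegral_congr fun y => ?_
        rw [lintegral_mul_const _ (by fun_prop), kernelMass,
          lintegral_sub_right_eq_self
            (fun z => ENNReal.ofReal (min 1 (z ^ 2)) * ENNReal.ofReal (|z| ^ (-1 - 2 * s))) y]

/-! ### Energy on an interval and the fractional Hardy inequality -/

/-- The Gagliardo energy on an interval. -/
def gagliardoOn (a b s : ℝ) (f : ℝ → ℂ) : ℝ≥0∞ :=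
  ∫⁻ x in Ioo a b, ∫⁻ y in Ioo a b, ENNReal.ofReal (|x - y| ^ (-1 - 2 * s)) * ‖f x - f y‖ₑ ^ 2

theorem gagliardoOn_le (a b s : ℝ) (f : ℝ → ℂ) : gagliardoOn a b s f ≤ gagliardo s f :=
  (setLIntegral_le_lintegral _ _).trans
    (lintegral_mono fun _ => setLIntegral_le_lintegral _ _)

theorem gagliardoOn_congr_ae {a b s : ℝ} {f g : ℝ → ℂ}
    (h : f =ᵐ[volume.restrict (Ioo a b)] g) : gagliardoOn a b s f = gagliardoOn a b s g := by
  refine lintegral_congr_ae ?_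
  filter_upwards [h] with x hx
  refine lintegral_congr_ae ?_
  filter_upwards [h] with y hy
  rw [hx, hy]

/-- Together with the reflection below, this moves either end point to the origin, where the Hardy
inequality is proved. -/
theorem gagliardoOn_translate (a b s : ℝ) (f : ℝ → ℂ) :
    gagliardoOn 0 (b - a) s (fun t => f (a + t)) = gagliardoOn a b s f := by
  have hp := measurePreserving_add_left (volume : Measure ℝ) a
  have he := (MeasurableEquiv.addLeft a).measurableEmbedding
  have hpre : (fun t : ℝ => a + t) ⁻¹' Ioo a b = Ioo 0 (b - a) := by
    ext t; simp [lt_sub_iff_add_lt']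
  have key := fun F : ℝ → ℝ≥0∞ => hp.setLIntegral_comp_preimage_emb he F (Ioo a b)
  rw [hpre] at key
  rw [gagliardoOn, gagliardoOn, ← key]
  refine lintegral_congr fun x => ?_
  rw [← key]
  simp

theorem gagliardoOn_reflect (a b s : ℝ) (f : ℝ → ℂ) :
    gagliardoOn 0 (b - a) s (fun t => f (b - t)) = gagliardoOn a b s f := by
  have hp := Measure.measurePreserving_sub_left (volume : Measure ℝ) b
  have he := (MeasurableEquiv.subLeft b).measurableEmbedding
  have hpre : (fun t : ℝ => b - t) ⁻¹' Ioo a b = Ioo 0 (b - a) := by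
    ext t; simp only [mem_preimage, mem_Ioo]; constructor <;> rintro ⟨h1, h2⟩ <;>
      constructor <;> linarith
  have key := fun F : ℝ → ℝ≥0∞ => hp.setLIntegral_comp_preimage_emb he F (Ioo a b)
  rw [hpre] at key
  rw [gagliardoOn, gagliardoOn, ← key]
  refine lintegral_congr fun x => ?_
  rw [← key]
  refine lintegral_congr fun y => ?_
  rw [sub_sub_sub_cancel_left, abs_sub_comm]

/-- Young's inequality. The coefficient 1 + δ of the second term must be near 1 for the absorption
in the Hardy inequality. -/
theorem enorm_add_sq_le_weighted {δ : ℝ} (hδ : 0 < δ) (x y : ℂ) :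
    ‖x + y‖ₑ ^ 2 ≤ ENNReal.ofReal (1 + δ⁻¹) * ‖x‖ₑ ^ 2 + ENNReal.ofReal (1 + δ) * ‖y‖ₑ ^ 2 := by
  simp only [← ofReal_norm, ← ENNReal.ofReal_pow (norm_nonneg _)]
  rw [← ENNReal.ofReal_mul (by positivity), ← ENNReal.ofReal_mul (by positivity),
    ← ENNReal.ofReal_add (by positivity) (by positivity)]
  refine ENNReal.ofReal_le_ofReal ?_
  refine (pow_le_pow_left₀ (norm_nonneg _) (norm_add_le x y) 2).trans ?_
  have h := sq_nonneg (‖x‖ - δ * ‖y‖)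
  have h2 : 0 ≤ δ⁻¹ * (‖x‖ - δ * ‖y‖) ^ 2 := by positivity
  have h3 : δ⁻¹ * (‖x‖ - δ * ‖y‖) ^ 2 = δ⁻¹ * ‖x‖ ^ 2 - 2 * (‖x‖ * ‖y‖) + δ * ‖y‖ ^ 2 := by
    field_simp
    ring
  nlinarith

/-- Under x ↦ θx the weight yields θ^{2s} and the Jacobian θ^{-1}. The product θ^{2s-1} is at most
(1/2)^{2s-1}, which is below 1 precisely because s > 1/2. -/
theorem lintegral_dilate_le {s L θ : ℝ} (hs : 1 / 2 < s) (h0 : 0 < θ) (h1 : θ ≤ 1 / 2)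
    {F : ℝ → ℂ} (hF : Measurable F) :
    ∫⁻ x in Ioo 0 L, ENNReal.ofReal (x ^ (-2 * s)) * ‖F (θ * x)‖ₑ ^ 2
      ≤ ENNReal.ofReal ((1 / 2) ^ (2 * s - 1)) *
        ∫⁻ x in Ioo 0 L, ENNReal.ofReal (x ^ (-2 * s)) * ‖F x‖ₑ ^ 2 := by
  set H : ℝ → ℝ≥0∞ := (Ioo 0 L).indicator fun t =>
    ENNReal.ofReal (t ^ (-2 * s)) * ‖F t‖ₑ ^ 2 with hH
  have hHm : Measurable H := (by fun_prop : Measurable fun t : ℝ =>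
    ENNReal.ofReal (t ^ (-2 * s)) * ‖F t‖ₑ ^ 2).indicator measurableSet_Ioo
  have hθ : (0 : ℝ) ≤ θ ^ (2 * s) := by positivity
  calc ∫⁻ x in Ioo 0 L, ENNReal.ofReal (x ^ (-2 * s)) * ‖F (θ * x)‖ₑ ^ 2
      ≤ ∫⁻ x in Ioo 0 L, ENNReal.ofReal (θ ^ (2 * s)) * H (θ * x) := by
        refine setLIntegral_mono' measurableSet_Ioo fun x hx => ?_
        have hmem : θ * x ∈ Ioo 0 L := ⟨mul_pos h0 hx.1, by nlinarith [hx.1, hx.2]⟩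
        rw [hH, indicator_of_mem hmem, ← mul_assoc, ← ENNReal.ofReal_mul hθ,
          Real.mul_rpow h0.le hx.1.le, ← mul_assoc, ← Real.rpow_add h0]
        simp
    _ ≤ ENNReal.ofReal (θ ^ (2 * s)) * ∫⁻ x, H (θ * x) := by
        rw [← lintegral_const_mul _ (by fun_prop)]
        exact setLIntegral_le_lintegral _ _
    _ = ENNReal.ofReal (θ ^ (2 * s - 1)) * ∫⁻ x, H x := by
        rw [lintegral_comp_mul_left h0.ne' hHm, ← mul_assoc, ← ENNReal.ofReal_mul hθ,
          abs_of_pos (inv_pos.2 h0), ← Real.rpow_neg_one θ, ← Real.rpow_add h0]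
        rfl
    _ ≤ _ := by
        rw [hH, lintegral_indicator measurableSet_Ioo]
        gcongr
        linarith

/-- Put y = xθ. Then 0 < x - y ≤ x, so x^{-1-2s} ≤ |x-y|^{-1-2s}, and dy = x dθ supplies the missing
power of x. -/
theorem lintegral_dilate_sub_le {s L x : ℝ} (hs : 1 / 2 < s) (hx : x ∈ Ioo 0 L)
    {F : ℝ → ℂ} (hF : Measurable F) :
    ∫⁻ θ in Ioo (0 : ℝ) (1 / 2), ENNReal.ofReal (x ^ (-2 * s)) * ‖F x - F (x * θ)‖ₑ ^ 2
      ≤ ∫⁻ y in Ioo 0 L, ENNReal.ofReal (|x - y| ^ (-1 - 2 * s)) * ‖F x - F y‖ₑ ^ 2 := by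
  set H : ℝ → ℝ≥0∞ := (Ioo 0 L).indicator fun y =>
    ENNReal.ofReal (|x - y| ^ (-1 - 2 * s)) * ‖F x - F y‖ₑ ^ 2 with hH
  have hHm : Measurable H := (by fun_prop : Measurable fun y : ℝ =>
    ENNReal.ofReal (|x - y| ^ (-1 - 2 * s)) * ‖F x - F y‖ₑ ^ 2).indicator measurableSet_Ioo
  have hx0 := hx.1
  calc ∫⁻ θ in Ioo (0 : ℝ) (1 / 2), ENNReal.ofReal (x ^ (-2 * s)) * ‖F x - F (x * θ)‖ₑ ^ 2
      ≤ ∫⁻ θ in Ioo (0 : ℝ) (1 / 2), ENNReal.ofReal x * H (x * θ) := by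
        refine setLIntegral_mono' measurableSet_Ioo fun θ hθ => ?_
        have hmem : x * θ ∈ Ioo 0 L :=
          ⟨mul_pos hx0 hθ.1, by nlinarith [hx.1, hx.2, hθ.2]⟩
        rw [hH, indicator_of_mem hmem, ← mul_assoc, ← ENNReal.ofReal_mul hx0.le]
        gcongr
        have h1 : 0 < x - x * θ := by nlinarith [hθ.2]
        rw [abs_of_pos h1]
        calc x ^ (-2 * s) = x * x ^ (-1 - 2 * s) := by
              nth_rw 2 [← Real.rpow_one x]
              rw [← Real.rpow_add hx0]; ring_nf
          _ ≤ x * (x - x * θ) ^ (-1 - 2 * s) := by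
              refine mul_le_mul_of_nonneg_left ?_ hx0.le
              exact Real.rpow_le_rpow_of_nonpos h1 (by nlinarith [hθ.1]) (by linarith)
    _ ≤ ENNReal.ofReal x * ∫⁻ θ, H (x * θ) := by
        rw [← lintegral_const_mul _ (by fun_prop)]
        exact setLIntegral_le_lintegral _ _
    _ = ∫⁻ y, H y := by
        rw [lintegral_comp_mul_left hx0.ne' hHm, ← mul_assoc, ← ENNReal.ofReal_mul hx0.le,
          abs_of_pos (inv_pos.2 hx0), mul_inv_cancel₀ hx0.ne']
        simp
    _ = _ := by rw [hH, lintegral_indicator measurableSet_Ioo]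

/-- The fractional Hardy inequality for `s > 1/2`. -/
theorem exists_hardy {s : ℝ} (hs : 1 / 2 < s) : ∃ C : ℝ≥0∞, C < ⊤ ∧ ∀ (L : ℝ) (F : ℝ → ℂ),
    Measurable F → ∫⁻ x in Ioo 0 L, ENNReal.ofReal (x ^ (-2 * s)) * ‖F x‖ₑ ^ 2 ≠ ⊤ →
    ∫⁻ x in Ioo 0 L, ENNReal.ofReal (x ^ (-2 * s)) * ‖F x‖ₑ ^ 2 ≤ C * gagliardoOn 0 L s F := by
  set η : ℝ := (1 / 2) ^ (2 * s - 1) with hη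
  have hη0 : 0 < η := by positivity
  have hη1 : η < 1 := Real.rpow_lt_one (by norm_num) (by norm_num) (by linarith)
  -- Chosen so that (1 + δ)η is the midpoint (1 + η)/2 of η and 1; a share (1 - η)/2 of X is left
  -- after absorption.
  set δ : ℝ := (1 - η) / (2 * η) with hδ
  have hδ0 : 0 < δ := by have : 0 < 1 - η := by linarith
                         positivity
  have hδη : (1 + δ) * η = (1 + η) / 2 := by rw [hδ]; field_simp; ring
  refine ⟨ENNReal.ofReal (4 * (1 + δ⁻¹) / (1 - η)), by simp, fun L F hF hfin => ?_⟩
  set X := ∫⁻ x in Ioo 0 L, ENNReal.ofReal (x ^ (-2 * s)) * ‖F x‖ₑ ^ 2 with hX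
  set Y : ℝ → ℝ≥0∞ := fun θ =>
    ∫⁻ x in Ioo 0 L, ENNReal.ofReal (x ^ (-2 * s)) * ‖F x - F (x * θ)‖ₑ ^ 2 with hY
  have step : ∀ θ ∈ Ioo (0 : ℝ) (1 / 2), ENNReal.ofReal ((1 - η) / 2) * X
      ≤ ENNReal.ofReal (1 + δ⁻¹) * Y θ := by
    intro θ hθ
    have h1 : X ≤ ENNReal.ofReal (1 + δ⁻¹) * Y θ + ENNReal.ofReal ((1 + η) / 2) * X := by
      calc X ≤ ∫⁻ x in Ioo 0 L, (ENNReal.ofReal (1 + δ⁻¹) *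
            (ENNReal.ofReal (x ^ (-2 * s)) * ‖F x - F (x * θ)‖ₑ ^ 2)
            + ENNReal.ofReal (1 + δ) * (ENNReal.ofReal (x ^ (-2 * s)) * ‖F (θ * x)‖ₑ ^ 2)) := by
            refine lintegral_mono fun x => ?_
            have := enorm_add_sq_le_weighted hδ0 (F x - F (x * θ)) (F (θ * x))
            rw [mul_comm x θ, sub_add_cancel] at this
            refine (mul_le_mul_right this _).trans_eq ?_
            rw [mul_comm x θ]
            ring
        _ = ENNReal.ofReal (1 + δ⁻¹) * Y θ + ENNReal.ofReal (1 + δ) *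
            ∫⁻ x in Ioo 0 L, ENNReal.ofReal (x ^ (-2 * s)) * ‖F (θ * x)‖ₑ ^ 2 := by
            rw [lintegral_add_left (by fun_prop), lintegral_const_mul _ (by fun_prop),
              lintegral_const_mul _ (by fun_prop)]
        _ ≤ _ := by
            rw [← hδη, ENNReal.ofReal_mul (p := 1 + δ) (by positivity), mul_assoc]
            gcongr
            exact lintegral_dilate_le hs hθ.1 hθ.2.le hF
    have hsplit : X = ENNReal.ofReal ((1 - η) / 2) * X + ENNReal.ofReal ((1 + η) / 2) * X := by
      rw [← add_mul, ← ENNReal.ofReal_add (by linarith) (by linarith)]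
      ring_nf; simp
    -- Absorbing X into the left side requires X to be finite beforehand.
    refine (ENNReal.add_le_add_iff_right (ENNReal.mul_ne_top ENNReal.ofReal_ne_top hfin)).1
      (hsplit.symm.le.trans h1)
  -- Averaging the one-dilation estimate over θ turns the increments F(x) - F(θx) into the double
  -- integral.
  have hint : ∫⁻ θ in Ioo (0 : ℝ) (1 / 2), Y θ ≤ gagliardoOn 0 L s F := by
    rw [hY, lintegral_lintegral_swap (by fun_prop)]
    exact setLIntegral_mono' measurableSet_Ioo fun x hx => lintegral_dilate_sub_le hs hx hF
  have hfinal : ENNReal.ofReal ((1 - η) / 4) * X ≤ ENNReal.ofReal (1 + δ⁻¹) * gagliardoOn 0 L s F := by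
    have hYm : Measurable Y := by
      rw [hY]
      exact Measurable.lintegral_prod_right' (f := fun p : ℝ × ℝ =>
        ENNReal.ofReal (p.2 ^ (-2 * s)) * ‖F p.2 - F (p.2 * p.1)‖ₑ ^ 2) (by fun_prop)
    have := setLIntegral_mono' (μ := volume) measurableSet_Ioo step
    rw [setLIntegral_const, lintegral_const_mul _ hYm, Real.volume_Ioo] at this
    refine le_trans (le_of_eq ?_) (this.trans (by gcongr))
    rw [mul_right_comm, ← ENNReal.ofReal_mul (by linarith)]
    ring_nf
  have hpos : (0 : ℝ) < (1 - η) / 4 := by linarith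
  have h4 : ENNReal.ofReal (4 * (1 + δ⁻¹) / (1 - η))
      = ENNReal.ofReal (((1 - η) / 4)⁻¹) * ENNReal.ofReal (1 + δ⁻¹) := by
    rw [← ENNReal.ofReal_mul (by positivity)]
    congr 1
    field_simp
  rw [h4, mul_assoc]
  refine le_trans (le_of_eq ?_) (mul_le_mul_right hfinal _)
  rw [← mul_assoc, ← ENNReal.ofReal_mul (by positivity), inv_mul_cancel₀ hpos.ne']
  simp

theorem lintegral_tail {s d : ℝ} (hs : 0 < s) (hd : 0 < d) :
    ∫⁻ z, (Ici d).indicator (fun z : ℝ => ENNReal.ofReal (|z| ^ (-1 - 2 * s))) z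
      = ENNReal.ofReal ((2 * s)⁻¹) * ENNReal.ofReal (d ^ (-2 * s)) := by
  rw [lintegral_indicator measurableSet_Ici, setLIntegral_congr Ioi_ae_eq_Ici.symm]
  have h1 : ∫⁻ z in Ioi d, ENNReal.ofReal (|z| ^ (-1 - 2 * s))
      = ∫⁻ z in Ioi d, ENNReal.ofReal (z ^ (-1 - 2 * s)) := by
    refine setLIntegral_congr_fun measurableSet_Ioi fun z hz => ?_
    rw [abs_of_pos (hd.trans hz)]
  rw [h1, ← ofReal_integral_eq_lintegral_ofReal
    (integrableOn_Ioi_rpow_of_lt (by linarith) hd), integral_Ioi_rpow_of_lt (by linarith) hd,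
    ← ENNReal.ofReal_mul (by positivity)]
  · congr 1
    rw [show -1 - 2 * s + 1 = -2 * s by ring]
    field_simp
  · filter_upwards [ae_restrict_mem measurableSet_Ioi] with z hz
    exact Real.rpow_nonneg (hd.trans hz).le _

/-- The complement consists of two half-lines at distances x - a and b - x, and each tail of the
kernel integrates to a multiple of the distance to the power -2s. -/
theorem lintegral_compl_kernel_le {a b s x : ℝ} (hs : 0 < s) (hx : x ∈ Ioo a b) :
    ∫⁻ y in (Ioo a b)ᶜ, ENNReal.ofReal (|x - y| ^ (-1 - 2 * s))
      ≤ ENNReal.ofReal ((2 * s)⁻¹) *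
        (ENNReal.ofReal ((x - a) ^ (-2 * s)) + ENNReal.ofReal ((b - x) ^ (-2 * s))) := by
  set k : ℝ → ℝ → ℝ≥0∞ := fun d => (Ici d).indicator
    (fun z : ℝ => ENNReal.ofReal (|z| ^ (-1 - 2 * s))) with hk
  have hkm : ∀ d, Measurable (k d) := fun d =>
    (by fun_prop : Measurable fun z : ℝ => ENNReal.ofReal (|z| ^ (-1 - 2 * s))).indicator
      measurableSet_Ici
  calc ∫⁻ y in (Ioo a b)ᶜ, ENNReal.ofReal (|x - y| ^ (-1 - 2 * s))
      ≤ ∫⁻ y in (Ioo a b)ᶜ, (k (x - a) (x - y) + k (b - x) (y - x)) := by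
        refine setLIntegral_mono' measurableSet_Ioo.compl fun y hy => ?_
        by_cases h : y ≤ a
        · refine le_trans (le_of_eq ?_) le_self_add
          simp only [hk]
          rw [indicator_of_mem]
          exact sub_le_sub_left h x
        · have : b ≤ y := by
            by_contra h'
            exact hy ⟨not_le.1 h, not_le.1 h'⟩
          refine le_trans (le_of_eq ?_) le_add_self
          simp only [hk]
          rw [indicator_of_mem, abs_sub_comm]
          simpa using this
    _ ≤ ∫⁻ y, (k (x - a) (x - y) + k (b - x) (y - x)) := setLIntegral_le_lintegral _ _
    _ = _ := by
        rw [lintegral_add_left (f := fun y => k (x - a) (x - y)) ((hkm _).comp (by fun_prop)),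
          lintegral_sub_left_eq_self (k (x - a)) x, lintegral_sub_right_eq_self (k (b - x)) x,
          lintegral_tail hs (by linarith [hx.1]), lintegral_tail hs (by linarith [hx.2]), mul_add]

/-- Off Ω × Ω only the two cross regions contribute, equally by symmetry. There one of the two
values is 0, so integrating the kernel over the complement leaves a Hardy weight against |f|². -/
theorem gagliardo_le_of_support {a b s : ℝ} (hs : 0 < s) {f : ℝ → ℂ} (hf : Measurable f)
    (h0 : ∀ x ∉ Ioo a b, f x = 0) :
    gagliardo s f ≤ gagliardoOn a b s f + 2 * (ENNReal.ofReal ((2 * s)⁻¹) *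
      ∫⁻ x in Ioo a b, (ENNReal.ofReal ((x - a) ^ (-2 * s)) + ENNReal.ofReal ((b - x) ^ (-2 * s)))
        * ‖f x‖ₑ ^ 2) := by
  set Ω := Ioo a b
  have hΩ : MeasurableSet Ω := measurableSet_Ioo
  set κ : ℝ → ℝ → ℝ≥0∞ := fun x y => ENNReal.ofReal (|x - y| ^ (-1 - 2 * s)) * ‖f x - f y‖ₑ ^ 2
    with hκ
  have hκm : Measurable (Function.uncurry κ) := by
    simp only [hκ, Function.uncurry_def]; fun_prop
  have hκs : ∀ x y, κ x y = κ y x := fun x y => by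
    simp only [hκ]; rw [abs_sub_comm, ← enorm_neg, neg_sub]
  have cross : ∫⁻ x in Ω, ∫⁻ y in Ωᶜ, κ x y ≤ ENNReal.ofReal ((2 * s)⁻¹) *
      ∫⁻ x in Ω, (ENNReal.ofReal ((x - a) ^ (-2 * s)) + ENNReal.ofReal ((b - x) ^ (-2 * s)))
        * ‖f x‖ₑ ^ 2 := by
    rw [← lintegral_const_mul _ (by fun_prop)]
    refine setLIntegral_mono' hΩ fun x hx => ?_
    have : ∫⁻ y in Ωᶜ, κ x y
        = ∫⁻ y in Ωᶜ, ENNReal.ofReal (|x - y| ^ (-1 - 2 * s)) * ‖f x‖ₑ ^ 2 := by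
      refine setLIntegral_congr_fun hΩ.compl fun y hy => ?_
      simp only [hκ]
      rw [h0 y hy, sub_zero]
    rw [this, lintegral_mul_const _ (by fun_prop), ← mul_assoc]
    gcongr
    exact lintegral_compl_kernel_le hs hx
  have e : gagliardo s f = (∫⁻ x in Ω, ∫⁻ y in Ω, κ x y) + (∫⁻ x in Ω, ∫⁻ y in Ωᶜ, κ x y)
      + ∫⁻ x in Ωᶜ, ∫⁻ y in Ω, κ x y := by
    have h1 : gagliardo s f = ∫⁻ x, ((∫⁻ y in Ω, κ x y) + ∫⁻ y in Ωᶜ, κ x y) :=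
      lintegral_congr fun x => (lintegral_add_compl _ hΩ).symm
    have m1 : Measurable fun x => ∫⁻ y in Ω, κ x y := hκm.lintegral_prod_right
    have h2 : ∫⁻ x in Ωᶜ, ∫⁻ y in Ωᶜ, κ x y = 0 := by
      rw [← nonpos_iff_eq_zero]
      refine le_trans (setLIntegral_mono' (g := fun _ => 0) hΩ.compl fun x hx => ?_) (by simp)
      refine le_trans (setLIntegral_mono' (g := fun _ => 0) hΩ.compl fun y hy => ?_) (by simp)
      simp [hκ, h0 x hx, h0 y hy]
    rw [h1, ← lintegral_add_compl _ hΩ, lintegral_add_left m1, lintegral_add_left m1, h2, add_zero]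
  have sym : ∫⁻ x in Ωᶜ, ∫⁻ y in Ω, κ x y = ∫⁻ x in Ω, ∫⁻ y in Ωᶜ, κ x y := by
    rw [lintegral_lintegral_swap hκm.aemeasurable]
    simp_rw [hκs]
  rw [e, sym, add_assoc, ← two_mul]
  exact add_le_add le_rfl (mul_le_mul_right cross 2)

/-- For functions vanishing near the end points the Gagliardo energy on the line is controlled by
the energy on the interval. -/
theorem exists_gagliardo_le_gagliardoOn {s : ℝ} (hs : 1 / 2 < s) :
    ∃ C : ℝ≥0∞, C < ⊤ ∧ ∀ (a b : ℝ) (f : ℝ → ℂ), Continuous f → HasCompactSupport f →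
      tsupport f ⊆ Ioo a b → gagliardo s f ≤ C * gagliardoOn a b s f := by
  obtain ⟨C, hC, hardy⟩ := exists_hardy hs
  refine ⟨1 + 2 * (ENNReal.ofReal ((2 * s)⁻¹) * (C + C)), by finiteness, fun a b f hf hc hsub => ?_⟩
  have h0 : ∀ x ∉ Ioo a b, f x = 0 := fun x hx => image_eq_zero_of_notMem_tsupport fun h =>
    hx (hsub h)
  -- The finiteness that the Hardy inequality demands: the support avoids 0, so the singular weight
  -- times |g|² is continuous with compact support.
  have hfin : ∀ g : ℝ → ℂ, Continuous g → HasCompactSupport g → tsupport g ⊆ Ioi 0 →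
      ∀ L, ∫⁻ x in Ioo 0 L, ENNReal.ofReal (x ^ (-2 * s)) * ‖g x‖ₑ ^ 2 ≠ ⊤ := by
    intro g hg hgc hgs L
    have hcont : Continuous fun x : ℝ => x ^ (-2 * s) * ‖g x‖ ^ 2 := by
      rw [continuous_iff_continuousAt]
      intro x
      by_cases hx : x ∈ tsupport g
      · exact (Real.continuousAt_rpow_const x _ (Or.inl (hgs hx).ne')).mul
          (hg.continuousAt.norm.pow 2)
      · have : (fun x : ℝ => x ^ (-2 * s) * ‖g x‖ ^ 2) =ᶠ[nhds x] fun _ => 0 := by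
          filter_upwards [(isClosed_tsupport g).isOpen_compl.mem_nhds hx] with y hy
          simp [image_eq_zero_of_notMem_tsupport hy]
        exact this.continuousAt
    have hcs : HasCompactSupport fun x : ℝ => x ^ (-2 * s) * ‖g x‖ ^ 2 := by
      refine hgc.mono fun x hx => ?_
      rw [Function.mem_support] at hx ⊢
      intro h; simp [h] at hx
    have hi := (hcont.integrable_of_hasCompactSupport (μ := volume) hcs).integrableOn
      (s := Ioo 0 L)
    refine (lt_of_le_of_lt (setLIntegral_mono' measurableSet_Ioo fun x hx => ?_)
      hi.lintegral_lt_top).ne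
    rw [ENNReal.ofReal_mul (Real.rpow_nonneg hx.1.le _), ENNReal.ofReal_pow (norm_nonneg _),
      ofReal_norm]
  have key : ∀ (e : ℝ → ℝ) (hem : MeasurePreserving e volume volume)
      (hee : MeasurableEmbedding e) (_ : e ⁻¹' Ioo a b = Ioo 0 (b - a))
      (d : ℝ → ℝ) (_ : ∀ t, d (e t) = t)
      (_ : ∫⁻ t in Ioo 0 (b - a), ENNReal.ofReal (t ^ (-2 * s)) * ‖f (e t)‖ₑ ^ 2
        ≤ C * gagliardoOn a b s f),
      ∫⁻ x in Ioo a b, ENNReal.ofReal (d x ^ (-2 * s)) * ‖f x‖ₑ ^ 2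
        ≤ C * gagliardoOn a b s f := by
    intro e hem hee hpre d hd h
    rw [← hem.setLIntegral_comp_preimage_emb hee _ (Ioo a b), hpre]
    simpa only [hd] using h
  have hl : ∫⁻ x in Ioo a b, ENNReal.ofReal ((x - a) ^ (-2 * s)) * ‖f x‖ₑ ^ 2
      ≤ C * gagliardoOn a b s f := by
    refine key (fun t => a + t) (measurePreserving_add_left volume a)
      (MeasurableEquiv.addLeft a).measurableEmbedding (by ext t; simp [lt_sub_iff_add_lt'])
      (fun x => x - a) (fun t => by ring) ?_
    rw [← gagliardoOn_translate]
    refine hardy (b - a) (fun t => f (a + t)) (by fun_prop) (hfin _ (by fun_prop) ?_ ?_ _)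
    · exact hc.comp_homeomorph (Homeomorph.addLeft a)
    · intro t ht
      have := hsub ((tsupport_comp_subset_preimage f (continuous_const.add continuous_id)) ht)
      simpa using this.1
  have hr : ∫⁻ x in Ioo a b, ENNReal.ofReal ((b - x) ^ (-2 * s)) * ‖f x‖ₑ ^ 2
      ≤ C * gagliardoOn a b s f := by
    refine key (fun t => b - t) (Measure.measurePreserving_sub_left volume b)
      (MeasurableEquiv.subLeft b).measurableEmbedding ?_
      (fun x => b - x) (fun t => by ring) ?_
    · ext t; simp only [mem_preimage, mem_Ioo]; constructor <;> rintro ⟨h1, h2⟩ <;>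
        constructor <;> linarith
    rw [← gagliardoOn_reflect]
    refine hardy (b - a) (fun t => f (b - t)) (by fun_prop) (hfin _ (by fun_prop) ?_ ?_ _)
    · exact hc.comp_homeomorph (Homeomorph.subLeft b)
    · intro t ht
      have := hsub ((tsupport_comp_subset_preimage f (continuous_const.sub continuous_id)) ht)
      simpa using this.2
  refine (gagliardo_le_of_support (by linarith) hf.measurable h0).trans ?_
  simp_rw [add_mul]
  rw [lintegral_add_left (by fun_prop), one_mul, mul_assoc, mul_assoc, add_mul]
  gcongr

/-! ### Zero extension and the energy norm -/

theorem memLp_zeroExtend {a b : ℝ} (u : L2 a b) :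
    MemLp ((Ioo a b).indicator fun x => ((u x : ℝ) : ℂ)) 2 (volume : Measure ℝ) := by
  rw [memLp_indicator_iff_restrict measurableSet_Ioo]
  exact (Lp.memLp u).ofReal

/-- Extension by zero of a real function on `(a, b)`, as a complex function on the line. -/
def zeroExtend (a b : ℝ) : L2 a b →ₗᵢ[ℝ] CL2 where
  toFun u := (memLp_zeroExtend u).toLp _
  map_add' u v := by
    rw [← MemLp.toLp_add, MemLp.toLp_eq_toLp_iff, ← indicator_add',
      ← ae_eq_restrict_iff_indicator_ae_eq measurableSet_Ioo]
    filter_upwards [Lp.coeFn_add u v] with x hx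
    rw [hx]
    exact Complex.ofReal_add _ _
  map_smul' c u := by
    rw [RingHom.id_apply, ← MemLp.toLp_const_smul, MemLp.toLp_eq_toLp_iff]
    refine Filter.EventuallyEq.trans ?_ (indicator_const_smul _ c _).eventuallyEq
    rw [← ae_eq_restrict_iff_indicator_ae_eq measurableSet_Ioo]
    filter_upwards [Lp.coeFn_smul c u] with x hx
    rw [hx]
    simp
  norm_map' u := by
    simp only [LinearMap.coe_mk, AddHom.coe_mk]
    rw [Lp.norm_toLp, Lp.norm_def, eLpNorm_indicator_eq_eLpNorm_restrict measurableSet_Ioo]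
    congr 1
    exact eLpNorm_congr_norm_ae (Filter.Eventually.of_forall fun x => by simp)

theorem coeFn_zeroExtend {a b : ℝ} (u : L2 a b) :
    zeroExtend a b u =ᵐ[volume] (Ioo a b).indicator fun x => ((u x : ℝ) : ℂ) :=
  (memLp_zeroExtend u).coeFn_toLp

theorem coeFn_zeroExtend_restrict {a b : ℝ} (u : L2 a b) :
    ∀ᵐ x ∂(volume.restrict (Ioo a b)), zeroExtend a b u x = ((u x : ℝ) : ℂ) := by
  filter_upwards [ae_restrict_of_ae (coeFn_zeroExtend u), ae_restrict_mem measurableSet_Ioo]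
    with x h1 h2
  rw [h1, indicator_of_mem h2]

theorem enorm_zeroExtend {a b : ℝ} (u : L2 a b) : ‖zeroExtend a b u‖ₑ = ‖u‖ₑ :=
  (zeroExtend a b).enorm_map u

theorem zeroExtend_eq_of_ae {a b : ℝ} {u : L2 a b} {φ : ℝ → ℝ} (hφ : tsupport φ ⊆ Ioo a b)
    (h : u =ᵐ[volume.restrict (Ioo a b)] φ) :
    zeroExtend a b u =ᵐ[volume] fun x => (φ x : ℂ) := by
  have h' : (Ioo a b).indicator (fun x => ((u x : ℝ) : ℂ)) =ᵐ[volume]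
      (Ioo a b).indicator fun x => (φ x : ℂ) := by
    rw [← ae_eq_restrict_iff_indicator_ae_eq measurableSet_Ioo]
    filter_upwards [h] with x hx
    rw [hx]
  refine (coeFn_zeroExtend u).trans (h'.trans (Filter.Eventually.of_forall fun x => ?_))
  by_cases hx : x ∈ Ioo a b
  · rw [indicator_of_mem hx]
  · simp only [indicator_of_notMem hx, image_eq_zero_of_notMem_tsupport fun h => hx (hφ h),
      Complex.ofReal_zero]

theorem fourierEnergy_zero (s : ℝ) : fourierEnergy s 0 = 0 := by
  have h : (𝓕 (0 : CL2) : CL2) = 0 := (Lp.fourierTransformₗᵢ ℝ ℂ).map_zero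
  rw [fourierEnergy, h, lintegral_eq_zero_iff' ?_]
  · filter_upwards [Lp.coeFn_zero ℂ 2 (volume : Measure ℝ)] with ξ h
    rw [h]
    simp
  · have := measurable_coeFn (0 : CL2)
    fun_prop

-- Lower semicontinuity: Fatou's lemma along a subsequence on which the transforms converge almost
-- everywhere.
open Filter Topology in
theorem fourierEnergy_le_of_tendsto {s : ℝ} {w : ℕ → CL2} {z : CL2} {B : ℝ≥0∞}
    (h : Tendsto w atTop (𝓝 z)) (hB : ∀ n, fourierEnergy s (w n) ≤ B) : fourierEnergy s z ≤ B := by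
  have h' : Tendsto (fun n => (𝓕 (w n) : CL2)) atTop (𝓝 (𝓕 z)) :=
    ((Lp.fourierTransformₗᵢ ℝ ℂ).continuous.tendsto z).comp h
  obtain ⟨ns, -, hns⟩ := (tendstoInMeasure_of_tendsto_Lp h').exists_seq_tendsto_ae
  have hm : ∀ n, Measurable fun ξ : ℝ => ENNReal.ofReal (|2 * Real.pi * ξ| ^ (2 * s)) *
      ‖(𝓕 (w (ns n)) : CL2) ξ‖ₑ ^ 2 := fun n => by
    have := measurable_coeFn (𝓕 (w (ns n)) : CL2)
    fun_prop
  calc fourierEnergy s z ≤ ∫⁻ ξ, liminf (fun n => ENNReal.ofReal (|2 * Real.pi * ξ| ^ (2 * s)) *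
      ‖(𝓕 (w (ns n)) : CL2) ξ‖ₑ ^ 2) atTop := by
        refine lintegral_mono_ae ?_
        filter_upwards [hns] with ξ hξ
        refine le_of_eq (Tendsto.liminf_eq ?_).symm
        exact ENNReal.Tendsto.const_mul ((ENNReal.continuous_pow 2).tendsto _ |>.comp
          ((continuous_enorm.tendsto _).comp hξ)) (Or.inr (by simp))
    _ ≤ liminf (fun n => fourierEnergy s (w (ns n))) atTop := lintegral_liminf_le hm
    _ ≤ B := by
        refine liminf_le_of_frequently_le' (Frequently.of_forall fun n => hB _)

/-- The squared energy norm `‖u‖² + ∫ |2πξ|^{2s} |𝓕 u ξ|² dξ` of the zero extension. -/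
def energy (a b s : ℝ) (u : L2 a b) : ℝ≥0∞ := ‖u‖ₑ ^ 2 + fourierEnergy s (zeroExtend a b u)

/-- The constant 1 + C, cruder than √C, avoids square roots in `ℝ≥0∞`. -/
theorem le_mul_of_sq_le {x y C : ℝ≥0∞} (h : x ^ 2 ≤ C * y ^ 2) : x ≤ (1 + C) * y := by
  refine (ENNReal.pow_right_strictMono two_ne_zero).le_iff_le.1 (h.trans ?_)
  rw [mul_pow]
  gcongr
  calc C ≤ 1 + C := le_add_self
    _ ≤ (1 + C) ^ 2 := le_self_pow₀ (by simp) two_ne_zero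

theorem sobolevNorm_sq (a b s : ℝ) (u : L2 a b) :
    sobolevNorm a b s u ^ 2 = ‖u‖ₑ ^ 2 + seminormOn a b s u ^ 2 := by
  rw [sobolevNorm, ← ENNReal.rpow_natCast, ← ENNReal.rpow_mul]
  norm_num

theorem enorm_le_sobolevNorm (a b s : ℝ) (u : L2 a b) : ‖u‖ₑ ≤ sobolevNorm a b s u := by
  refine (ENNReal.pow_right_strictMono two_ne_zero).le_iff_le.1 ?_
  rw [sobolevNorm_sq]
  exact le_self_add

/-- The zero extension is one competitor in the infimum. -/
theorem sobolevNorm_sq_le_energy (a b s : ℝ) (u : L2 a b) :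
    sobolevNorm a b s u ^ 2 ≤ ENNReal.ofReal (2 * Real.pi) * energy a b s u := by
  have h1 : seminormOn a b s u ≤ seminormLine s (zeroExtend a b u) :=
    iInf₂_le (f := fun (w : CL2) _ => seminormLine s w) _ (coeFn_zeroExtend_restrict u)
  rw [sobolevNorm_sq, energy, mul_add]
  refine add_le_add ?_ ((pow_le_pow_left' h1 2).trans_eq (seminormLine_sq s _))
  refine le_mul_of_one_le_left' ?_
  rw [ENNReal.one_le_ofReal]
  linarith [Real.pi_gt_three]

/-- An arbitrary extension w agrees with φ on Ω, so the interval energy of φ is at most the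
Gagliardo energy of w; by Hardy it controls the full energy of the zero extension. Then take the
infimum over w. -/
theorem exists_fourierEnergy_le_of_mem_testFunctions {s : ℝ} (hs : 1 / 2 < s) (hs1 : s < 1) :
    ∃ C : ℝ≥0∞, C < ⊤ ∧ ∀ (a b : ℝ), ∀ u ∈ testFunctions a b,
      fourierEnergy s (zeroExtend a b u) ≤ C * seminormOn a b s u ^ 2 := by
  have hs0 : 0 < s := by linarith
  obtain ⟨C, hC, hG⟩ := exists_gagliardo_le_gagliardoOn hs
  have hc0 := gagliardoConst_ne_zero s
  have hct := (gagliardoConst_lt_top hs0 hs1).ne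
  refine ⟨(1 + C) ^ 2, by finiteness, fun a b u ⟨φ, h1, h2, h3, h4⟩ => ?_⟩
  have key : ∀ w : CL2, (∀ᵐ x ∂(volume.restrict (Ioo a b)), w x = ((u x : ℝ) : ℂ)) →
      fourierEnergy s (zeroExtend a b u) ≤ C * seminormLine s w ^ 2 := by
    intro w hw
    have hz := zeroExtend_eq_of_ae h3 h4
    have e1 : gagliardo s (zeroExtend a b u) ≤ C * gagliardo s w := by
      rw [gagliardo_congr_ae hz]
      have hφ : Continuous fun x => (φ x : ℂ) := Complex.continuous_ofReal.comp h1.continuous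
      refine (hG a b _ hφ (h2.comp_left (g := Complex.ofReal) rfl) ?_).trans ?_
      · exact (closure_mono (Function.support_comp_subset (g := Complex.ofReal) rfl φ)).trans h3
      gcongr
      refine le_trans (le_of_eq (gagliardoOn_congr_ae ?_)) (gagliardoOn_le a b s w)
      filter_upwards [hw, h4] with x hx hx'
      rw [hx, hx']
    rw [gagliardo_eq hs0, gagliardo_eq hs0, mul_left_comm] at e1
    have e2 := (ENNReal.mul_le_mul_iff_right hc0 hct).1 e1
    refine e2.trans ?_
    gcongr
    rw [seminormLine_sq]
    refine le_mul_of_one_le_left' ?_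
    rw [ENNReal.one_le_ofReal]
    linarith [Real.pi_gt_three]
  -- The square stands outside the infimum, so the estimate is passed to the infimum in unsquared
  -- form.
  set T := fourierEnergy s (zeroExtend a b u) ^ (1 / 2 : ℝ) with hT
  have hT2 : T ^ 2 = fourierEnergy s (zeroExtend a b u) := by
    rw [hT, ← ENNReal.rpow_natCast, ← ENNReal.rpow_mul]; norm_num
  rw [← hT2, ← mul_pow]
  gcongr
  rw [seminormOn, ENNReal.mul_iInf_of_ne (by simp) (by finiteness)]
  refine le_iInf fun w => ?_
  rw [ENNReal.mul_iInf_of_ne (by simp) (by finiteness)]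
  refine le_iInf fun hw => ?_
  refine le_mul_of_sq_le ?_
  rw [hT2]
  exact key w hw

/-- The transform is a Schwartz function, and |2πξ|^{2s} ≤ 1 + |2πξ|². -/
theorem fourierEnergy_lt_top_of_mem_testFunctions {a b s : ℝ} (hs : 0 < s) (hs1 : s < 1)
    {u : L2 a b} (hu : u ∈ testFunctions a b) : fourierEnergy s (zeroExtend a b u) < ⊤ := by
  obtain ⟨φ, h1, h2, h3, h4⟩ := hu
  have hg₁ : HasCompactSupport (Complex.ofRealCLM ∘ φ) := h2.comp_left rfl
  have hg₂ : ContDiff ℝ ∞ (Complex.ofRealCLM ∘ φ) := by fun_prop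
  set F := hg₁.toSchwartzMap hg₂ with hF
  have e : zeroExtend a b u = F.toLp 2 := by
    apply Lp.ext
    filter_upwards [zeroExtend_eq_of_ae h3 h4, F.coeFn_toLp 2] with x hx hx'
    rw [hx, hx']
    simp [hF]
  rw [fourierEnergy, e, SchwartzMap.toLp_fourier_eq]
  set P := 𝓕 F with hP
  obtain ⟨M, hM0, hM⟩ : ∃ M, 0 < M ∧ ∀ x, ‖P x‖ ≤ M := by
    obtain ⟨M, h, hM⟩ := P.decay 0 0
    exact ⟨M, h, fun x => by simpa using hM x⟩
  have hI : Integrable fun ξ : ℝ => M * (‖ξ‖ ^ 0 * ‖P ξ‖) + M * (2 * Real.pi) ^ 2 *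
      (‖ξ‖ ^ 2 * ‖P ξ‖) :=
    ((P.integrable_pow_mul volume 0).const_mul _).add ((P.integrable_pow_mul volume 2).const_mul _)
  refine lt_of_le_of_lt (lintegral_mono_ae ?_) hI.lintegral_lt_top
  filter_upwards [P.coeFn_toLp 2] with ξ hξ
  rw [hξ, ← ofReal_norm, ← ENNReal.ofReal_pow (norm_nonneg _), ← ENNReal.ofReal_mul (by positivity)]
  refine ENNReal.ofReal_le_ofReal ?_
  have hp : |2 * Real.pi * ξ| ^ (2 * s) ≤ 1 + |2 * Real.pi * ξ| ^ 2 := by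
    rcases le_total |2 * Real.pi * ξ| 1 with h | h
    · have := Real.rpow_le_one (abs_nonneg _) h (show 0 ≤ 2 * s by linarith)
      nlinarith [sq_nonneg |2 * Real.pi * ξ|]
    · have := Real.rpow_le_rpow_of_exponent_le h (show 2 * s ≤ (2 : ℕ) by push_cast; linarith)
      rw [Real.rpow_natCast] at this
      linarith
  have hsq : ‖P ξ‖ ^ 2 ≤ M * ‖P ξ‖ := by nlinarith [norm_nonneg (P ξ), hM ξ]
  calc |2 * Real.pi * ξ| ^ (2 * s) * ‖P ξ‖ ^ 2 ≤ (1 + |2 * Real.pi * ξ| ^ 2) * (M * ‖P ξ‖) := by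
        gcongr
    _ = _ := by
        rw [sq_abs, Real.norm_eq_abs, sq_abs]
        ring

theorem energy_lt_top_of_mem_testFunctions {a b s : ℝ} (hs : 0 < s) (hs1 : s < 1)
    {u : L2 a b} (hu : u ∈ testFunctions a b) : energy a b s u < ⊤ := by
  have := fourierEnergy_lt_top_of_mem_testFunctions hs hs1 hu
  rw [energy]
  finiteness

theorem sobolevNorm_lt_top_of_energy {a b s : ℝ} {u : L2 a b} (h : energy a b s u < ⊤) :
    sobolevNorm a b s u < ⊤ := by
  have h1 := (sobolevNorm_sq_le_energy a b s u).trans_lt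
    (ENNReal.mul_lt_top ENNReal.ofReal_lt_top h)
  by_contra h2
  rw [not_lt, top_le_iff] at h2
  simp [h2] at h1

theorem sobolevNorm_lt_top_of_mem_H0 {a b s : ℝ} (hs : 0 < s) (hs1 : s < 1)
    {u : L2 a b} (hu : u ∈ H0 a b s) : sobolevNorm a b s u < ⊤ := by
  obtain ⟨φ, hφ, h⟩ := hu 1 one_pos
  have := sobolevNorm_add a b s (u - φ) φ
  rw [sub_add_cancel] at this
  exact this.trans_lt (ENNReal.add_lt_top.2 ⟨h.trans (by simp),
    sobolevNorm_lt_top_of_energy (energy_lt_top_of_mem_testFunctions hs hs1 hφ)⟩)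

theorem testFunctions_le_H0 (a b s : ℝ) : testFunctions a b ≤ H0 a b s :=
  fun u hu ε hε => ⟨u, hu, by simpa [sobolevNorm_zero] using hε⟩

theorem sobolevNorm_neg (a b s : ℝ) (u : L2 a b) :
    sobolevNorm a b s (-u) = sobolevNorm a b s u := by
  have h : ∀ v : L2 a b, sobolevNorm a b s (-v) ≤ sobolevNorm a b s v := fun v => by
    have := sobolevNorm_smul a b s (-1) (by norm_num) v
    simpa using this
  exact le_antisymm (h u) (by simpa using h (-u))

-- Density: test functions converging to u in L² and bounded in norm by 2‖u‖ have uniformly bounded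
-- energies, and the energy is lower semicontinuous.
open Filter Topology in
theorem exists_fourierEnergy_le_of_mem_H0 {s : ℝ} (hs : 1 / 2 < s) (hs1 : s < 1) :
    ∃ C : ℝ≥0∞, C < ⊤ ∧ ∀ (a b : ℝ), ∀ u ∈ H0 a b s,
      fourierEnergy s (zeroExtend a b u) ≤ C * sobolevNorm a b s u ^ 2 := by
  obtain ⟨C, hC, hT⟩ := exists_fourierEnergy_le_of_mem_testFunctions hs hs1
  refine ⟨C * 2 ^ 2, by finiteness, fun a b u hu => ?_⟩
  set N := sobolevNorm a b s u with hN
  rcases eq_or_ne N 0 with h0 | h0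
  · have : u = 0 := by
      have := enorm_le_sobolevNorm a b s u
      rw [← hN, h0, nonpos_iff_eq_zero, enorm_eq_zero] at this
      exact this
    rw [this, map_zero, fourierEnergy_zero]
    exact zero_le
  -- The bound N keeps the approximants of norm at most 2N; the bound 1/(n+1) forces convergence.
  have hε : ∀ n : ℕ, 0 < min N (n + 1 : ℝ≥0∞)⁻¹ := fun n =>
    lt_min (pos_iff_ne_zero.2 h0) (ENNReal.inv_pos.2 (by finiteness))
  choose φ hφ hφu using fun n => hu _ (hε n)
  have hconv : Tendsto φ atTop (𝓝 u) := by
    rw [tendsto_iff_edist_tendsto_0]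
    have h1 : Tendsto (fun n : ℕ => ((n : ℝ≥0∞) + 1)⁻¹) atTop (𝓝 0) := by
      have := (tendsto_add_atTop_iff_nat 1).2 ENNReal.tendsto_inv_nat_nhds_zero
      simpa using this
    refine tendsto_of_tendsto_of_tendsto_of_le_of_le tendsto_const_nhds h1
      (fun n => zero_le) fun n => ?_
    rw [edist_comm, edist_eq_enorm_sub]
    exact (enorm_le_sobolevNorm a b s _).trans ((hφu n).le.trans (min_le_right _ _))
  refine fourierEnergy_le_of_tendsto (((zeroExtend a b).continuous.tendsto u).comp hconv) fun n => ?_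
  refine (hT a b (φ n) (hφ n)).trans ?_
  rw [mul_assoc, ← mul_pow]
  gcongr
  have h1 : seminormOn a b s (φ n) ≤ sobolevNorm a b s (φ n) := by
    refine (ENNReal.pow_right_strictMono two_ne_zero).le_iff_le.1 ?_
    rw [sobolevNorm_sq]
    exact le_add_self
  refine h1.trans ?_
  have h2 := sobolevNorm_add a b s u (-(u - φ n))
  rw [sobolevNorm_neg] at h2
  have h3 : u + -(u - φ n) = φ n := by abel
  rw [h3] at h2
  refine h2.trans ?_
  rw [two_mul]
  exact add_le_add le_rfl ((hφu n).le.trans (min_le_left _ _))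

theorem exists_energy_le_of_mem_H0 {s : ℝ} (hs : 1 / 2 < s) (hs1 : s < 1) :
    ∃ C : ℝ≥0∞, C < ⊤ ∧ ∀ (a b : ℝ), ∀ u ∈ H0 a b s,
      energy a b s u ≤ C * sobolevNorm a b s u ^ 2 := by
  obtain ⟨C, hC, h⟩ := exists_fourierEnergy_le_of_mem_H0 hs hs1
  refine ⟨1 + C, by finiteness, fun a b u hu => ?_⟩
  rw [energy, add_mul, one_mul]
  exact add_le_add (pow_le_pow_left' (enorm_le_sobolevNorm a b s u) 2) (h a b u hu)

theorem energy_lt_top_of_mem_H0 {a b s : ℝ} (hs : 1 / 2 < s) (hs1 : s < 1)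
    {u : L2 a b} (hu : u ∈ H0 a b s) : energy a b s u < ⊤ := by
  obtain ⟨C, hC, h⟩ := exists_energy_le_of_mem_H0 hs hs1
  have := sobolevNorm_lt_top_of_mem_H0 (by linarith) hs1 hu
  exact (h a b u hu).trans_lt (by finiteness)

/-! ### Multiplication by exponentials -/

theorem coeFn_expMul {a b : ℝ} (rho : ℝ) (u : L2 a b) :
    expMul a b rho u =ᵐ[volume.restrict (Ioo a b)] fun x => Real.exp (rho * x) * u x :=
  (memLp_exp_mul a b rho u).coeFn_toLp

theorem expMul_expMul {a b : ℝ} (rho sig : ℝ) (u : L2 a b) :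
    expMul a b rho (expMul a b sig u) = expMul a b (rho + sig) u := by
  apply Lp.ext
  filter_upwards [coeFn_expMul rho (expMul a b sig u), coeFn_expMul sig u,
    coeFn_expMul (rho + sig) u] with x h1 h2 h3
  rw [h1, h2, h3, add_mul, Real.exp_add, mul_assoc]

theorem expMul_zero {a b : ℝ} (u : L2 a b) : expMul a b 0 u = u := by
  apply Lp.ext
  filter_upwards [coeFn_expMul 0 u] with x h1
  rw [h1]; simp

theorem expMul_mem_testFunctions {a b : ℝ} (rho : ℝ) {u : L2 a b} (hu : u ∈ testFunctions a b) :
    expMul a b rho u ∈ testFunctions a b := by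
  obtain ⟨φ, h1, h2, h3, h4⟩ := hu
  refine ⟨fun x => Real.exp (rho * x) * φ x, by fun_prop, h2.mul_left,
    (tsupport_mul_subset_right).trans h3, ?_⟩
  filter_upwards [coeFn_expMul rho u, h4] with x h5 h6
  rw [h5, h6]

/-- `e^{ρx}` frozen outside `(a, b)`. -/
def clampExp (a b rho x : ℝ) : ℝ := Real.exp (rho * max a (min b x))

theorem abs_mul_clamp_le {a b rho R : ℝ} (h : |rho| ≤ R) (x : ℝ) :
    |rho * max a (min b x)| ≤ R * (|a| + |b|) := by
  have hR : 0 ≤ R := (abs_nonneg _).trans h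
  rw [abs_mul]
  have hh : |max a (min b x)| ≤ |a| + |b| := by
    rw [abs_le]
    have := neg_abs_le a; have := le_abs_self a; have := le_abs_self b; have := abs_nonneg a
    have := abs_nonneg b
    constructor
    · have := le_max_left a (min b x); linarith
    · refine max_le (by linarith) ((min_le_left _ _).trans (by linarith))
  gcongr

theorem clampExp_le {a b rho R : ℝ} (h : |rho| ≤ R) (x : ℝ) :
    |clampExp a b rho x| ≤ Real.exp (R * (|a| + |b|)) := by
  rw [clampExp, abs_of_pos (Real.exp_pos _)]
  exact Real.exp_le_exp.2 ((le_abs_self _).trans (abs_mul_clamp_le h x))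

theorem abs_exp_sub_exp_le {p q B : ℝ} (hp : p ≤ B) (hq : q ≤ B) :
    |Real.exp p - Real.exp q| ≤ Real.exp B * |p - q| := by
  wlog hpq : q ≤ p generalizing p q
  · rw [abs_sub_comm, abs_sub_comm p]; exact this hq hp (le_of_not_ge hpq)
  rw [abs_of_nonneg (sub_nonneg.2 (Real.exp_le_exp.2 hpq)), abs_of_nonneg (sub_nonneg.2 hpq)]
  have h1 : Real.exp q = Real.exp p * Real.exp (q - p) := by rw [← Real.exp_add]; ring_nf
  have h2 := Real.add_one_le_exp (q - p)
  have h3 := Real.exp_le_exp.2 hp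
  have h4 := Real.exp_pos p
  nlinarith

theorem clampExp_lipschitz {a b rho R : ℝ} (h : |rho| ≤ R) (x y : ℝ) :
    |clampExp a b rho x - clampExp a b rho y| ≤ Real.exp (R * (|a| + |b|)) * R * |x - y| := by
  have hR : 0 ≤ R := (abs_nonneg _).trans h
  have h1 := fun x => (le_abs_self _).trans (abs_mul_clamp_le (a := a) (b := b) h x)
  refine (abs_exp_sub_exp_le (h1 x) (h1 y)).trans ?_
  rw [mul_assoc]
  gcongr
  rw [← mul_sub, abs_mul]
  refine mul_le_mul h ?_ (abs_nonneg _) hR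
  refine (abs_max_sub_max_le_max a (min b x) a (min b y)).trans ?_
  rw [sub_self, abs_zero, max_eq_right (abs_nonneg _)]
  refine (abs_min_sub_min_le_max b x b y).trans ?_
  rw [sub_self, abs_zero, max_eq_right (abs_nonneg _)]

/-- Outside Ω the zero extension vanishes, so the unbounded exponential may be replaced by its
clamped version, which is bounded and Lipschitz as `gagliardo_mul_le` requires. -/
theorem zeroExtend_expMul {a b : ℝ} (rho : ℝ) (u : L2 a b) :
    zeroExtend a b (expMul a b rho u) =ᵐ[volume]
      fun x => (clampExp a b rho x : ℂ) * zeroExtend a b u x := by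
  have h : (Ioo a b).indicator (fun x => ((expMul a b rho u x : ℝ) : ℂ)) =ᵐ[volume]
      (Ioo a b).indicator fun x => (Real.exp (rho * x) : ℂ) * ((u x : ℝ) : ℂ) := by
    rw [← ae_eq_restrict_iff_indicator_ae_eq measurableSet_Ioo]
    filter_upwards [coeFn_expMul rho u] with x hx
    rw [hx]; push_cast; rfl
  filter_upwards [coeFn_zeroExtend (expMul a b rho u), coeFn_zeroExtend u, h] with x h1 h2 h3
  rw [h1, h2, h3]
  by_cases hx : x ∈ Ioo a b
  · rw [indicator_of_mem hx, indicator_of_mem hx, clampExp, min_eq_right hx.2.le,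
      max_eq_right hx.1.le]
  · rw [indicator_of_notMem hx, indicator_of_notMem hx, mul_zero]

/-- The product estimate for Gagliardo energies. The constant sees `rho` only through R, which later
makes the final constant independent of λ. -/
theorem exists_energy_expMul_le {s : ℝ} (hs : 0 < s) (hs1 : s < 1) (a b R : ℝ) (hR : 0 ≤ R) :
    ∃ C : ℝ≥0∞, C < ⊤ ∧ ∀ rho, |rho| ≤ R → ∀ u : L2 a b,
      energy a b s (expMul a b rho u) ≤ C * energy a b s u := by
  -- A common upper bound for the supremum and the Lipschitz constant of `clampExp`.
  set M := Real.exp (R * (|a| + |b|)) * (1 + R) with hM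
  have hM0 : 0 ≤ M := by positivity
  set c := gagliardoConst s
  have hc0 : c ≠ 0 := gagliardoConst_ne_zero s
  have hct : c < ⊤ := gagliardoConst_lt_top hs hs1
  have hk := kernelMass_lt_top hs hs1
  refine ⟨ENNReal.ofReal (8 * M ^ 2) * (1 + 1 + kernelMass s / c), ?_, fun rho hrho u => ?_⟩
  · have : kernelMass s / c < ⊤ := ENNReal.div_lt_top hk.ne hc0
    finiteness
  have hb : ∀ x, |clampExp a b rho x| ≤ M := fun x => (clampExp_le hrho x).trans (by
    rw [hM]; nlinarith [Real.exp_pos (R * (|a| + |b|))])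
  have hl : ∀ x y, |clampExp a b rho x - clampExp a b rho y| ≤ M * |x - y| := fun x y =>
    (clampExp_lipschitz hrho x y).trans (by
      rw [hM]
      gcongr
      linarith)
  have hsum : ∫⁻ x, ‖zeroExtend a b u x‖ₑ ^ 2 = ‖u‖ₑ ^ 2 := by
    rw [← enorm_sq_eq_lintegral, enorm_zeroExtend]
  have h1 : fourierEnergy s (zeroExtend a b (expMul a b rho u)) ≤ ENNReal.ofReal (8 * M ^ 2) *
      (fourierEnergy s (zeroExtend a b u) + kernelMass s / c * ‖u‖ₑ ^ 2) := by
    have e := gagliardo_mul_le (s := s) hb hl (measurable_coeFn (zeroExtend a b u))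
    rw [← gagliardo_congr_ae (zeroExtend_expMul rho u), gagliardo_eq hs, gagliardo_eq hs, hsum] at e
    refine (ENNReal.mul_le_mul_iff_right hc0 hct.ne).1 (e.trans_eq ?_)
    rw [mul_left_comm c, mul_add c, ← mul_assoc c, ENNReal.mul_div_cancel hc0 hct.ne]
  have h2 : ‖expMul a b rho u‖ₑ ^ 2 ≤ ENNReal.ofReal (8 * M ^ 2) * ‖u‖ₑ ^ 2 := by
    rw [← enorm_zeroExtend, ← hsum, enorm_sq_eq_lintegral, ← lintegral_const_mul _
      (by have := measurable_coeFn (zeroExtend a b u); fun_prop)]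
    refine lintegral_mono_ae ?_
    filter_upwards [zeroExtend_expMul rho u] with x hx
    rw [hx, enorm_mul, mul_pow]
    gcongr
    rw [← ofReal_norm, Complex.norm_real, ← ENNReal.ofReal_pow (norm_nonneg _)]
    refine ENNReal.ofReal_le_ofReal ?_
    have := pow_le_pow_left₀ (abs_nonneg _) (hb x) 2
    rw [Real.norm_eq_abs]
    nlinarith [sq_nonneg M]
  rw [energy, energy]
  refine (add_le_add h2 h1).trans ?_
  rw [← mul_add, mul_assoc]
  gcongr
  set X := ‖u‖ₑ ^ 2
  set Y := fourierEnergy s (zeroExtend a b u)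
  calc X + (Y + kernelMass s / c * X) ≤ X + (Y + kernelMass s / c * X) + (X + Y +
        kernelMass s / c * Y) := le_self_add
    _ = _ := by ring

theorem exists_sobolevNorm_expMul_le {s : ℝ} (hs : 1 / 2 < s) (hs1 : s < 1) (a b R : ℝ)
    (hR : 0 ≤ R) :
    ∃ C : ℝ≥0∞, C < ⊤ ∧ ∀ rho, |rho| ≤ R → ∀ u ∈ H0 a b s,
      sobolevNorm a b s (expMul a b rho u) ≤ C * sobolevNorm a b s u := by
  obtain ⟨C, hC, h1⟩ := exists_energy_expMul_le (by linarith) hs1 a b R hR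
  obtain ⟨D, hD, h2⟩ := exists_energy_le_of_mem_H0 hs hs1
  refine ⟨1 + ENNReal.ofReal (2 * Real.pi) * (C * D), by finiteness, fun rho hrho u hu =>
    le_mul_of_sq_le ?_⟩
  refine (sobolevNorm_sq_le_energy a b s _).trans ?_
  rw [mul_assoc, mul_assoc]
  gcongr
  refine (h1 rho hrho u).trans ?_
  gcongr
  exact h2 a b u hu

/-- Multiplication preserves test functions; the norm bound, applied to u - φ, carries this to the
closure. -/
theorem expMul_mem_H0 {a b s : ℝ} (hs : 1 / 2 < s) (hs1 : s < 1) (rho : ℝ) {u : L2 a b}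
    (hu : u ∈ H0 a b s) : expMul a b rho u ∈ H0 a b s := by
  obtain ⟨C, hC, h⟩ := exists_sobolevNorm_expMul_le hs hs1 a b |rho| (abs_nonneg _)
  intro ε hε
  have hε' : 0 < ε / (1 + C) := ENNReal.div_pos hε.ne' (by finiteness)
  obtain ⟨φ, hφ, hlt⟩ := hu _ hε'
  refine ⟨expMul a b rho φ, expMul_mem_testFunctions rho hφ, ?_⟩
  rw [← map_sub]
  have hm : u - φ ∈ H0 a b s := sub_mem hu (testFunctions_le_H0 a b s hφ)
  refine lt_of_le_of_lt ((h rho le_rfl _ hm).trans (mul_le_mul_left (le_add_self : C ≤ 1 + C) _)) ?_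
  rw [mul_comm]
  exact (ENNReal.lt_div_iff_mul_lt (Or.inl (by simp)) (Or.inl (by finiteness))).1 hlt

/-! ### The Laplace transform of a power -/

theorem integrableOn_rpow_mul_exp {c r : ℝ} (hc : 0 < c) (hr : 0 < r) :
    IntegrableOn (fun x : ℝ => x ^ (c - 1) * Real.exp (-r * x)) (Ioi 0) := by
  simpa using integrableOn_rpow_mul_exp_neg_mul_rpow (s := c - 1) (p := 1) (b := r) (by linarith)
    one_pos hr

theorem norm_rpow_mul_cexp {c x : ℝ} (hx : 0 < x) (z : ℂ) :
    ‖((x ^ (c - 1) : ℝ) : ℂ) * Complex.exp (-z * x)‖ = x ^ (c - 1) * Real.exp (-z.re * x) := by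
  rw [norm_mul, Complex.norm_real, Real.norm_of_nonneg (by positivity), Complex.norm_exp]
  simp

theorem aestronglyMeasurable_rpow_mul_cexp (c : ℝ) (z : ℂ) (μ : Measure ℝ) :
    AEStronglyMeasurable (fun x : ℝ => ((x ^ (c - 1) : ℝ) : ℂ) * Complex.exp (-z * x)) μ :=
  (by fun_prop : Measurable fun x : ℝ =>
    ((x ^ (c - 1) : ℝ) : ℂ) * Complex.exp (-z * x)).aestronglyMeasurable

theorem integrableOn_rpow_mul_cexp {c : ℝ} (hc : 0 < c) {z : ℂ} (hz : 0 < z.re) :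
    IntegrableOn (fun x : ℝ => ((x ^ (c - 1) : ℝ) : ℂ) * Complex.exp (-z * x)) (Ioi 0) := by
  refine (integrableOn_rpow_mul_exp hc hz).mono' (aestronglyMeasurable_rpow_mul_cexp _ _ _) ?_
  filter_upwards [ae_restrict_mem measurableSet_Ioi] with x hx
  exact (norm_rpow_mul_cexp hx z).le

/-- Differentiation under the integral; on Re w > Re z / 2 the derivative is dominated by x^c
e^{-(Re z/2)x}. -/
theorem hasDerivAt_laplace_rpow {c : ℝ} (hc : 0 < c) {z : ℂ} (hz : 0 < z.re) :
    DifferentiableAt ℂ (fun z : ℂ => ∫ x in Ioi (0 : ℝ),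
      ((x ^ (c - 1) : ℝ) : ℂ) * Complex.exp (-z * x)) z := by
  have hr : 0 < z.re / 2 := by linarith
  have hs : {w : ℂ | z.re / 2 < w.re} ∈ nhds z :=
    (isOpen_lt continuous_const Complex.continuous_re).mem_nhds (by simp only [mem_ofPred_eq]; linarith)
  refine (hasDerivAt_integral_of_dominated_loc_of_deriv_le (μ := volume.restrict (Ioi (0 : ℝ)))
    (F := fun (z : ℂ) (x : ℝ) => ((x ^ (c - 1) : ℝ) : ℂ) * Complex.exp (-z * x))
    (F' := fun (z : ℂ) (x : ℝ) => ((x ^ (c - 1) : ℝ) : ℂ) * (Complex.exp (-z * x) * -x))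
    (bound := fun x => x ^ ((c + 1) - 1) * Real.exp (-(z.re / 2) * x)) hs ?_
    (integrableOn_rpow_mul_cexp hc hz) ?_ ?_ (integrableOn_rpow_mul_exp (by linarith) hr) ?_).2.differentiableAt
  · exact Filter.Eventually.of_forall fun w => aestronglyMeasurable_rpow_mul_cexp c w _
  · exact (by fun_prop : Measurable fun x : ℝ =>
      ((x ^ (c - 1) : ℝ) : ℂ) * (Complex.exp (-z * x) * -x)).aestronglyMeasurable
  · filter_upwards [ae_restrict_mem measurableSet_Ioi] with x hx w hw
    have hx' : (0 : ℝ) < x := hx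
    rw [← mul_assoc, norm_mul, norm_rpow_mul_cexp hx, norm_neg, Complex.norm_real,
      Real.norm_of_nonneg hx'.le, mul_right_comm, ← Real.rpow_add_one hx'.ne']
    rw [show c - 1 + 1 = c + 1 - 1 by ring]
    have hw' : z.re / 2 < w.re := hw
    gcongr
  · filter_upwards with x w _
    refine HasDerivAt.const_mul _ ?_
    have h : HasDerivAt (fun z : ℂ => -z * (x : ℂ)) (-x) w := by
      simpa using (hasDerivAt_id w).neg.mul_const (x : ℂ)
    exact h.cexp

/-- Identity theorem: both sides are analytic on the right half-plane and agree on the positive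
reals, which accumulate at 1. -/
theorem laplace_rpow {c : ℝ} (hc : 0 < c) {z : ℂ} (hz : 0 < z.re) :
    ∫ x in Ioi (0 : ℝ), ((x ^ (c - 1) : ℝ) : ℂ) * Complex.exp (-z * x)
      = (Real.Gamma c : ℂ) * z ^ (-c : ℂ) := by
  set U : Set ℂ := {z | 0 < z.re} with hU
  have hUo : IsOpen U := isOpen_lt continuous_const Complex.continuous_re
  have h1 : AnalyticOnNhd ℂ (fun z : ℂ => ∫ x in Ioi (0 : ℝ),
      ((x ^ (c - 1) : ℝ) : ℂ) * Complex.exp (-z * x)) U :=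
    DifferentiableOn.analyticOnNhd
      (fun w hw => (hasDerivAt_laplace_rpow hc hw).differentiableWithinAt) hUo
  have h2 : AnalyticOnNhd ℂ (fun z : ℂ => (Real.Gamma c : ℂ) * z ^ (-c : ℂ)) U := by
    refine DifferentiableOn.analyticOnNhd (fun w hw => ?_) hUo
    refine DifferentiableAt.differentiableWithinAt ?_
    exact (differentiableAt_id.cpow_const (Or.inl hw)).const_mul _
  have h3 : ∃ᶠ w in nhdsWithin (1 : ℂ) {1}ᶜ, (∫ x in Ioi (0 : ℝ),
      ((x ^ (c - 1) : ℝ) : ℂ) * Complex.exp (-w * x)) = (Real.Gamma c : ℂ) * w ^ (-c : ℂ) := by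
    have ht : Filter.Tendsto (fun r : ℝ => (r : ℂ)) (nhdsWithin (1 : ℝ) {1}ᶜ)
        (nhdsWithin (1 : ℂ) {1}ᶜ) := by
      refine tendsto_nhdsWithin_of_tendsto_nhds_of_eventually_within _ ?_ ?_
      · exact (Complex.continuous_ofReal.tendsto' 1 1 (by simp)).mono_left nhdsWithin_le_nhds
      · filter_upwards [self_mem_nhdsWithin] with r hr h
        exact hr (by simpa using h)
    refine ht.frequently (Filter.Eventually.frequently ?_)
    have hpos : ∀ᶠ r : ℝ in nhdsWithin (1 : ℝ) {1}ᶜ, 0 < r :=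
      nhdsWithin_le_nhds (lt_mem_nhds one_pos)
    filter_upwards [hpos] with r hr
    have h := Real.integral_rpow_mul_exp_neg_mul_Ioi hc hr
    have e : ∫ x in Ioi (0 : ℝ), ((x ^ (c - 1) : ℝ) : ℂ) * Complex.exp (-(r : ℂ) * x)
        = ((∫ x in Ioi (0 : ℝ), x ^ (c - 1) * Real.exp (-(r * x)) : ℝ) : ℂ) := by
      rw [← integral_complex_ofReal]
      refine integral_congr_ae (Filter.Eventually.of_forall fun x => ?_)
      simp
    rw [e, h, mul_comm, one_div, Real.inv_rpow hr.le, ← Real.rpow_neg hr.le]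
    push_cast
    rw [Complex.ofReal_cpow hr.le]
    push_cast
    rfl
  have hpre : IsPreconnected U := (convex_halfSpace_re_gt 0).isPreconnected
  exact h1.eqOn_of_preconnected_of_frequently_eq h2 hpre (z₀ := 1) (by simp [hU]) h3 hz

/-! ### Fractional derivatives through the Fourier transform -/

/-- The unimodular character `e^{2πixξ}`. -/
def expi (x ξ : ℝ) : ℂ := Complex.exp (((2 * Real.pi * (x * ξ) : ℝ) : ℂ) * Complex.I)

theorem norm_expi (x ξ : ℝ) : ‖expi x ξ‖ = 1 := Complex.norm_exp_ofReal_mul_I _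

theorem continuous_expi (x : ℝ) : Continuous (expi x) := by
  unfold expi; fun_prop

theorem norm_expi_sub_le (x y ξ : ℝ) : ‖expi x ξ - expi y ξ‖ ≤ |2 * Real.pi * ξ| * |x - y| := by
  have e : expi x ξ - expi y ξ
      = expi y ξ * (Complex.exp (Complex.I * ((2 * Real.pi * ((x - y) * ξ) : ℝ) : ℂ)) - 1) := by
    rw [expi, expi, mul_sub, mul_one, ← Complex.exp_add]
    congr 2
    push_cast; ring
  rw [e, norm_mul, norm_expi, one_mul]
  refine Real.norm_exp_I_mul_ofReal_sub_one_le.trans (le_of_eq ?_)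
  rw [Real.norm_eq_abs, ← abs_mul]
  congr 1; ring

/-- The fractional integral with kernel `z^{-σ}`, looking left (`η = 1`) or right (`η = -1`),
damped by `e^{-εz}`. -/
def fracInt (σ η ε : ℝ) (f : ℝ → ℝ) (y : ℝ) : ℝ :=
  ∫ z in Ioi 0, z ^ (-σ) * Real.exp (-ε * z) * f (y - η * z)

/-- Damping makes the kernel integrable, so Fourier inversion for f and Fubini apply; the z-integral
is then the Laplace transform of z^{-σ} at ε + 2πiηξ. -/
theorem fracInt_damped_eq {σ η ε : ℝ} (hσ1 : σ < 1) (hη : η ≠ 0) (hε : 0 < ε)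
    {f : ℝ → ℝ} {U : ℝ → ℂ} (hU : Integrable U)
    (hf : ∀ᵐ x, (f x : ℂ) = ∫ ξ, expi x ξ * U ξ) (y : ℝ) :
    (fracInt σ η ε f y : ℂ) = (Real.Gamma (1 - σ) : ℂ) * ∫ ξ, expi y ξ *
      ((ε : ℂ) + ((2 * Real.pi * (η * ξ) : ℝ) : ℂ) * Complex.I) ^ ((σ - 1 : ℝ) : ℂ) * U ξ := by
  have hq : Measure.QuasiMeasurePreserving (fun z : ℝ => y - η * z) volume volume := by
    refine (Measure.measurePreserving_sub_left volume y).quasiMeasurePreserving.comp ?_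
    refine ⟨measurable_const_mul _, ?_⟩
    rw [Real.map_volume_mul_left hη]
    exact Measure.smul_absolutelyContinuous
  have hk := integrableOn_rpow_mul_exp (c := 1 - σ) (r := ε) (by linarith) hε
  have e1 : (fracInt σ η ε f y : ℂ) = ∫ z in Ioi (0 : ℝ), ∫ ξ,
      ((z ^ (1 - σ - 1) * Real.exp (-ε * z) : ℝ) : ℂ) * (expi (y - η * z) ξ * U ξ) := by
    rw [fracInt, ← integral_complex_ofReal]
    refine integral_congr_ae ?_
    filter_upwards [ae_restrict_of_ae (hq.ae hf)] with z hz
    rw [integral_const_mul, ← hz, show 1 - σ - 1 = -σ by ring]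
    push_cast
    ring
  have hint : Integrable (Function.uncurry fun (z ξ : ℝ) =>
      ((z ^ (1 - σ - 1) * Real.exp (-ε * z) : ℝ) : ℂ) * (expi (y - η * z) ξ * U ξ))
      ((volume.restrict (Ioi (0 : ℝ))).prod volume) := by
    have h := (hk.ofReal (𝕜 := ℂ)).mul_prod hU
    refine h.mono ?_ (Filter.Eventually.of_forall fun p => ?_)
    · have h2 : Continuous fun p : ℝ × ℝ => expi (y - η * p.1) p.2 := by
        unfold expi; fun_prop
      refine (h2.aestronglyMeasurable.mul h.1).congr (Filter.Eventually.of_forall fun p => ?_)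
      simp only [Function.uncurry, Pi.mul_apply, Complex.coe_algebraMap]
      ring
    · simp only [Function.uncurry]
      rw [norm_mul, norm_mul, norm_mul, norm_expi, one_mul]
      rfl
  rw [e1, integral_integral_swap hint, ← integral_const_mul]
  refine integral_congr_ae (Filter.Eventually.of_forall fun ξ => ?_)
  have hre : 0 < ((ε : ℂ) + ((2 * Real.pi * (η * ξ) : ℝ) : ℂ) * Complex.I).re := by simpa using hε
  have hL := laplace_rpow (c := 1 - σ) (by linarith) hre
  have e2 : ∀ z : ℝ, ((z ^ (1 - σ - 1) * Real.exp (-ε * z) : ℝ) : ℂ) * (expi (y - η * z) ξ * U ξ)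
      = (expi y ξ * U ξ) * (((z ^ (1 - σ - 1) : ℝ) : ℂ) *
        Complex.exp (-((ε : ℂ) + ((2 * Real.pi * (η * ξ) : ℝ) : ℂ) * Complex.I) * z)) := by
    intro z
    have : expi (y - η * z) ξ * Complex.exp (-(ε : ℂ) * z) = expi y ξ *
        Complex.exp (-((ε : ℂ) + ((2 * Real.pi * (η * ξ) : ℝ) : ℂ) * Complex.I) * z) := by
      rw [expi, expi, ← Complex.exp_add, ← Complex.exp_add]
      congr 1
      push_cast; ring
    rw [Complex.ofReal_mul (z ^ (1 - σ - 1)), Complex.ofReal_exp,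
      show ((-ε * z : ℝ) : ℂ) = -(ε : ℂ) * z by push_cast; rfl]
    linear_combination (((z ^ (1 - σ - 1) : ℝ) : ℂ) * U ξ) * this
  simp only [e2]
  rw [integral_const_mul, hL]
  push_cast
  rw [show -(1 - (σ : ℂ)) = σ - 1 by ring]
  ring

open Filter Topology in
theorem tendsto_fracInt {σ η : ℝ} (hσ1 : σ < 1) (hη : |η| = 1) {f : ℝ → ℝ} (hfm : Measurable f)
    {M a b : ℝ} (hM : ∀ᵐ x, |f x| ≤ M) (hsupp : ∀ x ∉ Ioo a b, f x = 0) (y : ℝ) :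
    Tendsto (fun ε => fracInt σ η ε f y) (𝓝[>] 0) (𝓝 (fracInt σ η 0 f y)) := by
  have hη0 : η ≠ 0 := by rintro rfl; simp at hη
  have hq : Measure.QuasiMeasurePreserving (fun z : ℝ => y - η * z) volume volume := by
    refine (Measure.measurePreserving_sub_left volume y).quasiMeasurePreserving.comp ?_
    refine ⟨measurable_const_mul _, ?_⟩
    rw [Real.map_volume_mul_left hη0]
    exact Measure.smul_absolutelyContinuous
  -- For z ≥ T the point y - ηz has left (a, b), so the integrand vanishes and M z^{-σ} on (0, T)
  -- dominates.
  set T := |y| + |a| + |b| + 1 with hT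
  have hTpos : 0 < T := by positivity
  refine tendsto_integral_filter_of_dominated_convergence
    ((Ioo 0 T).indicator fun z => z ^ (-σ) * M) ?_ ?_ ?_ ?_
  · exact Eventually.of_forall fun ε => (by fun_prop : Measurable fun z : ℝ =>
      z ^ (-σ) * Real.exp (-ε * z) * f (y - η * z)).aestronglyMeasurable
  · filter_upwards [self_mem_nhdsWithin] with ε hε
    filter_upwards [ae_restrict_mem measurableSet_Ioi, ae_restrict_of_ae (hq.ae hM)] with z hz hz2
    have hz' : (0 : ℝ) < z := hz
    have hε' : (0 : ℝ) < ε := hε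
    by_cases hzT : z ∈ Ioo 0 T
    · rw [indicator_of_mem hzT, norm_mul, norm_mul, Real.norm_of_nonneg (by positivity),
        Real.norm_of_nonneg (Real.exp_pos _).le, Real.norm_eq_abs]
      have h1 : Real.exp (-ε * z) ≤ 1 := by
        rw [Real.exp_le_one_iff]; nlinarith
      have h2 : 0 ≤ z ^ (-σ) := by positivity
      calc z ^ (-σ) * Real.exp (-ε * z) * |f (y - η * z)| ≤ z ^ (-σ) * 1 * M := by gcongr
        _ = _ := by ring
    · have hTz : T ≤ z := by
        by_contra h
        exact hzT ⟨hz, not_le.1 h⟩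
      have hout : y - η * z ∉ Ioo a b := by
        intro h
        have h1 : |η * z| = z := by rw [abs_mul, hη, one_mul, abs_of_pos hz']
        have h2 := neg_abs_le a; have h3 := le_abs_self b
        have h4 := neg_abs_le y; have h5 := le_abs_self y
        have h6 := abs_nonneg a; have h7 := abs_nonneg b
        rcases abs_choice (η * z) with h8 | h8 <;> rw [h1] at h8 <;>
          have := h.1 <;> have := h.2 <;> linarith
      rw [hsupp _ hout, mul_zero, norm_zero, indicator_of_notMem hzT]
  · have h1 : IntegrableOn (fun z : ℝ => z ^ (-σ)) (Ioo 0 T) :=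
      (intervalIntegral.integrableOn_Ioo_rpow_iff hTpos).2 (by linarith)
    exact ((integrable_indicator_iff measurableSet_Ioo).2 (h1.mul_const M)).mono_measure
      Measure.restrict_le_self
  · refine Eventually.of_forall fun z => ?_
    have : ContinuousAt (fun ε : ℝ => z ^ (-σ) * Real.exp (-ε * z) * f (y - η * z)) 0 := by
      fun_prop
    exact this.tendsto.mono_left nhdsWithin_le_nhds

-- Let the damping tend to 0. The limiting symbol has size |2πξ|^{σ-1}, singular at 0, while U is
-- merely integrable; this is why a difference in y is taken, whose factor O(|ξ|) cancels the
-- singularity.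
open Filter Topology in
theorem fracInt_sub_eq {σ η : ℝ} (hσ0 : 0 < σ) (hσ1 : σ < 1) (hη : |η| = 1) {f : ℝ → ℝ}
    (hfm : Measurable f) {U : ℝ → ℂ} (hU : Integrable U)
    (hf : ∀ᵐ x, (f x : ℂ) = ∫ ξ, expi x ξ * U ξ) {a b : ℝ}
    (hsupp : ∀ x ∉ Ioo a b, f x = 0) (y y' : ℝ) :
    ((fracInt σ η 0 f y - fracInt σ η 0 f y' : ℝ) : ℂ) = (Real.Gamma (1 - σ) : ℂ) *
      ∫ ξ, (expi y ξ - expi y' ξ) *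
        (((2 * Real.pi * (η * ξ) : ℝ) : ℂ) * Complex.I) ^ ((σ - 1 : ℝ) : ℂ) * U ξ := by
  have hη0 : η ≠ 0 := by rintro rfl; simp at hη
  have hM : ∀ᵐ x, |f x| ≤ ∫ ξ, ‖U ξ‖ := by
    filter_upwards [hf] with x hx
    rw [← Real.norm_eq_abs, ← Complex.norm_real, hx]
    refine (norm_integral_le_integral_norm _).trans (le_of_eq ?_)
    simp [norm_expi]
  have hlim := ((tendsto_fracInt hσ1 hη hfm hM hsupp y).sub
    (tendsto_fracInt hσ1 hη hfm hM hsupp y'))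
  have hlim' := (Complex.continuous_ofReal.tendsto _).comp hlim
  set p : ℝ → ℝ → ℂ := fun ε ξ =>
    ((ε : ℂ) + ((2 * Real.pi * (η * ξ) : ℝ) : ℂ) * Complex.I) ^ ((σ - 1 : ℝ) : ℂ) with hp
  have hpm : ∀ ε, Measurable (p ε) := fun ε => by
    simp only [hp]
    exact Measurable.pow_const (by fun_prop) _
  have habs : ∀ ξ, |2 * Real.pi * (η * ξ)| = |2 * Real.pi * ξ| := fun ξ => by
    rw [mul_left_comm, abs_mul, hη, one_mul]
  have hre : ∀ ε ξ : ℝ, ((ε : ℂ) + ((2 * Real.pi * (η * ξ) : ℝ) : ℂ) * Complex.I).im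
      = 2 * Real.pi * (η * ξ) := fun ε ξ => by simp
  have hpn : ∀ ε ξ : ℝ, ξ ≠ 0 → ‖p ε ξ‖ ≤ |2 * Real.pi * ξ| ^ (σ - 1) := by
    intro ε ξ hξ
    simp only [hp]
    have h0 : 0 < |2 * Real.pi * ξ| := abs_pos.2 (by positivity)
    have h1 : |2 * Real.pi * ξ| ≤ ‖(ε : ℂ) + ((2 * Real.pi * (η * ξ) : ℝ) : ℂ) * Complex.I‖ := by
      have := Complex.abs_im_le_norm ((ε : ℂ) + ((2 * Real.pi * (η * ξ) : ℝ) : ℂ) * Complex.I)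
      rwa [hre, habs] at this
    rw [Complex.norm_cpow_real]
    exact Real.rpow_le_rpow_of_nonpos h0 h1 (by linarith)
  have hdom : Integrable fun ξ => (2 + |y - y'|) * ‖U ξ‖ := hU.norm.const_mul _
  have hbound : ∀ ε ξ : ℝ, ξ ≠ 0 → ‖(expi y ξ - expi y' ξ) * p ε ξ * U ξ‖
      ≤ (2 + |y - y'|) * ‖U ξ‖ := by
    intro ε ξ hξ
    have h0 : 0 < |2 * Real.pi * ξ| := abs_pos.2 (by positivity)
    rw [norm_mul, norm_mul]
    gcongr
    have h1 : ‖expi y ξ - expi y' ξ‖ ≤ 2 := by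
      refine (norm_sub_le _ _).trans ?_
      rw [norm_expi, norm_expi]; norm_num
    have h2 := norm_expi_sub_le y y' ξ
    rcases le_total |2 * Real.pi * ξ| 1 with h | h
    · calc ‖expi y ξ - expi y' ξ‖ * ‖p ε ξ‖
          ≤ (|2 * Real.pi * ξ| * |y - y'|) * |2 * Real.pi * ξ| ^ (σ - 1) := by
            gcongr
            exact hpn ε ξ hξ
        _ = |2 * Real.pi * ξ| ^ σ * |y - y'| := by
            rw [Real.rpow_sub_one h0.ne']; field_simp
        _ ≤ 1 * |y - y'| := by
            gcongr
            exact Real.rpow_le_one h0.le h hσ0.le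
        _ ≤ _ := by linarith
    · calc ‖expi y ξ - expi y' ξ‖ * ‖p ε ξ‖ ≤ 2 * |2 * Real.pi * ξ| ^ (σ - 1) := by
            gcongr
            exact hpn ε ξ hξ
        _ ≤ 2 * 1 := by
            gcongr
            exact Real.rpow_le_one_of_one_le_of_nonpos h (by linarith)
        _ ≤ _ := by linarith [abs_nonneg (y - y')]
  have hne : ∀ᵐ ξ : ℝ, ξ ≠ 0 := by simp [ae_iff, measure_singleton]
  have hR : Tendsto (fun ε => (Real.Gamma (1 - σ) : ℂ) * ∫ ξ, (expi y ξ - expi y' ξ) * p ε ξ * U ξ)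
      (𝓝[>] 0) (𝓝 ((Real.Gamma (1 - σ) : ℂ) * ∫ ξ, (expi y ξ - expi y' ξ) *
        (((2 * Real.pi * (η * ξ) : ℝ) : ℂ) * Complex.I) ^ ((σ - 1 : ℝ) : ℂ) * U ξ)) := by
    refine Tendsto.const_mul _ ?_
    refine tendsto_integral_filter_of_dominated_convergence _ ?_ ?_ hdom ?_
    · exact Eventually.of_forall fun ε => (((continuous_expi y).sub
        (continuous_expi y')).aestronglyMeasurable.mul (hpm ε).aestronglyMeasurable).mul hU.1
    · refine Eventually.of_forall fun ε => ?_
      filter_upwards [hne] with ξ hξ using hbound ε ξ hξ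
    · filter_upwards [hne] with ξ hξ
      refine Tendsto.mul_const _ (Tendsto.const_mul _ ?_)
      have hc : ContinuousAt (fun ε : ℝ => p ε ξ) 0 := by
        simp only [hp]
        refine ContinuousAt.cpow (by fun_prop) continuousAt_const ?_
        refine Or.inr ?_
        rw [hre]
        simp [Real.pi_ne_zero, hη0, hξ]
      have := hc.tendsto.mono_left (nhdsWithin_le_nhds (s := Ioi 0))
      simpa [hp] using this
  refine tendsto_nhds_unique hlim' (hR.congr' ?_)
  filter_upwards [self_mem_nhdsWithin] with ε hε
  have hε' : (0 : ℝ) < ε := hε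
  simp only [Function.comp_apply, Complex.ofReal_sub]
  rw [fracInt_damped_eq hσ1 hη0 hε' hU hf, fracInt_damped_eq hσ1 hη0 hε' hU hf, ← mul_sub]
  have hI : ∀ y, Integrable fun ξ => expi y ξ * p ε ξ * U ξ := by
    intro y
    refine (hU.norm.const_mul (ε ^ (σ - 1))).mono' (((continuous_expi y).aestronglyMeasurable.mul
      (hpm ε).aestronglyMeasurable).mul hU.1) (Eventually.of_forall fun ξ => ?_)
    rw [norm_mul, norm_mul, norm_expi, one_mul]
    gcongr
    simp only [hp]
    rw [Complex.norm_cpow_real]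
    refine Real.rpow_le_rpow_of_nonpos hε' ?_ (by linarith)
    have := Complex.abs_re_le_norm ((ε : ℂ) + ((2 * Real.pi * (η * ξ) : ℝ) : ℂ) * Complex.I)
    refine le_trans (le_of_eq ?_) this
    simp [abs_of_pos hε']
  rw [← integral_sub (hI y) (hI y')]
  congr 1
  refine integral_congr_ae (Eventually.of_forall fun ξ => ?_)
  simp only [hp]
  ring

open scoped ComplexConjugate

theorem fourier_indicator_Ioc {y' y : ℝ} (h : y' ≤ y) {ξ : ℝ} (hξ : ξ ≠ 0) :
    conj (𝓕 ((Ioc y' y).indicator fun _ => (1 : ℂ)) ξ) * (((2 * Real.pi * ξ : ℝ) : ℂ) * Complex.I)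
      = expi y ξ - expi y' ξ := by
  set c : ℂ := -(((2 * Real.pi * ξ : ℝ) : ℂ) * Complex.I) with hc
  have hc0 : c ≠ 0 := by
    rw [hc, neg_ne_zero]
    have : (2 * Real.pi * ξ : ℝ) ≠ 0 := by positivity
    simp only [mul_ne_zero_iff]
    exact ⟨by exact_mod_cast this, Complex.I_ne_zero⟩
  have e : 𝓕 ((Ioc y' y).indicator fun _ => (1 : ℂ)) ξ
      = (Complex.exp (c * y) - Complex.exp (c * y')) / c := by
    rw [← integral_exp_mul_complex hc0, intervalIntegral.integral_of_le h,
      ← integral_indicator measurableSet_Ioc, Real.fourier_eq']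
    refine integral_congr_ae (Filter.Eventually.of_forall fun v => ?_)
    by_cases hv : v ∈ Ioc y' y
    · simp only [indicator_of_mem hv, smul_eq_mul, mul_one, hc]
      congr 1
      simp
      ring
    · simp only [indicator_of_notMem hv, smul_zero]
  have hcc : conj c = -c := by
    rw [hc, map_neg, map_mul, Complex.conj_ofReal, Complex.conj_I]; ring
  have hexp : ∀ t : ℝ, conj (Complex.exp (c * t)) = expi t ξ := fun t => by
    rw [← Complex.exp_conj, map_mul, hcc, Complex.conj_ofReal, expi, hc]
    congr 1
    push_cast; ring
  rw [e, map_div₀, map_sub, hexp, hexp, hcc]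
  have : ((2 * Real.pi * ξ : ℝ) : ℂ) * Complex.I = -c := by rw [hc, neg_neg]
  rw [this]
  field_simp

/-- Parseval against the indicator of (y', y]. One factor 2πiξ of the symbol cancels the denominator
of the indicator's transform, leaving the power σ - 1 of `fracInt_sub_eq`; η remains from 2πiηξ =
η·2πiξ. -/
theorem integral_fourierInv_Ioc {σ η : ℝ} (hσ0 : 0 < σ) (hσ1 : σ < 1) (hη : |η| = 1) {f : ℝ → ℝ}
    (hfm : Measurable f) {U : ℝ → ℂ} (hU : Integrable U)
    (hf : ∀ᵐ x, (f x : ℂ) = ∫ ξ, expi x ξ * U ξ) {a b : ℝ}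
    (hsupp : ∀ x ∉ Ioo a b, f x = 0)
    (hV : MemLp (fun ξ => (((2 * Real.pi * (η * ξ) : ℝ) : ℂ) * Complex.I) ^ (σ : ℂ) * U ξ) 2)
    {y' y : ℝ} (h : y' ≤ y) :
    ∫ x in Ioc y' y, (𝓕⁻ (hV.toLp _) : CL2) x =
      ((η * (Real.Gamma (1 - σ))⁻¹ * (fracInt σ η 0 f y - fracInt σ η 0 f y') : ℝ) : ℂ) := by
  have hη2 : η * η = 1 := by rw [← abs_mul_abs_self, hη, one_mul]
  have hη0 : η ≠ 0 := by rintro rfl; simp at hη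
  have hfin : volume (Ioc y' y) ≠ ⊤ := by simp
  rw [← L2.inner_indicatorConstLp_one (𝕜 := ℂ) measurableSet_Ioc hfin, ← Lp.inner_fourier_eq,
    FourierTransform.fourier_fourierInv_eq, L2.inner_def]
  have hI : Integrable ((Ioc y' y).indicator fun _ => (1 : ℂ)) :=
    (integrable_indicator_iff measurableSet_Ioc).2 (integrableOn_const hfin)
  have hI2 : MemLp ((Ioc y' y).indicator fun _ => (1 : ℂ)) 2 (volume : Measure ℝ) :=
    memLp_indicator_const 2 measurableSet_Ioc 1 (Or.inr hfin)
  have hG : Real.Gamma (1 - σ) ≠ 0 := (Real.Gamma_pos_of_pos (by linarith)).ne'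
  have hne : ∀ᵐ ξ : ℝ, ξ ≠ 0 := by simp [ae_iff, measure_singleton]
  have e : ∫ ξ, inner ℂ ((𝓕 (indicatorConstLp 2 measurableSet_Ioc hfin (1 : ℂ)) : CL2) ξ)
      ((hV.toLp _ : CL2) ξ) = ∫ ξ, (η : ℂ) * ((expi y ξ - expi y' ξ) *
        (((2 * Real.pi * (η * ξ) : ℝ) : ℂ) * Complex.I) ^ ((σ - 1 : ℝ) : ℂ) * U ξ) := by
    refine integral_congr_ae ?_
    filter_upwards [fourier_toLp_ae_eq hI hI2, hV.coeFn_toLp, hne] with ξ h1 h2 hξ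
    rw [h2, RCLike.inner_apply]
    have h1' : (𝓕 (indicatorConstLp 2 measurableSet_Ioc hfin (1 : ℂ)) : CL2) ξ
      = 𝓕 ((Ioc y' y).indicator fun _ => (1 : ℂ)) ξ := h1
    rw [h1', ← fourier_indicator_Ioc h hξ]
    have hz : ((2 * Real.pi * (η * ξ) : ℝ) : ℂ) * Complex.I ≠ 0 := by
      have : (2 * Real.pi * (η * ξ) : ℝ) ≠ 0 := by positivity
      exact mul_ne_zero (by exact_mod_cast this) Complex.I_ne_zero
    have hpow : (((2 * Real.pi * (η * ξ) : ℝ) : ℂ) * Complex.I) ^ (σ : ℂ)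
        = (((2 * Real.pi * (η * ξ) : ℝ) : ℂ) * Complex.I) ^ ((σ - 1 : ℝ) : ℂ) *
          ((η : ℂ) * (((2 * Real.pi * ξ : ℝ) : ℂ) * Complex.I)) := by
      rw [Complex.ofReal_sub, Complex.ofReal_one, Complex.cpow_sub _ _ hz, Complex.cpow_one,
        show (η : ℂ) * (((2 * Real.pi * ξ : ℝ) : ℂ) * Complex.I)
          = ((2 * Real.pi * (η * ξ) : ℝ) : ℂ) * Complex.I by push_cast; ring,
        div_mul_cancel₀ _ hz]
    rw [hpow]
    ring
  rw [e, integral_const_mul]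
  have key := fracInt_sub_eq hσ0 hσ1 hη hfm hU hf hsupp y y'
  rw [mul_assoc, Complex.ofReal_mul, Complex.ofReal_mul, key, Complex.ofReal_inv,
    inv_mul_cancel_left₀ (by exact_mod_cast hG)]

/-- The multiplier `(±2πiξ)^σ` acts as the Riemann-Liouville derivative. -/
theorem fourierInv_ae_eq_deriv {σ η : ℝ} (hσ0 : 0 < σ) (hσ1 : σ < 1) (hη : |η| = 1) {f : ℝ → ℝ}
    (hfm : Measurable f) {U : ℝ → ℂ} (hU : Integrable U)
    (hf : ∀ᵐ x, (f x : ℂ) = ∫ ξ, expi x ξ * U ξ) {a b : ℝ}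
    (hsupp : ∀ x ∉ Ioo a b, f x = 0)
    (hV : MemLp (fun ξ => (((2 * Real.pi * (η * ξ) : ℝ) : ℂ) * Complex.I) ^ (σ : ℂ) * U ξ) 2) :
    ∀ᵐ x, (𝓕⁻ (hV.toLp _) : CL2) x =
      ((η * (Real.Gamma (1 - σ))⁻¹ * deriv (fracInt σ η 0 f) x : ℝ) : ℂ) := by
  set G : CL2 := 𝓕⁻ (hV.toLp _) with hG
  set H : ℝ → ℝ := fun y => η * (Real.Gamma (1 - σ))⁻¹ * (fracInt σ η 0 f y - fracInt σ η 0 f 0)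
    with hH
  have hint : ∀ y : ℝ, ∫ t in (0 : ℝ)..y, G t = (H y : ℂ) := by
    intro y
    rcases le_total 0 y with h | h
    · rw [intervalIntegral.integral_of_le h]
      exact integral_fourierInv_Ioc hσ0 hσ1 hη hfm hU hf hsupp hV h
    · rw [intervalIntegral.integral_of_ge h,
        integral_fourierInv_Ioc hσ0 hσ1 hη hfm hU hf hsupp hV h, hH, ← Complex.ofReal_neg]
      congr 1
      ring
  -- The primitive of G is the real function H, so Lebesgue differentiation gives G = H' almost
  -- everywhere and forces the imaginary part of G to vanish.
  have hloc : LocallyIntegrable (G : ℝ → ℂ) volume := (Lp.memLp G).locallyIntegrable (by norm_num)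
  filter_upwards [LocallyIntegrable.ae_hasDerivAt_integral hloc] with x hx
  have h0 := hx 0
  simp only [hint] at h0
  have hre : HasDerivAt H (G x).re x := by
    have := Complex.reCLM.hasFDerivAt.comp_hasDerivAt x h0
    simpa [Function.comp_def] using this
  have him : HasDerivAt (fun _ : ℝ => (0 : ℝ)) (G x).im x := by
    have := Complex.imCLM.hasFDerivAt.comp_hasDerivAt x h0
    simpa [Function.comp_def] using this
  have him0 : (G x).im = 0 := him.unique (hasDerivAt_const x 0)
  have hd : deriv H x = η * (Real.Gamma (1 - σ))⁻¹ * deriv (fracInt σ η 0 f) x := by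
    rw [hH, deriv_const_mul_field, deriv_sub_const]
  rw [← hd, hre.deriv]
  exact Complex.ext rfl (by simpa using him0)

/-! ### Elements of `H₀^s` on the Fourier side -/

theorem energy_eq_lintegral {a b : ℝ} (s : ℝ) (u : L2 a b) :
    energy a b s u = ∫⁻ ξ, ENNReal.ofReal (1 + |2 * Real.pi * ξ| ^ (2 * s)) *
      ‖(𝓕 (zeroExtend a b u) : CL2) ξ‖ₑ ^ 2 := by
  have hm := measurable_coeFn (𝓕 (zeroExtend a b u) : CL2)
  have e : ‖u‖ₑ ^ 2 = ∫⁻ ξ, ‖(𝓕 (zeroExtend a b u) : CL2) ξ‖ₑ ^ 2 := by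
    rw [← enorm_sq_eq_lintegral, ← enorm_zeroExtend, ← ofReal_norm, ← ofReal_norm,
      Lp.norm_fourier_eq]
  rw [energy, e, fourierEnergy, ← lintegral_add_left (by fun_prop)]
  refine lintegral_congr fun ξ => ?_
  rw [ENNReal.ofReal_add (by positivity) (by positivity), add_mul, ENNReal.ofReal_one, one_mul]

theorem norm_sq_integrable_of_energy {a b s : ℝ} {u : L2 a b} (hu : energy a b s u < ⊤) :
    Integrable fun ξ : ℝ => (1 + |2 * Real.pi * ξ| ^ (2 * s)) *
      ‖(𝓕 (zeroExtend a b u) : CL2) ξ‖ ^ 2 := by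
  have hm := measurable_coeFn (𝓕 (zeroExtend a b u) : CL2)
  refine ⟨(by fun_prop : Measurable _).aestronglyMeasurable, ?_⟩
  rw [hasFiniteIntegral_iff_ofReal (Filter.Eventually.of_forall fun ξ => by positivity)]
  rw [energy_eq_lintegral] at hu
  refine lt_of_le_of_lt (le_of_eq (lintegral_congr fun ξ => ?_)) hu
  rw [ENNReal.ofReal_mul (by positivity), ENNReal.ofReal_pow (norm_nonneg _), ofReal_norm]

/-- Decay of order 2s > 1 at infinity. This is what makes transforms of finite-energy functions
integrable. -/
theorem integrable_weight_inv {s : ℝ} (hs : 1 / 2 < s) (hs1 : s < 1) :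
    Integrable fun ξ : ℝ => (1 + |2 * Real.pi * ξ| ^ (2 * s))⁻¹ := by
  have h := (integrable_one_add_norm (E := ℝ) (μ := volume) (r := 2 * s)
    (by simp; linarith)).const_mul 4
  refine h.mono' (by fun_prop : Measurable _).aestronglyMeasurable
    (Filter.Eventually.of_forall fun ξ => ?_)
  rw [Real.norm_of_nonneg (by positivity), Real.norm_eq_abs, Real.rpow_neg (by positivity),
    ← div_eq_mul_inv, inv_eq_one_div, div_le_div_iff₀ (by positivity) (by positivity), one_mul]
  have h1 : |ξ| ≤ |2 * Real.pi * ξ| := by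
    rw [abs_mul, abs_of_pos (by positivity : 0 < 2 * Real.pi)]
    nlinarith [abs_nonneg ξ, Real.pi_gt_three]
  have h2 : (1 + |ξ|) ≤ 2 * max 1 |ξ| := by
    rcases max_cases 1 |ξ| with h | h <;> linarith
  calc (1 + |ξ|) ^ (2 * s) ≤ (2 * max 1 |ξ|) ^ (2 * s) := by gcongr
    _ = 2 ^ (2 * s) * max 1 |ξ| ^ (2 * s) := Real.mul_rpow (by norm_num) (by positivity)
    _ ≤ 4 * (1 + |2 * Real.pi * ξ| ^ (2 * s)) := by
        have h4 : (2 : ℝ) ^ (2 * s) ≤ 4 := by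
          calc (2 : ℝ) ^ (2 * s) ≤ 2 ^ (2 : ℝ) :=
                Real.rpow_le_rpow_of_exponent_le (by norm_num) (by linarith)
            _ = 4 := by norm_num
        have h5 : max 1 |ξ| ^ (2 * s) ≤ 1 + |2 * Real.pi * ξ| ^ (2 * s) := by
          rcases max_cases 1 |ξ| with h | h <;> rw [h.1]
          · rw [Real.one_rpow]; linarith [Real.rpow_nonneg (abs_nonneg (2 * Real.pi * ξ)) (2 * s)]
          · have : |ξ| ^ (2 * s) ≤ |2 * Real.pi * ξ| ^ (2 * s) :=
              Real.rpow_le_rpow (abs_nonneg _) h1 (by linarith)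
            linarith
        gcongr

/-- With weight q, 2n ≤ q n² + q⁻¹, and both terms on the right are integrable. -/
theorem integrable_fourier_of_energy {a b s : ℝ} (hs : 1 / 2 < s) (hs1 : s < 1) {u : L2 a b}
    (hu : energy a b s u < ⊤) : Integrable (𝓕 (zeroExtend a b u) : CL2) := by
  have hm := measurable_coeFn (𝓕 (zeroExtend a b u) : CL2)
  refine ((integrable_weight_inv hs hs1).add (norm_sq_integrable_of_energy hu)).mono'
    hm.aestronglyMeasurable (Filter.Eventually.of_forall fun ξ => ?_)
  simp only [Pi.add_apply]
  set q := 1 + |2 * Real.pi * ξ| ^ (2 * s) with hq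
  have hq0 : 0 < q := by positivity
  set n := ‖(𝓕 (zeroExtend a b u) : CL2) ξ‖
  have h1 : 0 ≤ q⁻¹ * (q * n - 1) ^ 2 := by positivity
  have h2 : q⁻¹ * (q * n - 1) ^ 2 = q * n ^ 2 - 2 * n + q⁻¹ := by
    field_simp
    ring
  have : 0 ≤ q * n ^ 2 := by positivity
  have : 0 ≤ q⁻¹ := by positivity
  linarith

/-- The real zero extension as a function. -/
def zeroExtendFun {a b : ℝ} (u : L2 a b) : ℝ → ℝ := (Ioo a b).indicator u

theorem measurable_zeroExtendFun {a b : ℝ} (u : L2 a b) : Measurable (zeroExtendFun u) :=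
  (Lp.stronglyMeasurable u).measurable.indicator measurableSet_Ioo

theorem zeroExtendFun_inversion {a b s : ℝ} (hs : 1 / 2 < s) (hs1 : s < 1) {u : L2 a b}
    (hu : energy a b s u < ⊤) :
    ∀ᵐ x, (zeroExtendFun u x : ℂ) = ∫ ξ, expi x ξ * (𝓕 (zeroExtend a b u) : CL2) ξ := by
  set w := zeroExtend a b u
  have h1 := integrable_fourier_of_energy hs hs1 hu
  have e : (𝓕⁻ ((Lp.memLp (𝓕 w : CL2)).toLp _) : CL2) = w := by
    rw [Lp.toLp_coeFn, FourierTransform.fourierInv_fourier_eq]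
  have h2 := fourierInv_toLp_ae_eq h1 (Lp.memLp (𝓕 w : CL2))
  rw [e] at h2
  filter_upwards [h2, coeFn_zeroExtend u] with x hx hx'
  have h3 : (zeroExtendFun u x : ℂ) = w x := by
    rw [hx', zeroExtendFun]
    by_cases h : x ∈ Ioo a b
    · rw [indicator_of_mem h, indicator_of_mem h]
    · rw [indicator_of_notMem h, indicator_of_notMem h, Complex.ofReal_zero]
  rw [h3, hx, Real.fourierInv_eq']
  refine integral_congr_ae (Filter.Eventually.of_forall fun ξ => ?_)
  simp only [expi, smul_eq_mul, RCLike.inner_apply, conj_trivial]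
  rfl

theorem norm_mul_I_cpow (η ξ σ : ℝ) (hη : |η| = 1) :
    ‖(((2 * Real.pi * (η * ξ) : ℝ) : ℂ) * Complex.I) ^ (σ : ℂ)‖ = |2 * Real.pi * ξ| ^ σ := by
  rw [Complex.norm_cpow_real, norm_mul, Complex.norm_I, mul_one, Complex.norm_real,
    Real.norm_eq_abs, mul_left_comm, abs_mul, hη, one_mul]

theorem rpow_le_weight {t σ r : ℝ} (ht : 0 ≤ t) (hσ : 0 ≤ σ) (h : σ ≤ r) : t ^ σ ≤ 1 + t ^ r := by
  rcases le_total t 1 with h1 | h1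
  · have := Real.rpow_le_one ht h1 hσ
    have := Real.rpow_nonneg ht r
    linarith
  · have := Real.rpow_le_rpow_of_exponent_le h1 h
    linarith

theorem measurable_mul_I_cpow (η σ : ℝ) :
    Measurable fun ξ : ℝ => (((2 * Real.pi * (η * ξ) : ℝ) : ℂ) * Complex.I) ^ (σ : ℂ) :=
  Measurable.pow_const (by fun_prop) _

theorem memLp_mul_fourier {a b s σ η : ℝ} (hσ : 0 ≤ σ) (hσs : σ ≤ s) (hη : |η| = 1) {u : L2 a b}
    (hu : energy a b s u < ⊤) :
    MemLp (fun ξ => (((2 * Real.pi * (η * ξ) : ℝ) : ℂ) * Complex.I) ^ (σ : ℂ) *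
      (𝓕 (zeroExtend a b u) : CL2) ξ) 2 := by
  have hm := measurable_coeFn (𝓕 (zeroExtend a b u) : CL2)
  have hmeas : AEStronglyMeasurable (fun ξ => (((2 * Real.pi * (η * ξ) : ℝ) : ℂ) * Complex.I) ^
      (σ : ℂ) * (𝓕 (zeroExtend a b u) : CL2) ξ) volume :=
    ((measurable_mul_I_cpow η σ).mul hm).aestronglyMeasurable
  rw [memLp_two_iff_integrable_sq_norm hmeas]
  refine (norm_sq_integrable_of_energy hu).mono' (hmeas.norm.pow 2)
    (Filter.Eventually.of_forall fun ξ => ?_)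
  rw [Real.norm_of_nonneg (by positivity), norm_mul, norm_mul_I_cpow _ _ _ hη, mul_pow]
  gcongr
  rw [← Real.rpow_natCast, ← Real.rpow_mul (abs_nonneg _)]
  exact rpow_le_weight (abs_nonneg _) (by positivity) (by push_cast; linarith)

theorem fracInt_eq_zero {σ η a b x : ℝ} {u : L2 a b}
    (h : ∀ z, 0 < z → x - η * z ∉ Ioo a b) : fracInt σ η 0 (zeroExtendFun u) x = 0 := by
  rw [fracInt]
  refine (setIntegral_congr_fun measurableSet_Ioi fun z hz => ?_).trans
    (integral_zero _ _ (μ := volume.restrict (Ioi 0)))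
  simp only [zeroExtendFun, indicator_of_notMem (h z hz), mul_zero]

theorem fracInt_left_eq {a b σ y : ℝ} (u : L2 a b) (hy : y ∈ Ioo a b) :
    fracInt σ 1 0 (zeroExtendFun u) y = ∫ ξ in a..y, Real.exp (0 * ξ) * u ξ / (y - ξ) ^ σ := by
  have hp := Measure.measurePreserving_sub_left (volume : Measure ℝ) y
  have he := (MeasurableEquiv.subLeft y).measurableEmbedding
  have hpre : (fun z : ℝ => y - z) ⁻¹' Iio y = Ioi 0 := by ext t; simp
  have key := hp.setIntegral_preimage_emb he (fun ξ => (y - ξ) ^ (-σ) * zeroExtendFun u ξ) (Iio y)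
  rw [hpre] at key
  have e1 : fracInt σ 1 0 (zeroExtendFun u) y
      = ∫ ξ in Iio y, (y - ξ) ^ (-σ) * zeroExtendFun u ξ := by
    rw [← key, fracInt]
    simp
  rw [e1, intervalIntegral.integral_of_le hy.1.le, integral_Ioc_eq_integral_Ioo,
    ← integral_indicator measurableSet_Iio, ← integral_indicator measurableSet_Ioo]
  congr 1
  funext ξ
  by_cases h1 : ξ < y
  · rw [indicator_of_mem (show ξ ∈ Iio y from h1)]
    by_cases h2 : a < ξ
    · rw [indicator_of_mem (show ξ ∈ Ioo a y from ⟨h2, h1⟩), zeroExtendFun,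
        indicator_of_mem (show ξ ∈ Ioo a b from ⟨h2, h1.trans hy.2⟩),
        Real.rpow_neg (by linarith), zero_mul, Real.exp_zero]
      field_simp
    · rw [indicator_of_notMem (fun h => h2 h.1), zeroExtendFun, indicator_of_notMem (fun h => h2 h.1),
        mul_zero]
  · rw [indicator_of_notMem (show ξ ∉ Iio y from h1), indicator_of_notMem (fun h => h1 h.2)]

theorem fracInt_right_eq {a b σ y : ℝ} (u : L2 a b) (hy : y ∈ Ioo a b) :
    fracInt σ (-1) 0 (zeroExtendFun u) y = ∫ ξ in y..b, Real.exp (-0 * ξ) * u ξ / (ξ - y) ^ σ := by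
  have hp := measurePreserving_add_left (volume : Measure ℝ) y
  have he := (MeasurableEquiv.addLeft y).measurableEmbedding
  have hpre : (fun z : ℝ => y + z) ⁻¹' Ioi y = Ioi 0 := by ext t; simp
  have key := hp.setIntegral_preimage_emb he (fun ξ => (ξ - y) ^ (-σ) * zeroExtendFun u ξ) (Ioi y)
  rw [hpre] at key
  have e1 : fracInt σ (-1) 0 (zeroExtendFun u) y
      = ∫ ξ in Ioi y, (ξ - y) ^ (-σ) * zeroExtendFun u ξ := by
    rw [← key, fracInt]
    simp
  rw [e1, intervalIntegral.integral_of_le hy.2.le, integral_Ioc_eq_integral_Ioo,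
    ← integral_indicator measurableSet_Ioi, ← integral_indicator measurableSet_Ioo]
  congr 1
  funext ξ
  by_cases h1 : y < ξ
  · rw [indicator_of_mem (show ξ ∈ Ioi y from h1)]
    by_cases h2 : ξ < b
    · rw [indicator_of_mem (show ξ ∈ Ioo y b from ⟨h1, h2⟩), zeroExtendFun,
        indicator_of_mem (show ξ ∈ Ioo a b from ⟨hy.1.trans h1, h2⟩),
        Real.rpow_neg (by linarith), neg_zero, zero_mul, Real.exp_zero]
      field_simp
    · rw [indicator_of_notMem (fun h => h2 h.2), zeroExtendFun, indicator_of_notMem (fun h => h2 h.2),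
        mul_zero]
  · rw [indicator_of_notMem (show ξ ∉ Ioi y from h1), indicator_of_notMem (fun h => h1 h.1)]

theorem leftDeriv_eq_deriv {a b σ x : ℝ} (u : L2 a b) (hx : x ∈ Ioo a b) :
    leftDeriv a σ 0 u x
      = 1 * (Real.Gamma (1 - σ))⁻¹ * deriv (fracInt σ 1 0 (zeroExtendFun u)) x := by
  have h : (fun y => ∫ ξ in a..y, Real.exp (0 * ξ) * u ξ / (y - ξ) ^ σ)
      =ᶠ[nhds x] fracInt σ 1 0 (zeroExtendFun u) := by
    filter_upwards [isOpen_Ioo.mem_nhds hx] with y hy using (fracInt_left_eq u hy).symm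
  rw [leftDeriv, h.deriv_eq]
  simp

theorem rightDeriv_eq_deriv {a b σ x : ℝ} (u : L2 a b) (hx : x ∈ Ioo a b) :
    rightDeriv b σ 0 u x
      = -1 * (Real.Gamma (1 - σ))⁻¹ * deriv (fracInt σ (-1) 0 (zeroExtendFun u)) x := by
  have h : (fun y => ∫ ξ in y..b, Real.exp (-0 * ξ) * u ξ / (ξ - y) ^ σ)
      =ᶠ[nhds x] fracInt σ (-1) 0 (zeroExtendFun u) := by
    filter_upwards [isOpen_Ioo.mem_nhds hx] with y hy using (fracInt_right_eq u hy).symm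
  rw [rightDeriv, h.deriv_eq]
  simp

/-! ### Bilinear forms on the Fourier side -/

/-- The sesquilinear form with symbol `p`. -/
def fourierForm {a b : ℝ} (p : ℝ → ℂ) (u v : L2 a b) : ℂ :=
  ∫ ξ, p ξ * ((𝓕 (zeroExtend a b u) : CL2) ξ * conj ((𝓕 (zeroExtend a b v) : CL2) ξ))

theorem integrable_fourierForm_dom {a b s : ℝ} {u v : L2 a b} (hu : energy a b s u < ⊤)
    (hv : energy a b s v < ⊤) : Integrable fun ξ : ℝ => (1 + |2 * Real.pi * ξ| ^ (2 * s)) *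
      (‖(𝓕 (zeroExtend a b u) : CL2) ξ‖ * ‖(𝓕 (zeroExtend a b v) : CL2) ξ‖) := by
  have hmu := measurable_coeFn (𝓕 (zeroExtend a b u) : CL2)
  have hmv := measurable_coeFn (𝓕 (zeroExtend a b v) : CL2)
  refine ((norm_sq_integrable_of_energy hu).add (norm_sq_integrable_of_energy hv)).mono'
    (by fun_prop : Measurable _).aestronglyMeasurable (Filter.Eventually.of_forall fun ξ => ?_)
  simp only [Pi.add_apply]
  rw [Real.norm_of_nonneg (by positivity), ← mul_add]
  gcongr
  nlinarith [sq_nonneg (‖(𝓕 (zeroExtend a b u) : CL2) ξ‖ - ‖(𝓕 (zeroExtend a b v) : CL2) ξ‖),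
    sq_nonneg ‖(𝓕 (zeroExtend a b u) : CL2) ξ‖, sq_nonneg ‖(𝓕 (zeroExtend a b v) : CL2) ξ‖]

theorem integrable_fourierForm {a b s C : ℝ} {p : ℝ → ℂ} (hp : Measurable p)
    (hpb : ∀ ξ, ‖p ξ‖ ≤ C * (1 + |2 * Real.pi * ξ| ^ (2 * s))) {u v : L2 a b}
    (hu : energy a b s u < ⊤) (hv : energy a b s v < ⊤) :
    Integrable fun ξ => p ξ * ((𝓕 (zeroExtend a b u) : CL2) ξ *
      conj ((𝓕 (zeroExtend a b v) : CL2) ξ)) := by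
  have hmu := measurable_coeFn (𝓕 (zeroExtend a b u) : CL2)
  have hmv := measurable_coeFn (𝓕 (zeroExtend a b v) : CL2)
  refine ((integrable_fourierForm_dom hu hv).const_mul C).mono' ?_
    (Filter.Eventually.of_forall fun ξ => ?_)
  · exact (hp.mul (hmu.mul (Complex.continuous_conj.measurable.comp hmv))).aestronglyMeasurable
  · rw [norm_mul, norm_mul, RCLike.norm_conj, ← mul_assoc C]
    gcongr
    exact hpb ξ

theorem norm_mul_I_cpow_le {s σ ξ : ℝ} (hσ : 0 ≤ σ) (h : σ ≤ 2 * s) :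
    ‖(((2 * Real.pi * ξ : ℝ) : ℂ) * Complex.I) ^ (σ : ℂ)‖
      ≤ 1 * (1 + |2 * Real.pi * ξ| ^ (2 * s)) := by
  have := norm_mul_I_cpow 1 ξ σ (by simp)
  rw [one_mul] at this
  rw [this, one_mul]
  exact rpow_le_weight (abs_nonneg _) hσ h

/-- An imaginary base avoids the branch cut, so conjugation commutes with the power. Hence the
conjugated right symbol is a left symbol, and orders of left and right derivatives add. -/
theorem conj_mul_I_cpow (ξ τ : ℝ) :
    conj ((((2 * Real.pi * (-1 * ξ) : ℝ) : ℂ) * Complex.I) ^ (τ : ℂ))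
      = (((2 * Real.pi * ξ : ℝ) : ℂ) * Complex.I) ^ (τ : ℂ) := by
  have harg : (((2 * Real.pi * (-1 * ξ) : ℝ) : ℂ) * Complex.I).arg ≠ Real.pi := by
    rw [Ne, Complex.arg_eq_pi_iff]
    simp
  have h := Complex.conj_cpow (((2 * Real.pi * (-1 * ξ) : ℝ) : ℂ) * Complex.I) (τ : ℂ) harg
  rw [Complex.conj_ofReal] at h
  rw [← h, map_mul, Complex.conj_ofReal, Complex.conj_I]
  congr 1
  push_cast
  ring

/-- The left derivative of the zero extension vanishes left of a and the right derivative vanishes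
right of b. Their product therefore lives on (a, b), the integral over Ω is an inner product over
the line, and Plancherel applies. -/
theorem ip_deriv_eq_fourierForm {a b s σ τ : ℝ} (hs : 1 / 2 < s) (hs1 : s < 1) (hσ : 0 < σ)
    (hσs : σ ≤ s) (hτ : 0 < τ) (hτs : τ ≤ s) {u v : L2 a b} (hu : energy a b s u < ⊤)
    (hv : energy a b s v < ⊤) :
    (ip a b (leftDeriv a σ 0 u) (rightDeriv b τ 0 v) : ℂ)
      = fourierForm (fun ξ => (((2 * Real.pi * ξ : ℝ) : ℂ) * Complex.I) ^ ((σ + τ : ℝ) : ℂ)) u v := by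
  have hVu := memLp_mul_fourier (η := 1) hσ.le hσs (by simp) hu
  have hVv := memLp_mul_fourier (η := -1) hτ.le hτs (by simp) hv
  have hoff : ∀ w : L2 a b, ∀ x ∉ Ioo a b, zeroExtendFun w x = 0 := fun w x hx =>
    indicator_of_notMem hx _
  have hGu := fourierInv_ae_eq_deriv hσ (by linarith) (by simp) (measurable_zeroExtendFun u)
    (integrable_fourier_of_energy hs hs1 hu) (zeroExtendFun_inversion hs hs1 hu) (hoff u) hVu
  have hGv := fourierInv_ae_eq_deriv hτ (by linarith) (by simp) (measurable_zeroExtendFun v)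
    (integrable_fourier_of_energy hs hs1 hv) (zeroExtendFun_inversion hs hs1 hv) (hoff v) hVv
  set Gu : CL2 := 𝓕⁻ (hVu.toLp _)
  set Gv : CL2 := 𝓕⁻ (hVv.toLp _)
  have hza : ∀ x < a, deriv (fracInt σ 1 0 (zeroExtendFun u)) x = 0 := by
    intro x hx
    have : fracInt σ 1 0 (zeroExtendFun u) =ᶠ[nhds x] fun _ => 0 := by
      filter_upwards [gt_mem_nhds hx] with y hy
      exact fracInt_eq_zero fun z hz h => by linarith [h.1]
    rw [this.deriv_eq, deriv_const]
  have hzb : ∀ x, b < x → deriv (fracInt τ (-1) 0 (zeroExtendFun v)) x = 0 := by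
    intro x hx
    have : fracInt τ (-1) 0 (zeroExtendFun v) =ᶠ[nhds x] fun _ => 0 := by
      filter_upwards [lt_mem_nhds hx] with y hy
      exact fracInt_eq_zero fun z hz h => by linarith [h.2]
    rw [this.deriv_eq, deriv_const]
  have e1 : (ip a b (leftDeriv a σ 0 u) (rightDeriv b τ 0 v) : ℂ) = inner ℂ Gv Gu := by
    rw [ip, ← integral_complex_ofReal, ← integral_indicator measurableSet_Ioo, L2.inner_def]
    refine integral_congr_ae ?_
    have hna : ∀ᵐ x : ℝ, x ≠ a := by simp [ae_iff, measure_singleton]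
    have hnb : ∀ᵐ x : ℝ, x ≠ b := by simp [ae_iff, measure_singleton]
    filter_upwards [hGu, hGv, hna, hnb] with x h1 h2 h3 h4
    rw [RCLike.inner_apply, h1, h2, Complex.conj_ofReal]
    by_cases hx : x ∈ Ioo a b
    · rw [indicator_of_mem hx, leftDeriv_eq_deriv u hx, rightDeriv_eq_deriv v hx,
        Complex.ofReal_mul]
    · rw [indicator_of_notMem hx]
      rcases lt_or_gt_of_ne h3 with h | h
      · rw [hza x h]; simp
      · have : b < x := by
          rcases lt_or_gt_of_ne h4 with h5 | h5
          · exact absurd ⟨h, h5⟩ hx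
          · exact h5
        rw [hzb x this]; simp
  have hne : ∀ᵐ ξ : ℝ, ξ ≠ 0 := by simp [ae_iff, measure_singleton]
  rw [e1, ← Lp.inner_fourier_eq, FourierTransform.fourier_fourierInv_eq,
    FourierTransform.fourier_fourierInv_eq, L2.inner_def]
  refine integral_congr_ae ?_
  filter_upwards [hVu.coeFn_toLp, hVv.coeFn_toLp, hne] with ξ h1 h2 hξ
  have hz : ((2 * Real.pi * ξ : ℝ) : ℂ) * Complex.I ≠ 0 := by
    have : (2 * Real.pi * ξ : ℝ) ≠ 0 := by positivity
    exact mul_ne_zero (by exact_mod_cast this) Complex.I_ne_zero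
  rw [h1, h2, RCLike.inner_apply, map_mul, conj_mul_I_cpow, Complex.ofReal_add,
    Complex.cpow_add _ _ hz, one_mul]
  ring

theorem ip_eq_inner {a b : ℝ} (u v : L2 a b) :
    (ip a b u v : ℂ) = inner ℂ (zeroExtend a b v) (zeroExtend a b u) := by
  rw [ip, ← integral_complex_ofReal, ← integral_indicator measurableSet_Ioo, L2.inner_def]
  refine integral_congr_ae ?_
  filter_upwards [coeFn_zeroExtend u, coeFn_zeroExtend v] with x h1 h2
  rw [h1, h2, RCLike.inner_apply]
  by_cases hx : x ∈ Ioo a b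
  · simp only [indicator_of_mem hx, Complex.conj_ofReal, Complex.ofReal_mul]
  · simp only [indicator_of_notMem hx, zero_mul]

theorem inner_eq_fourierForm {a b : ℝ} (u v : L2 a b) :
    inner ℂ (zeroExtend a b v) (zeroExtend a b u) = fourierForm (fun _ => 1) u v := by
  rw [← Lp.inner_fourier_eq, L2.inner_def]
  refine integral_congr_ae (Filter.Eventually.of_forall fun ξ => ?_)
  simp only [RCLike.inner_apply, one_mul]

theorem ip_eq_fourierForm {a b : ℝ} (u v : L2 a b) :
    (ip a b u v : ℂ) = fourierForm (fun _ => 1) u v := by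
  rw [ip_eq_inner, inner_eq_fourierForm]

/-! ### The first order form as a limit of difference quotients -/

theorem inner_translate_eq {a b : ℝ} (h : ℝ) (u v : L2 a b) :
    inner ℂ (zeroExtend a b v) (translate h (zeroExtend a b u))
      = fourierForm (fun ξ => expi h ξ) u v := by
  rw [← Lp.inner_fourier_eq, L2.inner_def, fourier_translate]
  refine integral_congr_ae ?_
  filter_upwards [coeFn_mulL (memLp_fourierChar h) (𝓕 (zeroExtend a b u) : CL2)] with ξ h1
  rw [h1, RCLike.inner_apply, Real.fourierChar_apply, expi, mul_assoc]

/-- Pointwise, e^{-λ(x+h)} e^{λx} = e^{-λh}. -/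
theorem inner_translate_expMul {a b : ℝ} (h lam : ℝ) (u v : L2 a b) :
    inner ℂ (zeroExtend a b (expMul a b lam v)) (translate h (zeroExtend a b (expMul a b (-lam) u)))
      = (Real.exp (-lam * h) : ℂ) *
        inner ℂ (zeroExtend a b v) (translate h (zeroExtend a b u)) := by
  rw [L2.inner_def, L2.inner_def, ← integral_const_mul]
  refine integral_congr_ae ?_
  have hq := (measurePreserving_add_right (volume : Measure ℝ) h).quasiMeasurePreserving
  have hu := (ae_restrict_iff' measurableSet_Ioo).1 (coeFn_expMul (-lam) u)
  have hv := (ae_restrict_iff' measurableSet_Ioo).1 (coeFn_expMul lam v)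
  filter_upwards [coeFn_translate h (zeroExtend a b (expMul a b (-lam) u)),
    coeFn_translate h (zeroExtend a b u), coeFn_zeroExtend (expMul a b lam v), coeFn_zeroExtend v,
    hq.ae (coeFn_zeroExtend (expMul a b (-lam) u)), hq.ae (coeFn_zeroExtend u), hv, hq.ae hu]
    with x h1 h2 h3 h4 h5 h6 h7 h8
  rw [h1, h2, h3, h4, h5, h6, RCLike.inner_apply, RCLike.inner_apply]
  by_cases hx : x ∈ Ioo a b
  · by_cases hxh : x + h ∈ Ioo a b
    · simp only [indicator_of_mem hx, indicator_of_mem hxh, h7 hx, h8 hxh, Complex.conj_ofReal]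
      rw [← Complex.ofReal_mul, ← Complex.ofReal_mul, ← Complex.ofReal_mul]
      congr 1
      have : Real.exp (-lam * h) = Real.exp (-lam * (x + h)) * Real.exp (lam * x) := by
        rw [← Real.exp_add]; ring_nf
      rw [this]
      ring
    · simp only [indicator_of_notMem hxh, zero_mul, mul_zero]
  · simp only [indicator_of_notMem hx, map_zero, mul_zero]

-- Dominated convergence: |e^{2πihξ} - 1|/|h| ≤ |2πξ| ≤ 1 + |2πξ|^{2s}, since 2s > 1.
open Filter Topology in
theorem tendsto_difference_quotient {a b s : ℝ} (hs : 1 / 2 < s) {u v : L2 a b}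
    (hu : energy a b s u < ⊤) (hv : energy a b s v < ⊤) :
    Tendsto (fun h : ℝ => (h : ℂ)⁻¹ *
      (inner ℂ (zeroExtend a b v) (translate h (zeroExtend a b u))
        - inner ℂ (zeroExtend a b v) (zeroExtend a b u))) (𝓝[≠] 0)
      (𝓝 (fourierForm (fun ξ => ((2 * Real.pi * ξ : ℝ) : ℂ) * Complex.I) u v)) := by
  have hI : ∀ h, Integrable fun ξ => expi h ξ * ((𝓕 (zeroExtend a b u) : CL2) ξ *
      conj ((𝓕 (zeroExtend a b v) : CL2) ξ)) := fun h =>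
    integrable_fourierForm (C := 1) (continuous_expi h).measurable (fun ξ => by
      rw [norm_expi, one_mul]; linarith [Real.rpow_nonneg (abs_nonneg (2 * Real.pi * ξ)) (2 * s)])
      hu hv
  have h1 : ∀ ξ, expi 0 ξ = 1 := fun ξ => by simp [expi]
  have e : ∀ h : ℝ, (h : ℂ)⁻¹ * (inner ℂ (zeroExtend a b v) (translate h (zeroExtend a b u))
        - inner ℂ (zeroExtend a b v) (zeroExtend a b u))
      = ∫ ξ, ((h : ℂ)⁻¹ * (expi h ξ - expi 0 ξ)) * ((𝓕 (zeroExtend a b u) : CL2) ξ *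
        conj ((𝓕 (zeroExtend a b v) : CL2) ξ)) := by
    intro h
    have h2 : fourierForm (fun _ => 1) u v = fourierForm (fun ξ => expi 0 ξ) u v := by
      simp only [h1]
    rw [inner_translate_eq, inner_eq_fourierForm, h2, fourierForm, fourierForm,
      ← integral_sub (hI h) (hI 0), ← integral_const_mul]
    refine integral_congr_ae (Eventually.of_forall fun ξ => ?_)
    simp only
    ring
  simp only [e]
  refine tendsto_integral_filter_of_dominated_convergence _ ?_ ?_
    (integrable_fourierForm_dom hu hv) ?_
  · refine Eventually.of_forall fun h => ?_
    have hmu := measurable_coeFn (𝓕 (zeroExtend a b u) : CL2)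
    have hmv := measurable_coeFn (𝓕 (zeroExtend a b v) : CL2)
    exact ((measurable_const.mul ((continuous_expi h).sub (continuous_expi 0)).measurable).mul
      (hmu.mul (Complex.continuous_conj.measurable.comp hmv))).aestronglyMeasurable
  · filter_upwards [self_mem_nhdsWithin] with h hh
    have hh' : h ≠ 0 := hh
    refine Eventually.of_forall fun ξ => ?_
    rw [norm_mul, norm_mul, norm_mul, RCLike.norm_conj]
    gcongr
    have h2 := norm_expi_sub_le h 0 ξ
    rw [sub_zero] at h2
    calc ‖(h : ℂ)⁻¹‖ * ‖expi h ξ - expi 0 ξ‖ ≤ |h|⁻¹ * (|2 * Real.pi * ξ| * |h|) := by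
          rw [norm_inv, Complex.norm_real, Real.norm_eq_abs]
          gcongr
      _ = |2 * Real.pi * ξ| ^ (1 : ℝ) := by
          have : |h| ≠ 0 := abs_ne_zero.2 hh'
          rw [Real.rpow_one]
          field_simp
      _ ≤ _ := rpow_le_weight (abs_nonneg _) zero_le_one (by linarith)
  · refine Eventually.of_forall fun ξ => ?_
    refine Tendsto.mul_const _ ?_
    have hd : HasDerivAt (fun h : ℝ => expi h ξ)
        (((2 * Real.pi * ξ : ℝ) : ℂ) * Complex.I) 0 := by
      have h2 : HasDerivAt (fun h : ℝ => ((2 * Real.pi * (h * ξ) : ℝ) : ℂ) * Complex.I)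
          (((2 * Real.pi * (1 * ξ) : ℝ) : ℂ) * Complex.I) 0 :=
        ((((hasDerivAt_id (0 : ℝ)).mul_const ξ).const_mul (2 * Real.pi)).ofReal_comp).mul_const _
      have := h2.cexp
      simpa [expi] using this
    have := hasDerivAt_iff_tendsto_slope.1 hd
    refine this.congr fun h => ?_
    rw [slope_def_module, sub_zero, Complex.real_smul, Complex.ofReal_inv]

-- The product rule (e^{-λx}u)' e^{λx}v = u'v - λuv in weak form. As u' need not be a function, it
-- is proved for difference quotients: e^{-λh} multiplies the quotient for u, and (e^{-λh} - 1)/h →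
-- -λ gives the extra term.
open Filter Topology in
theorem fourierForm_deriv_expMul {a b s : ℝ} (hs : 1 / 2 < s) (lam : ℝ) {u v : L2 a b}
    (hu : energy a b s u < ⊤) (hv : energy a b s v < ⊤)
    (hu' : energy a b s (expMul a b (-lam) u) < ⊤) (hv' : energy a b s (expMul a b lam v) < ⊤) :
    fourierForm (fun ξ => ((2 * Real.pi * ξ : ℝ) : ℂ) * Complex.I) (expMul a b (-lam) u)
      (expMul a b lam v)
      = fourierForm (fun ξ => ((2 * Real.pi * ξ : ℝ) : ℂ) * Complex.I) u v
        - lam * inner ℂ (zeroExtend a b v) (zeroExtend a b u) := by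
  set I := inner ℂ (zeroExtend a b v) (zeroExtend a b u) with hI
  have h0 : inner ℂ (zeroExtend a b (expMul a b lam v)) (zeroExtend a b (expMul a b (-lam) u))
      = I := by
    have := inner_translate_expMul 0 lam u v
    have ht : ∀ w : CL2, translate 0 w = w := fun w => by
      apply Lp.ext
      filter_upwards [coeFn_translate 0 w] with x hx
      rw [hx, add_zero]
    simpa [ht] using this
  have hlim := tendsto_difference_quotient hs hu' hv'
  have hlim0 := tendsto_difference_quotient hs hu hv
  have hexp : HasDerivAt (fun h : ℝ => (Real.exp (-lam * h) : ℂ)) (-lam) 0 := by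
    have h2 : HasDerivAt (fun h : ℝ => Real.exp (-lam * h)) (-lam) 0 := by
      have := ((hasDerivAt_id (0 : ℝ)).const_mul (-lam)).exp
      simpa using this
    simpa using h2.ofReal_comp
  have hexp1 : Tendsto (fun h : ℝ => (Real.exp (-lam * h) : ℂ)) (𝓝[≠] 0) (𝓝 1) := by
    have := hexp.continuousAt.tendsto.mono_left (nhdsWithin_le_nhds (s := {(0 : ℝ)}ᶜ))
    simpa using this
  have hexp2 := hasDerivAt_iff_tendsto_slope.1 hexp
  have hsum := (hexp1.mul hlim0).add (hexp2.mul_const I)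
  have hsum' : Tendsto (fun h : ℝ => (h : ℂ)⁻¹ * (inner ℂ (zeroExtend a b (expMul a b lam v))
      (translate h (zeroExtend a b (expMul a b (-lam) u))) -
      inner ℂ (zeroExtend a b (expMul a b lam v)) (zeroExtend a b (expMul a b (-lam) u))))
      (𝓝[≠] 0) (𝓝 _) := hsum.congr fun h => by
    rw [inner_translate_expMul, h0, slope_def_module, sub_zero, Complex.real_smul,
      Complex.ofReal_inv, mul_zero, Real.exp_zero, Complex.ofReal_one]
    ring
  rw [tendsto_nhds_unique hlim hsum']
  ring

/-! ### The symbol of the companion equation -/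

/-- The Fourier symbol of `-D^α + αλ^{α-1} d/dx + (1-α)λ^α`. -/
def symbol (α lam ξ : ℝ) : ℂ :=
  -(((2 * Real.pi * ξ : ℝ) : ℂ) * Complex.I) ^ (α : ℂ)
    + ((α * lam ^ (α - 1) : ℝ) : ℂ) * (((2 * Real.pi * ξ : ℝ) : ℂ) * Complex.I)
    + (((1 - α) * lam ^ α : ℝ) : ℂ)

theorem measurable_symbol (α lam : ℝ) : Measurable (symbol α lam) := by
  have h := measurable_mul_I_cpow 1 α
  simp only [one_mul] at h
  exact (h.neg.add (by fun_prop)).add measurable_const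

theorem norm_symbol_le {α : ℝ} (hα : 1 < α) (lam ξ : ℝ) :
    ‖symbol α lam ξ‖ ≤ (1 + |α * lam ^ (α - 1)| + |(1 - α) * lam ^ α|) *
      (1 + |2 * Real.pi * ξ| ^ (2 * (α / 2))) := by
  have h1 : ‖(((2 * Real.pi * ξ : ℝ) : ℂ) * Complex.I) ^ (α : ℂ)‖ ≤ _ :=
    norm_mul_I_cpow_le (s := α / 2) (by linarith) (by linarith)
  have h2 : |2 * Real.pi * ξ| ≤ 1 + |2 * Real.pi * ξ| ^ (2 * (α / 2)) := by
    simpa using rpow_le_weight (abs_nonneg (2 * Real.pi * ξ)) zero_le_one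
      (r := 2 * (α / 2)) (by linarith)
  have h3 : 1 ≤ 1 + |2 * Real.pi * ξ| ^ (2 * (α / 2)) :=
    le_add_of_nonneg_right (by positivity)
  rw [add_mul, add_mul]
  refine (norm_add₃_le).trans (add_le_add_three ?_ ?_ ?_)
  · rwa [norm_neg]
  · rw [norm_mul, norm_mul, Complex.norm_real, Complex.norm_real, Complex.norm_I, mul_one,
      Real.norm_eq_abs, Real.norm_eq_abs]
    gcongr
  · rw [Complex.norm_real, Real.norm_eq_abs]
    exact le_mul_of_one_le_right (abs_nonneg _) h3

/-- For t ≠ 0 the argument of it is ±π/2, and the cosine is even. -/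
theorem re_mul_I_cpow {α : ℝ} (hα : α ≠ 0) (t : ℝ) :
    (((t : ℂ) * Complex.I) ^ (α : ℂ)).re = |t| ^ α * Real.cos (Real.pi * α / 2) := by
  rcases eq_or_ne t 0 with rfl | h
  · rw [Complex.ofReal_zero, zero_mul, Complex.zero_cpow (by exact_mod_cast hα), abs_zero,
      Real.zero_rpow hα, zero_mul, Complex.zero_re]
  rw [Complex.cpow_ofReal_re, norm_mul, Complex.norm_real, Complex.norm_I, mul_one,
    Real.norm_eq_abs]
  congr 1
  rcases h.lt_or_gt with h | h
  · have e : (t : ℂ) * Complex.I = ((-t : ℝ) : ℂ) * -Complex.I := by push_cast; ring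
    rw [e, Complex.arg_real_mul _ (neg_pos.2 h), Complex.arg_neg_I, ← Real.cos_neg]
    ring_nf
  · rw [Complex.arg_real_mul _ h, Complex.arg_I]
    ring_nf

theorem symbol_re {α : ℝ} (hα : 1 < α) (lam ξ : ℝ) :
    (symbol α lam ξ).re
      = -Real.cos (Real.pi * α / 2) * |2 * Real.pi * ξ| ^ α + (1 - α) * lam ^ α := by
  simp only [symbol, Complex.add_re, Complex.neg_re, re_mul_I_cpow (by linarith : α ≠ 0),
    Complex.ofReal_re, Complex.I_re, Complex.mul_re, Complex.ofReal_im]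
  ring

/-- The orders add to α/2 + α/2 = α and α/2 + (1 - α/2) = 1. The right order 1 - α/2 stays within
the available regularity α/2 because α > 1. -/
theorem formA2_eq_fourierForm {a b α : ℝ} (hα₁ : 1 < α) (hα₂ : α < 2) (lam : ℝ) {u v : L2 a b}
    (hu : energy a b (α / 2) u < ⊤) (hv : energy a b (α / 2) v < ⊤) :
    (formA2 a b α lam u v : ℂ) = fourierForm (symbol α lam) u v := by
  have e1 := ip_deriv_eq_fourierForm (σ := α / 2) (τ := α / 2) (by linarith) (by linarith)
    (by linarith) le_rfl (by linarith) le_rfl hu hv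
  have e2 := ip_deriv_eq_fourierForm (σ := α / 2) (τ := 1 - α / 2) (by linarith) (by linarith)
    (by linarith) le_rfl (by linarith) (by linarith) hu hv
  rw [add_halves] at e1
  rw [show α / 2 + (1 - α / 2) = 1 by ring] at e2
  have m1 := measurable_mul_I_cpow 1 α
  simp only [one_mul] at m1
  have i1 := integrable_fourierForm m1 (fun ξ => norm_mul_I_cpow_le (s := α / 2) (σ := α)
    (by linarith) (by linarith)) hu hv
  have i2 := integrable_fourierForm (s := α / 2) (C := 1)
    (p := fun ξ => ((2 * Real.pi * ξ : ℝ) : ℂ) * Complex.I) (by fun_prop) (fun ξ => by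
      simpa using norm_mul_I_cpow_le (s := α / 2) (σ := 1) (ξ := ξ) (by linarith) (by linarith))
    hu hv
  have i3 := integrable_fourierForm (s := α / 2) (C := 1) (p := fun _ => 1) measurable_const
    (fun ξ => by
      rw [norm_one, one_mul]
      exact le_add_of_nonneg_right (by positivity)) hu hv
  simp only [Complex.ofReal_one, Complex.cpow_one] at e2
  rw [formA2, Complex.ofReal_add, Complex.ofReal_add, Complex.ofReal_neg, Complex.ofReal_mul,
    Complex.ofReal_mul ((1 - α) * lam ^ α), e1, e2, ip_eq_fourierForm]
  simp only [fourierForm]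
  rw [← integral_neg, ← integral_const_mul, ← integral_const_mul]
  refine (congrArg₂ _ (integral_add i1.neg (i2.const_mul _)).symm rfl).trans
    ((integral_add (i1.neg.add (i2.const_mul _)) (i3.const_mul _)).symm.trans
      (integral_congr_ae (Filter.Eventually.of_forall fun ξ => ?_)))
  simp only [symbol, Pi.neg_apply, Pi.add_apply]
  ring

/-! ### The tempered form -/

theorem leftDeriv_expMul {a b s lam x : ℝ} (u : L2 a b) (hx : x ∈ Ioo a b) :
    leftDeriv a s lam (expMul a b (-lam) u) x = Real.exp (-lam * x) * leftDeriv a s 0 u x := by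
  have h : (fun y => ∫ ξ in a..y, Real.exp (lam * ξ) * expMul a b (-lam) u ξ / (y - ξ) ^ s)
      =ᶠ[nhds x] fun y => ∫ ξ in a..y, Real.exp (0 * ξ) * u ξ / (y - ξ) ^ s := by
    filter_upwards [isOpen_Ioo.mem_nhds hx] with y hy
    have h1 := (ae_restrict_iff' measurableSet_Ioo).1 (coeFn_expMul (-lam) u)
    refine intervalIntegral.integral_congr_ae ?_
    filter_upwards [h1] with ξ h2 h3
    rw [uIoc_of_le hy.1.le] at h3
    rw [h2 ⟨h3.1, h3.2.trans_lt hy.2⟩, ← mul_assoc, ← Real.exp_add]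
    simp
  rw [leftDeriv, leftDeriv, h.deriv_eq]
  simp
  ring

theorem rightDeriv_expMul {a b s lam x : ℝ} (v : L2 a b) (hx : x ∈ Ioo a b) :
    rightDeriv b s lam (expMul a b lam v) x = Real.exp (lam * x) * rightDeriv b s 0 v x := by
  have h : (fun y => ∫ ξ in y..b, Real.exp (-lam * ξ) * expMul a b lam v ξ / (ξ - y) ^ s)
      =ᶠ[nhds x] fun y => ∫ ξ in y..b, Real.exp (-0 * ξ) * v ξ / (ξ - y) ^ s := by
    filter_upwards [isOpen_Ioo.mem_nhds hx] with y hy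
    have h1 := (ae_restrict_iff' measurableSet_Ioo).1 (coeFn_expMul lam v)
    refine intervalIntegral.integral_congr_ae ?_
    filter_upwards [h1, Measure.ae_ne volume b] with ξ h2 hb h3
    rw [uIoc_of_le hy.2.le] at h3
    rw [h2 ⟨hy.1.trans h3.1, lt_of_le_of_ne h3.2 hb⟩, ← mul_assoc, ← Real.exp_add]
    simp
  rw [rightDeriv, rightDeriv, h.deriv_eq]
  simp
  ring

theorem formA1_expMul {a b α : ℝ} (hα₁ : 1 < α) (hα₂ : α < 2) {lam : ℝ} (hlam : 0 ≤ lam)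
    {u v : L2 a b} (hu : u ∈ H0 a b (α / 2)) (hv : v ∈ H0 a b (α / 2)) :
    formA1 a b α lam (expMul a b (-lam) u) (expMul a b lam v) = formA2 a b α lam u v := by
  have hs : 1 / 2 < α / 2 := by linarith
  have hs1 : α / 2 < 1 := by linarith
  have Eu := energy_lt_top_of_mem_H0 hs hs1 hu
  have Ev := energy_lt_top_of_mem_H0 hs hs1 hv
  have Eu' := energy_lt_top_of_mem_H0 hs hs1 (expMul_mem_H0 hs hs1 (-lam) hu)
  have Ev' := energy_lt_top_of_mem_H0 hs hs1 (expMul_mem_H0 hs hs1 lam hv)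
  have hE : ∀ x : ℝ, Real.exp (-lam * x) * Real.exp (lam * x) = 1 := fun x => by
    rw [← Real.exp_add]; simp
  have e1 : ip a b (leftDeriv a (α / 2) lam (expMul a b (-lam) u))
      (rightDeriv b (α / 2) lam (expMul a b lam v))
      = ip a b (leftDeriv a (α / 2) 0 u) (rightDeriv b (α / 2) 0 v) := by
    refine setIntegral_congr_fun measurableSet_Ioo fun x hx => ?_
    rw [leftDeriv_expMul u hx, rightDeriv_expMul v hx, mul_mul_mul_comm, hE, one_mul]
  have e3 : ip a b (expMul a b (-lam) u) (expMul a b lam v) = ip a b u v := by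
    refine integral_congr_ae ?_
    filter_upwards [coeFn_expMul (-lam) u, coeFn_expMul lam v] with x h1 h2
    rw [h1, h2, mul_mul_mul_comm, hE, one_mul]
  have e2 : ip a b (leftDeriv a (α / 2) 0 (expMul a b (-lam) u))
      (rightDeriv b (1 - α / 2) 0 (expMul a b lam v))
      = ip a b (leftDeriv a (α / 2) 0 u) (rightDeriv b (1 - α / 2) 0 v) - lam * ip a b u v := by
    have h1 := ip_deriv_eq_fourierForm (σ := α / 2) (τ := 1 - α / 2) hs hs1
      (by linarith) le_rfl (by linarith) (by linarith) Eu Ev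
    have h2 := ip_deriv_eq_fourierForm (σ := α / 2) (τ := 1 - α / 2) hs hs1
      (by linarith) le_rfl (by linarith) (by linarith) Eu' Ev'
    rw [show α / 2 + (1 - α / 2) = 1 by ring] at h1 h2
    simp only [Complex.ofReal_one, Complex.cpow_one] at h1 h2
    have h3 := fourierForm_deriv_expMul hs lam Eu Ev Eu' Ev'
    rw [← h1, ← h2, ← ip_eq_inner] at h3
    exact_mod_cast h3
  -- The loss -λ(u, v) of the middle term thus becomes -αλ^α(u, v), turning λ^α into (1-α)λ^α.
  have e4 : α * lam ^ (α - 1) * lam = α * lam ^ α := by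
    rcases hlam.eq_or_lt with rfl | h
    · rw [Real.zero_rpow (by linarith : α ≠ 0)]; ring
    · rw [mul_assoc, ← Real.rpow_add_one h.ne', sub_add_cancel]
  rw [formA1, formA2, e1, e2, e3]
  linear_combination -(ip a b u v) * e4

/-! ### Poincaré inequality and coercivity -/

theorem integral_norm_sq_fourier {a b : ℝ} (u : L2 a b) :
    ∫ ξ, ‖(𝓕 (zeroExtend a b u) : CL2) ξ‖ ^ 2 = ‖u‖ ^ 2 := by
  have h : (‖u‖ ^ 2 : ℝ) = ‖(𝓕 (zeroExtend a b u) : CL2)‖ ^ 2 := by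
    rw [Lp.norm_fourier_eq, (zeroExtend a b).norm_map]
  rw [h, ← @inner_self_eq_norm_sq ℂ, L2.inner_def]
  simp only [inner_self_eq_norm_sq_to_K]
  have e : ∀ ξ, ((‖(𝓕 (zeroExtend a b u) : CL2) ξ‖ : ℝ) : ℂ) ^ 2
      = ((‖(𝓕 (zeroExtend a b u) : CL2) ξ‖ ^ 2 : ℝ) : ℂ) := fun ξ => by push_cast; rfl
  simp only [Complex.coe_algebraMap, e]
  rw [integral_complex_ofReal]
  rfl

theorem integral_norm_le {a b : ℝ} (hab : a < b) (u : L2 a b) :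
    (∫ x in Ioo a b, ‖u x‖) ^ 2 ≤ (b - a) * ‖u‖ ^ 2 := by
  have h := eLpNorm_le_eLpNorm_mul_rpow_measure_univ (p := 1) (q := 2) (by norm_num)
    (Lp.aestronglyMeasurable u)
  rw [Measure.restrict_apply_univ, Real.volume_Ioo, ← Lp.enorm_def] at h
  have h1 : ∫ x in Ioo a b, ‖u x‖ = (eLpNorm u 1 (volume.restrict (Ioo a b))).toReal := by
    rw [eLpNorm_one_eq_lintegral_enorm, integral_norm_eq_lintegral_enorm (Lp.aestronglyMeasurable u)]
  have h2 := ENNReal.toReal_mono (by finiteness) h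
  rw [← h1, ENNReal.toReal_mul, toReal_enorm, ← ENNReal.toReal_rpow,
    ENNReal.toReal_ofReal (by linarith)] at h2
  have h3 : ((b - a) ^ (1 / (1 : ℝ≥0∞).toReal - 1 / (2 : ℝ≥0∞).toReal)) ^ 2 = b - a := by
    rw [← Real.rpow_natCast, ← Real.rpow_mul (by linarith)]
    norm_num
  calc _ ≤ (‖u‖ * (b - a) ^ (1 / (1 : ℝ≥0∞).toReal - 1 / (2 : ℝ≥0∞).toReal)) ^ 2 := by
        gcongr
    _ = _ := by rw [mul_pow, h3, mul_comm]

/-- The transform is bounded by the L¹ norm, which Hölder controls on an interval of length b - a.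
-/
theorem norm_fourier_sq_le {a b : ℝ} (hab : a < b) (u : L2 a b) :
    ∀ᵐ ξ, ‖(𝓕 (zeroExtend a b u) : CL2) ξ‖ ^ 2 ≤ (b - a) * ‖u‖ ^ 2 := by
  have hm := memLp_zeroExtend u
  have hi : Integrable ((Ioo a b).indicator fun x => ((u x : ℝ) : ℂ)) := by
    rw [integrable_indicator_iff measurableSet_Ioo]
    exact ((Lp.memLp u).integrable (by norm_num)).ofReal
  filter_upwards [fourier_toLp_ae_eq hi hm] with ξ h
  refine le_trans ?_ (integral_norm_le hab u)
  change ‖(𝓕 (hm.toLp _) : CL2) ξ‖ ^ 2 ≤ _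
  rw [h]
  gcongr
  refine (VectorFourier.norm_fourierIntegral_le_integral_norm _ _ _ _ _).trans_eq ?_
  rw [← integral_indicator measurableSet_Ioo]
  refine integral_congr_ae (Filter.Eventually.of_forall fun x => ?_)
  by_cases hx : x ∈ Ioo a b <;> simp [hx]

theorem integrable_rpow_norm_sq_fourier {a b s : ℝ} {u : L2 a b} (hu : energy a b s u < ⊤) :
    Integrable fun ξ : ℝ => |2 * Real.pi * ξ| ^ (2 * s) *
      ‖(𝓕 (zeroExtend a b u) : CL2) ξ‖ ^ 2 := by
  have hm := measurable_coeFn (𝓕 (zeroExtend a b u) : CL2)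
  refine (norm_sq_integrable_of_energy hu).mono' (by fun_prop : Measurable _).aestronglyMeasurable
    (Filter.Eventually.of_forall fun ξ => ?_)
  rw [Real.norm_of_nonneg (by positivity)]
  gcongr
  linarith

theorem integrable_norm_sq_fourier {a b : ℝ} (u : L2 a b) :
    Integrable fun ξ : ℝ => ‖(𝓕 (zeroExtend a b u) : CL2) ξ‖ ^ 2 :=
  (Lp.memLp _).integrable_norm_pow (by norm_num)

/-- Compact support bounds the transform pointwise, so low frequencies carry at most half of the
mass; at high frequencies the weight ((b-a)|2πξ|)^{2s} is at least 1. -/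
theorem poincare {a b s : ℝ} (hab : a < b) (hs : 0 < s) {u : L2 a b} (hu : energy a b s u < ⊤) :
    ‖u‖ ^ 2 ≤ 2 * (b - a) ^ (2 * s) *
      ∫ ξ, |2 * Real.pi * ξ| ^ (2 * s) * ‖(𝓕 (zeroExtend a b u) : CL2) ξ‖ ^ 2 := by
  have hL : 0 < b - a := sub_pos.2 hab
  -- This R gives 2R(b-a) = 1/2, the half to be absorbed, and (b-a)·2πR = π/2 ≥ 1.
  set R := (4 * (b - a))⁻¹ with hR
  have hR0 : 0 < R := by positivity
  set M := (b - a) * ‖u‖ ^ 2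
  have hi := (integrable_rpow_norm_sq_fourier hu).const_mul ((b - a) ^ (2 * s))
  have hj : Integrable ((Icc (-R) R).indicator fun _ => M) := by
    rw [integrable_indicator_iff measurableSet_Icc]
    exact integrableOn_const (by simp)
  have key : ∫ ξ, ‖(𝓕 (zeroExtend a b u) : CL2) ξ‖ ^ 2 ≤ ∫ ξ, ((Icc (-R) R).indicator (fun _ => M) ξ
      + (b - a) ^ (2 * s) * (|2 * Real.pi * ξ| ^ (2 * s) *
        ‖(𝓕 (zeroExtend a b u) : CL2) ξ‖ ^ 2)) := by
    refine integral_mono_ae (integrable_norm_sq_fourier u) (hj.add hi) ?_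
    filter_upwards [norm_fourier_sq_le hab u] with ξ h
    by_cases hx : ξ ∈ Icc (-R) R
    · rw [indicator_of_mem hx]
      exact h.trans (le_add_of_nonneg_right (by positivity))
    · rw [indicator_of_notMem hx, zero_add, ← mul_assoc]
      refine le_mul_of_one_le_left (by positivity) ?_
      rw [← Real.mul_rpow hL.le (abs_nonneg _)]
      refine Real.one_le_rpow ?_ (by linarith)
      have h1 : R < |ξ| := by
        rw [← not_le, abs_le]
        exact hx
      have h2 : (b - a) * R = 1 / 4 := by rw [hR]; field_simp
      rw [abs_mul, abs_of_pos (by positivity : 0 < 2 * Real.pi)]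
      have h3 := mul_lt_mul_of_pos_left h1 hL
      nlinarith [Real.pi_gt_three]
  rw [integral_norm_sq_fourier, integral_add hj hi, integral_indicator measurableSet_Icc,
    integral_const_mul ((b - a) ^ (2 * s)), setIntegral_const] at key
  have e : volume.real (Icc (-R) R) • M = ‖u‖ ^ 2 / 2 := by
    rw [Real.volume_real_Icc_of_le (by linarith), smul_eq_mul, hR]
    simp only [M]
    field_simp
    ring
  rw [e] at key
  linarith

/-- Convexity of Γ between Γ(1) = Γ(2) = 1. -/
theorem Gamma_half_add_one_sq_le {α : ℝ} (hα₁ : 1 < α) (hα₂ : α < 2) :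
    Real.Gamma (α / 2 + 1) ^ 2 ≤ 1 := by
  have h := Real.convexOn_Gamma.2 (mem_Ioi.2 one_pos) (mem_Ioi.2 two_pos)
    (by linarith : 0 ≤ 1 - α / 2) (by linarith : 0 ≤ α / 2) (by ring)
  simp only [smul_eq_mul, Real.Gamma_one, Real.Gamma_two] at h
  rw [show (1 - α / 2) * 1 + α / 2 * 2 = α / 2 + 1 by ring] at h
  have := Real.Gamma_pos_of_pos (by linarith : 0 < α / 2 + 1)
  exact pow_le_one₀ this.le (by linarith)

theorem energy_toReal {a b s : ℝ} {u : L2 a b} (hu : energy a b s u < ⊤) :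
    (energy a b s u).toReal = ‖u‖ ^ 2 +
      ∫ ξ, |2 * Real.pi * ξ| ^ (2 * s) * ‖(𝓕 (zeroExtend a b u) : CL2) ξ‖ ^ 2 := by
  have hm := measurable_coeFn (𝓕 (zeroExtend a b u) : CL2)
  rw [energy] at hu ⊢
  rw [ENNReal.toReal_add (by finiteness) (ne_top_of_le_ne_top hu.ne le_add_self), ENNReal.toReal_pow,
    toReal_enorm, integral_eq_lintegral_of_nonneg_ae (Filter.Eventually.of_forall fun ξ => by positivity)
      (by fun_prop : Measurable _).aestronglyMeasurable, fourierEnergy]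
  congr 2
  refine lintegral_congr fun ξ => ?_
  rw [ENNReal.ofReal_mul (by positivity), ENNReal.ofReal_pow (norm_nonneg _), ofReal_norm]

theorem formA2_self {a b α : ℝ} (hα₁ : 1 < α) (hα₂ : α < 2) (lam : ℝ) {u : L2 a b}
    (hu : energy a b (α / 2) u < ⊤) :
    formA2 a b α lam u u = -Real.cos (Real.pi * α / 2) *
      (∫ ξ, |2 * Real.pi * ξ| ^ (2 * (α / 2)) * ‖(𝓕 (zeroExtend a b u) : CL2) ξ‖ ^ 2)
        + (1 - α) * lam ^ α * ‖u‖ ^ 2 := by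
  have h := congrArg Complex.re (formA2_eq_fourierForm hα₁ hα₂ lam hu hu)
  have hi := integrable_fourierForm (measurable_symbol α lam) (norm_symbol_le hα₁ lam) hu hu
  rw [Complex.ofReal_re] at h
  rw [h, fourierForm, ← integral_norm_sq_fourier, ← integral_const_mul, ← integral_const_mul,
    ← integral_add ((integrable_rpow_norm_sq_fourier hu).const_mul _)
      ((integrable_norm_sq_fourier u).const_mul _)]
  refine (Complex.reCLM.integral_comp_comm hi).symm.trans
    (integral_congr_ae (Filter.Eventually.of_forall fun ξ => ?_))
  simp only [Complex.reCLM_apply]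
  rw [Complex.mul_conj, Complex.re_mul_ofReal, Complex.normSq_eq_norm_sq, symbol_re hα₁,
    mul_div_cancel₀ α two_ne_zero]
  ring

theorem cos_neg_of_one_lt {α : ℝ} (hα₁ : 1 < α) (hα₂ : α < 2) : Real.cos (Real.pi * α / 2) < 0 := by
  have := Real.pi_pos
  exact Real.cos_neg_of_pi_div_two_lt_of_lt (by nlinarith) (by nlinarith)

/-- Poincaré bounds the negative term by 2(α-1)λ^α(b-a)^α E. As Γ(α/2+1)² ≤ 1 and π > 3, the
smallness condition makes this at most half of |cos(πα/2)|E; Poincaré again bounds the full energy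
by what is left. -/
theorem coercive_formA2 {α a b : ℝ} (hα₁ : 1 < α) (hα₂ : α < 2) (hab : a < b) {lam : ℝ}
    (hlt : lam ^ α < |Real.cos (Real.pi * α / 2)| * Real.Gamma (α / 2 + 1) ^ 2 /
        (2 * Real.pi * (α - 1) * (b - a) ^ α)) {u : L2 a b} (hu : energy a b (α / 2) u < ⊤) :
    |Real.cos (Real.pi * α / 2)| / 2 / (1 + 2 * (b - a) ^ α) * (energy a b (α / 2) u).toReal
      ≤ formA2 a b α lam u u := by
  have hL : 0 < (b - a) ^ α := Real.rpow_pos_of_pos (sub_pos.2 hab) α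
  have hP := poincare hab (by linarith) hu
  rw [formA2_self hα₁ hα₂ lam hu, energy_toReal hu, ← abs_of_neg (cos_neg_of_one_lt hα₁ hα₂)]
  rw [mul_div_cancel₀ α two_ne_zero] at hP ⊢
  set E := ∫ ξ, |2 * Real.pi * ξ| ^ α * ‖(𝓕 (zeroExtend a b u) : CL2) ξ‖ ^ 2
  set c := |Real.cos (Real.pi * α / 2)|
  have hE : 0 ≤ E := integral_nonneg fun ξ => by positivity
  have hc : 0 ≤ c := abs_nonneg _
  have hpi := Real.pi_gt_three
  have hα : 0 < α - 1 := by linarith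
  rw [lt_div_iff₀ (by positivity)] at hlt
  have hG := mul_le_mul_of_nonneg_left (Gamma_half_add_one_sq_le hα₁ hα₂) hc
  have hN : (α - 1) * lam ^ α * ‖u‖ ^ 2 ≤ c / 2 * E := by
    -- No sign of `lam` is assumed here, and a real power of a negative base may be negative.
    rcases le_total (lam ^ α) 0 with h0 | h0
    · exact (mul_nonpos_of_nonpos_of_nonneg (mul_nonpos_of_nonneg_of_nonpos hα.le h0)
        (by positivity)).trans (by positivity)
    calc (α - 1) * lam ^ α * ‖u‖ ^ 2 ≤ (α - 1) * lam ^ α * (2 * (b - a) ^ α * E) := by gcongr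
      _ = lam ^ α * (2 * 1 * (α - 1) * (b - a) ^ α) * E := by ring
      _ ≤ c / 2 * E := by
        gcongr
        have h1 : lam ^ α * (2 * 3 * (α - 1) * (b - a) ^ α)
            ≤ lam ^ α * (2 * Real.pi * (α - 1) * (b - a) ^ α) := by gcongr
        nlinarith
  have hb : c / 2 / (1 + 2 * (b - a) ^ α) * (‖u‖ ^ 2 + E) ≤ c / 2 * E := by
    rw [div_mul_eq_mul_div, div_le_iff₀ (by positivity)]
    nlinarith [mul_le_mul_of_nonneg_left hP hc]
  linarith

/-! ### A Hilbert space isometric to `H₀` -/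

/-- The weight `(1 + |2πξ|^{2s})^{-1/2}`. -/
def weightInv (s ξ : ℝ) : ℝ := (√(1 + |2 * Real.pi * ξ| ^ (2 * s)))⁻¹

theorem weightInv_pos (s ξ : ℝ) : 0 < weightInv s ξ := by
  rw [weightInv]; positivity

theorem weight_mul_weightInv_sq (s ξ : ℝ) :
    (1 + |2 * Real.pi * ξ| ^ (2 * s)) * weightInv s ξ ^ 2 = 1 := by
  rw [weightInv, inv_pow, Real.sq_sqrt (by positivity)]
  exact mul_inv_cancel₀ (by positivity)

theorem measurable_weightInv (s : ℝ) : Measurable (weightInv s) := by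
  unfold weightInv
  fun_prop

theorem memLp_weightInv (s : ℝ) : MemLp (fun ξ => (weightInv s ξ : ℂ)) ∞ (volume : Measure ℝ) := by
  have hm := measurable_weightInv s
  refine memLp_top_of_bound (by fun_prop : Measurable _).aestronglyMeasurable 1
    (Filter.Eventually.of_forall fun ξ => ?_)
  rw [Complex.norm_real, Real.norm_of_nonneg (weightInv_pos s ξ).le]
  refine inv_le_one_of_one_le₀ (Real.one_le_sqrt.2 ?_)
  exact le_add_of_nonneg_right (by positivity)

/-- Multiplication by the inverse weight. -/
abbrev weightInvL (s : ℝ) : CL2 →L[ℂ] CL2 := mulL _ (memLp_weightInv s)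

theorem enorm_sq_eq_energy {a b s : ℝ} {u : L2 a b} {g : CL2}
    (h : 𝓕 (zeroExtend a b u) = weightInvL s g) : ‖g‖ₑ ^ 2 = energy a b s u := by
  rw [energy_eq_lintegral, h, enorm_sq_eq_lintegral]
  refine lintegral_congr_ae ?_
  filter_upwards [coeFn_mulL (memLp_weightInv s) g] with ξ hξ
  rw [hξ, enorm_mul, mul_pow, ← mul_assoc]
  have e : ‖(weightInv s ξ : ℂ)‖ₑ ^ 2 = ENNReal.ofReal (weightInv s ξ ^ 2) := by
    rw [← ofReal_norm, ← ENNReal.ofReal_pow (norm_nonneg _), Complex.norm_real, Real.norm_eq_abs,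
      sq_abs]
  rw [e, ← ENNReal.ofReal_mul (by positivity), weight_mul_weightInv_sq, ENNReal.ofReal_one, one_mul]

theorem exists_fourier_eq_weightInvL {a b s : ℝ} {u : L2 a b} (hu : energy a b s u < ⊤) :
    ∃ g : CL2, 𝓕 (zeroExtend a b u) = weightInvL s g := by
  have hm := measurable_coeFn (𝓕 (zeroExtend a b u) : CL2)
  have hw := measurable_weightInv s
  have hg : MemLp (fun ξ => ((weightInv s ξ)⁻¹ : ℂ) * (𝓕 (zeroExtend a b u) : CL2) ξ) 2 := by
    refine ⟨(by fun_prop : Measurable _).aestronglyMeasurable, ?_⟩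
    have h2 := eLpNorm_two_sq (ν := (volume : Measure ℝ))
      (fun ξ => ((weightInv s ξ)⁻¹ : ℂ) * (𝓕 (zeroExtend a b u) : CL2) ξ)
    have h3 : ∫⁻ ξ, ‖((weightInv s ξ)⁻¹ : ℂ) * (𝓕 (zeroExtend a b u) : CL2) ξ‖ₑ ^ 2
        = energy a b s u := by
      rw [energy_eq_lintegral]
      refine lintegral_congr fun ξ => ?_
      rw [enorm_mul, mul_pow]
      congr 1
      rw [← ofReal_norm, ← ENNReal.ofReal_pow (norm_nonneg _), norm_inv, Complex.norm_real,
        Real.norm_eq_abs, inv_pow, sq_abs]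
      congr 1
      exact (eq_inv_of_mul_eq_one_left (weight_mul_weightInv_sq s ξ)).symm
    rw [h3] at h2
    by_contra h4
    rw [not_lt, top_le_iff] at h4
    rw [h4] at h2
    simp [← h2] at hu
  refine ⟨hg.toLp _, Lp.ext ?_⟩
  filter_upwards [coeFn_mulL (memLp_weightInv s) (hg.toLp _), hg.coeFn_toLp] with ξ h1 h2
  rw [h1, h2, mul_inv_cancel_left₀ (by exact_mod_cast (weightInv_pos s ξ).ne')]

/-- The Fourier transform of the extension by zero. -/
def fourierExtend (a b : ℝ) : L2 a b →ₗᵢ[ℝ] CL2 where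
  toFun u := 𝓕 (zeroExtend a b u)
  map_add' u v := by rw [map_add, FourierTransform.fourier_add]
  map_smul' c u := by
    rw [map_smul, RingHom.id_apply]
    exact (((Lp.fourierTransformₗᵢ ℝ ℂ).toLinearEquiv : CL2 →ₗ[ℂ] CL2).restrictScalars ℝ).map_smul c _
  norm_map' u := by
    change ‖(𝓕 (zeroExtend a b u) : CL2)‖ = _
    rw [Lp.norm_fourier_eq, (zeroExtend a b).norm_map]

theorem fourierExtend_apply {a b : ℝ} (u : L2 a b) :
    fourierExtend a b u = 𝓕 (zeroExtend a b u) := rfl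

/-- The weighted Fourier transforms of the elements of `H₀`. -/
def weightedRange (a b s : ℝ) : Submodule ℝ CL2 :=
  ((H0 a b s).map (fourierExtend a b).toLinearMap).comap
    ((weightInvL s).restrictScalars ℝ).toLinearMap

theorem mem_weightedRange {a b s : ℝ} {g : CL2} : g ∈ weightedRange a b s ↔
    ∃ u ∈ H0 a b s, 𝓕 (zeroExtend a b u) = weightInvL s g := Iff.rfl

/-- The energy dominates the Sobolev norm, so the closure is also closed in the energy norm. -/
theorem mem_H0_of_forall_energy {a b s : ℝ} {u : L2 a b}
    (h : ∀ ε : ℝ≥0∞, 0 < ε → ∃ v ∈ H0 a b s, energy a b s (u - v) < ε) : u ∈ H0 a b s := by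
  intro ε hε
  have hε2 : 0 < ε / 2 := ENNReal.half_pos hε.ne'
  obtain ⟨v, hv, h1⟩ := h ((ε / 2) ^ 2 / ENNReal.ofReal (2 * Real.pi))
    (ENNReal.div_pos (pow_ne_zero 2 hε2.ne') ENNReal.ofReal_ne_top)
  obtain ⟨φ, hφ, h2⟩ := hv (ε / 2) hε2
  refine ⟨φ, hφ, ?_⟩
  have h3 : sobolevNorm a b s (u - v) < ε / 2 := by
    refine (ENNReal.pow_right_strictMono two_ne_zero).lt_iff_lt.1
      ((sobolevNorm_sq_le_energy a b s _).trans_lt ?_)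
    have hpi : ENNReal.ofReal (2 * Real.pi) ≠ 0 := by
      rw [Ne, ENNReal.ofReal_eq_zero, not_le]; positivity
    rw [mul_comm]
    exact (ENNReal.lt_div_iff_mul_lt (Or.inl hpi) (Or.inl ENNReal.ofReal_ne_top)).1 h1
  rw [← sub_add_sub_cancel u v φ]
  exact (sobolevNorm_add a b s _ _).trans_lt
    ((ENNReal.add_lt_add h3 h2).trans_eq (ENNReal.add_halves ε))

-- If gₙ → g, the transforms of the uₙ converge in the closed range of an isometry, which yields a
-- limit v. The energy of v - uₙ equals ‖g - gₙ‖² and tends to 0, so v stays in H₀.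
open Filter Topology in
theorem isClosed_weightedRange (a b s : ℝ) : IsClosed (weightedRange a b s : Set CL2) := by
  refine IsSeqClosed.isClosed fun g g₀ hg hlim => ?_
  choose u hu hug using fun n => mem_weightedRange.1 (hg n)
  have h1 : Tendsto (fun n => fourierExtend a b (u n)) atTop (𝓝 (weightInvL s g₀)) := by
    simp only [fourierExtend_apply, hug]
    exact ((weightInvL s).continuous.tendsto g₀).comp hlim
  obtain ⟨v, hv⟩ := ((fourierExtend a b).isometry.isClosedEmbedding.isClosed_range).mem_of_tendsto
    h1 (Eventually.of_forall fun n => mem_range_self _)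
  refine mem_weightedRange.2 ⟨v, mem_H0_of_forall_energy fun ε hε => ?_, hv⟩
  have h2 : ∀ n, energy a b s (v - u n) = ‖g₀ - g n‖ₑ ^ 2 := fun n => by
    refine (enorm_sq_eq_energy ?_).symm
    rw [map_sub (weightInvL s), ← hug n, ← hv, ← fourierExtend_apply, map_sub]
    rfl
  have h3 : Tendsto (fun n => ‖g₀ - g n‖ₑ ^ 2) atTop (𝓝 0) := by
    have h4 : Tendsto (fun n => g₀ - g n) atTop (𝓝 0) := by
      simpa using (tendsto_const_nhds (x := g₀)).sub hlim
    have h5 := (ENNReal.continuous_pow 2).tendsto _ |>.comp (h4.enorm)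
    simpa [Function.comp_def] using h5
  obtain ⟨n, hn⟩ := (h3.eventually_lt_const hε).exists
  exact ⟨u n, hu n, (h2 n).trans_lt hn⟩

/-- The element of `H₀` with a given weighted Fourier transform. -/
def ofWeighted (a b s : ℝ) : weightedRange a b s →ₗ[ℝ] H0 a b s :=
  ((H0 a b s).equivMapOfInjective (fourierExtend a b).toLinearMap
      (fourierExtend a b).injective).symm.toLinearMap ∘ₗ
    ((weightInvL s).restrictScalars ℝ).toLinearMap.restrict fun _ h => h

theorem fourier_ofWeighted {a b s : ℝ} (g : weightedRange a b s) :
    𝓕 (zeroExtend a b (ofWeighted a b s g : L2 a b)) = weightInvL s g := by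
  have h := ((H0 a b s).equivMapOfInjective (fourierExtend a b).toLinearMap
      (fourierExtend a b).injective).apply_symm_apply
    (((weightInvL s).restrictScalars ℝ).toLinearMap.restrict (fun _ h => h) g)
  exact congrArg Subtype.val h

theorem enorm_sq_eq_energy_ofWeighted {a b s : ℝ} (g : weightedRange a b s) :
    ‖g‖ₑ ^ 2 = energy a b s (ofWeighted a b s g) :=
  enorm_sq_eq_energy (fourier_ofWeighted g)

/-- Every element of H₀ has finite energy, which rests on the Hardy inequality. -/
theorem ofWeighted_surjective {a b s : ℝ} (hs : 1 / 2 < s) (hs1 : s < 1) :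
    Function.Surjective (ofWeighted a b s) := by
  rintro ⟨u, hu⟩
  obtain ⟨g, hg⟩ := exists_fourier_eq_weightInvL (energy_lt_top_of_mem_H0 hs hs1 hu)
  refine ⟨⟨g, mem_weightedRange.2 ⟨u, hu, hg⟩⟩, Subtype.ext ((fourierExtend a b).injective ?_)⟩
  exact (fourier_ofWeighted _).trans hg.symm

/-! ### The bilinear form on the Hilbert space -/

/-- The normalized symbol. -/
def normalizedSymbol (α lam ξ : ℝ) : ℂ := symbol α lam ξ * (weightInv (α / 2) ξ : ℂ) ^ 2

theorem memLp_normalizedSymbol {α : ℝ} (hα : 1 < α) (lam : ℝ) :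
    MemLp (normalizedSymbol α lam) ∞ (volume : Measure ℝ) := by
  have h1 := measurable_symbol α lam
  have h2 := measurable_weightInv (α / 2)
  have h3 : Measurable (normalizedSymbol α lam) := by unfold normalizedSymbol; fun_prop
  refine memLp_top_of_bound h3.aestronglyMeasurable
    (1 + |α * lam ^ (α - 1)| + |(1 - α) * lam ^ α|) (Filter.Eventually.of_forall fun ξ => ?_)
  rw [normalizedSymbol, norm_mul, norm_pow, Complex.norm_real, Real.norm_eq_abs, sq_abs]
  refine (mul_le_mul_of_nonneg_right (norm_symbol_le hα lam ξ) (by positivity)).trans_eq ?_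
  rw [mul_assoc, weight_mul_weightInv_sq, mul_one]

theorem real_inner_eq_re (f g : CL2) : inner ℝ f g = (inner ℂ f g).re := by
  rw [L2.inner_def, L2.inner_def]
  exact (Complex.reCLM.integral_comp_comm (L2.integrable_inner f g))

/-- The two inverse weights combine with the symbol into a bounded multiplier, so the transported
form is continuous. -/
theorem formA2_ofWeighted {a b α : ℝ} (hα₁ : 1 < α) (hα₂ : α < 2) (lam : ℝ)
    (g h : weightedRange a b (α / 2)) :
    formA2 a b α lam (ofWeighted a b (α / 2) g : L2 a b) (ofWeighted a b (α / 2) h : L2 a b)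
      = inner ℝ (mulL _ (memLp_normalizedSymbol hα₁ lam) (g : CL2)) (h : CL2) := by
  have hE : ∀ k : weightedRange a b (α / 2),
      energy a b (α / 2) (ofWeighted a b (α / 2) k : L2 a b) < ⊤ := fun k =>
    energy_lt_top_of_mem_H0 (by linarith) (by linarith) (ofWeighted a b (α / 2) k).2
  have e := congrArg Complex.re (formA2_eq_fourierForm hα₁ hα₂ lam (hE g) (hE h))
  rw [Complex.ofReal_re] at e
  rw [e, real_inner_comm, real_inner_eq_re, L2.inner_def, fourierForm, fourier_ofWeighted,
    fourier_ofWeighted]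
  congr 1
  refine integral_congr_ae ?_
  filter_upwards [coeFn_mulL (memLp_weightInv (α / 2)) (g : CL2),
    coeFn_mulL (memLp_weightInv (α / 2)) (h : CL2),
    coeFn_mulL (memLp_normalizedSymbol hα₁ lam) (g : CL2)] with ξ h1 h2 h3
  rw [h1, h2, RCLike.inner_apply, h3, map_mul, Complex.conj_ofReal, normalizedSymbol]
  ring

/-- `formA2` transported to the weighted range. -/
def weightedForm {α : ℝ} (a b : ℝ) (hα : 1 < α) (lam : ℝ) :
    weightedRange a b (α / 2) →L[ℝ] weightedRange a b (α / 2) →L[ℝ] ℝ :=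
  (isBoundedBilinearMap_inner (𝕜 := ℝ) (E := CL2)).toContinuousLinearMap.bilinearComp
    (((mulL _ (memLp_normalizedSymbol hα lam)).restrictScalars ℝ).comp
      (weightedRange a b (α / 2)).subtypeL) (weightedRange a b (α / 2)).subtypeL

/-! ### The Lax-Milgram argument -/

instance instCompleteSpaceWeightedRange (a b s : ℝ) : CompleteSpace (weightedRange a b s) :=
  (isClosed_weightedRange a b s).completeSpace_coe

theorem weightedForm_apply {a b α : ℝ} (hα₁ : 1 < α) (hα₂ : α < 2) (lam : ℝ)
    (g h : weightedRange a b (α / 2)) :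
    weightedForm a b hα₁ lam g h
      = formA2 a b α lam (ofWeighted a b (α / 2) g : L2 a b) (ofWeighted a b (α / 2) h : L2 a b) :=
  (formA2_ofWeighted hα₁ hα₂ lam g h).symm

theorem norm_sq_eq_energy_toReal {a b s : ℝ} (g : weightedRange a b s) :
    ‖g‖ ^ 2 = (energy a b s (ofWeighted a b s g)).toReal := by
  rw [← enorm_sq_eq_energy_ofWeighted, ENNReal.toReal_pow, toReal_enorm]

/-- The coercivity constant of `formA2`. -/
def coercivityConst (a b α : ℝ) : ℝ :=
  |Real.cos (Real.pi * α / 2)| / 2 / (1 + 2 * (b - a) ^ α)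

theorem coercivityConst_pos {a b α : ℝ} (hα₁ : 1 < α) (hα₂ : α < 2) (hab : a < b) :
    0 < coercivityConst a b α := by
  have h1 := abs_pos.2 (cos_neg_of_one_lt hα₁ hα₂).ne
  have h2 := Real.rpow_pos_of_pos (sub_pos.2 hab) α
  rw [coercivityConst]
  positivity

theorem isCoercive_weightedForm {α a b : ℝ} (hα₁ : 1 < α) (hα₂ : α < 2) (hab : a < b) {lam : ℝ}
    (hlt : lam ^ α < |Real.cos (Real.pi * α / 2)| * Real.Gamma (α / 2 + 1) ^ 2 /
        (2 * Real.pi * (α - 1) * (b - a) ^ α)) : IsCoercive (weightedForm a b hα₁ lam) := by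
  refine ⟨_, coercivityConst_pos hα₁ hα₂ hab, fun g => ?_⟩
  rw [weightedForm_apply hα₁ hα₂, mul_assoc, ← sq, norm_sq_eq_energy_toReal]
  exact coercive_formA2 hα₁ hα₂ hab hlt
    (energy_lt_top_of_mem_H0 (by linarith) (by linarith) (ofWeighted a b (α / 2) g).2)

/-- Lax-Milgram after representing the functional by Riesz. -/
theorem _root_.IsCoercive.existsUnique {V : Type*} [NormedAddCommGroup V] [InnerProductSpace ℝ V]
    [CompleteSpace V] {B : V →L[ℝ] V →L[ℝ] ℝ} (hB : IsCoercive B) (l : StrongDual ℝ V) :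
    ∃! v, ∀ w, B v w = l w := by
  set f := (InnerProductSpace.toDual ℝ V).symm l with hf
  have h : ∀ w, inner ℝ f w = l w := fun w => InnerProductSpace.toDual_symm_apply
  refine ⟨hB.continuousLinearEquivOfBilin.symm f, fun w => ?_, fun v hv => ?_⟩
  · rw [← hB.continuousLinearEquivOfBilin_apply, ContinuousLinearEquiv.apply_symm_apply, h]
  · rw [ContinuousLinearEquiv.eq_symm_apply]
    exact (hB.unique_continuousLinearEquivOfBilin fun w => (h w).trans (hv w).symm).symm

theorem enorm_le_dualNorm_mul {a b s : ℝ} (hs : 0 < s) (hs1 : s < 1) (F : H0 a b s →ₗ[ℝ] ℝ)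
    (v : H0 a b s) : ‖F v‖ₑ ≤ dualNorm F * sobolevNorm a b s v := by
  rcases eq_or_ne (sobolevNorm a b s v) 0 with h0 | h0
  · have h1 := enorm_le_sobolevNorm a b s v
    rw [h0, nonpos_iff_eq_zero, enorm_eq_zero] at h1
    have h2 : v = 0 := Subtype.ext h1
    rw [h2]
    simp
  have ht := (sobolevNorm_lt_top_of_mem_H0 hs hs1 v.2).ne
  set N := sobolevNorm a b s v with hN
  have hr : N.toReal ≠ 0 := ENNReal.toReal_ne_zero.2 ⟨h0, ht⟩
  have hce : ‖N.toReal⁻¹‖ₑ = N⁻¹ := by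
    rw [enorm_inv hr, Real.enorm_of_nonneg ENNReal.toReal_nonneg, ENNReal.ofReal_toReal ht]
  have h1 : sobolevNorm a b s (N.toReal⁻¹ • v : H0 a b s) ≤ 1 := by
    refine (sobolevNorm_smul a b s _ (inv_ne_zero hr) v).trans_eq ?_
    rw [hce, ENNReal.inv_mul_cancel h0 ht]
  have h2 : ‖F (N.toReal⁻¹ • v)‖ₑ ≤ dualNorm F :=
    le_iSup₂ (f := fun (w : H0 a b s) (_ : sobolevNorm a b s w ≤ 1) => ‖F w‖ₑ) _ h1
  rw [map_smul, smul_eq_mul, enorm_mul, hce] at h2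
  calc ‖F v‖ₑ = N⁻¹ * ‖F v‖ₑ * N := by
        rw [mul_right_comm, ENNReal.inv_mul_cancel h0 ht, one_mul]
    _ ≤ dualNorm F * N := by gcongr

theorem sobolevNorm_le_enorm {a b s : ℝ} (g : weightedRange a b s) :
    sobolevNorm a b s (ofWeighted a b s g) ≤ (1 + ENNReal.ofReal (2 * Real.pi)) * ‖g‖ₑ := by
  refine le_mul_of_sq_le ?_
  rw [enorm_sq_eq_energy_ofWeighted]
  exact sobolevNorm_sq_le_energy a b s _

theorem norm_apply_ofWeighted_le {a b s : ℝ} (hs : 0 < s) (hs1 : s < 1) {F : H0 a b s →ₗ[ℝ] ℝ}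
    (hF : dualNorm F < ⊤) (g : weightedRange a b s) :
    ‖F (ofWeighted a b s g)‖ ≤ (dualNorm F).toReal * (1 + 2 * Real.pi) * ‖g‖ := by
  have h := (enorm_le_dualNorm_mul hs hs1 F (ofWeighted a b s g)).trans
    (mul_le_mul_right (sobolevNorm_le_enorm g) _)
  have h2 := ENNReal.toReal_mono (by finiteness) h
  rw [toReal_enorm, ENNReal.toReal_mul, ENNReal.toReal_mul, toReal_enorm,
    ENNReal.toReal_add (by simp) ENNReal.ofReal_ne_top, ENNReal.toReal_one,
    ENNReal.toReal_ofReal (by positivity), ← mul_assoc] at h2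
  exact h2

theorem existsUnique_formA2 {α a b : ℝ} (hα₁ : 1 < α) (hα₂ : α < 2) (hab : a < b) {lam : ℝ}
    (hlt : lam ^ α < |Real.cos (Real.pi * α / 2)| * Real.Gamma (α / 2 + 1) ^ 2 /
        (2 * Real.pi * (α - 1) * (b - a) ^ α)) {F : H0 a b (α / 2) →ₗ[ℝ] ℝ}
    (hF : dualNorm F < ⊤) :
    ∃! u : L2 a b, u ∈ H0 a b (α / 2) ∧ ∀ v : H0 a b (α / 2), formA2 a b α lam u v = F v := by
  have hs : 1 / 2 < α / 2 := by linarith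
  have hs1 : α / 2 < 1 := by linarith
  have hsurj := ofWeighted_surjective (a := a) (b := b) hs hs1
  obtain ⟨g, hg, huniq⟩ := (isCoercive_weightedForm hα₁ hα₂ hab hlt).existsUnique
    ((F ∘ₗ ofWeighted a b (α / 2)).mkContinuous _
      (norm_apply_ofWeighted_le (by linarith) hs1 hF))
  simp only [weightedForm_apply hα₁ hα₂, LinearMap.mkContinuous_apply, LinearMap.comp_apply]
    at hg huniq
  refine ⟨ofWeighted a b (α / 2) g, ⟨(ofWeighted a b (α / 2) g).2, fun v => ?_⟩, ?_⟩
  · obtain ⟨h, rfl⟩ := hsurj v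
    exact hg h
  · rintro u ⟨hu, hv⟩
    obtain ⟨k, hk⟩ := hsurj ⟨u, hu⟩
    have hk' : (ofWeighted a b (α / 2) k : L2 a b) = u := congrArg Subtype.val hk
    rw [← huniq k fun w => by rw [hk']; exact hv _, hk']

/-- Test with v = u: coercivity gives c‖g‖² ≤ F(u) ≤ ‖F‖(1 + 2π)‖g‖. A second factor 1 + 2π comes
from returning from ‖g‖ to the Sobolev norm. -/
theorem sobolevNorm_le_of_formA2 {α a b : ℝ} (hα₁ : 1 < α) (hα₂ : α < 2) (hab : a < b) {lam : ℝ}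
    (hlt : lam ^ α < |Real.cos (Real.pi * α / 2)| * Real.Gamma (α / 2 + 1) ^ 2 /
        (2 * Real.pi * (α - 1) * (b - a) ^ α)) {F : H0 a b (α / 2) →ₗ[ℝ] ℝ}
    (hF : dualNorm F < ⊤) {u : L2 a b} (hu : u ∈ H0 a b (α / 2))
    (h : ∀ v : H0 a b (α / 2), formA2 a b α lam u v = F v) :
    sobolevNorm a b (α / 2) u ≤
      ENNReal.ofReal ((1 + 2 * Real.pi) ^ 2 / coercivityConst a b α) * dualNorm F := by
  have hs : 1 / 2 < α / 2 := by linarith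
  have hs1 : α / 2 < 1 := by linarith
  obtain ⟨g, hg⟩ := ofWeighted_surjective hs hs1 ⟨u, hu⟩
  have hg' : (ofWeighted a b (α / 2) g : L2 a b) = u := congrArg Subtype.val hg
  have hc := coercivityConst_pos hα₁ hα₂ hab
  have h1 : coercivityConst a b α * ‖g‖ ^ 2 ≤ formA2 a b α lam u u := by
    rw [norm_sq_eq_energy_toReal, hg']
    exact coercive_formA2 hα₁ hα₂ hab hlt (energy_lt_top_of_mem_H0 hs hs1 hu)
  have h2 : formA2 a b α lam u u ≤ (dualNorm F).toReal * (1 + 2 * Real.pi) * ‖g‖ := by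
    have h3 := norm_apply_ofWeighted_le (by linarith) hs1 hF g
    rw [hg] at h3
    exact (h ⟨u, hu⟩).le.trans ((le_abs_self _).trans h3)
  have h4 : ‖g‖ ≤ (dualNorm F).toReal * (1 + 2 * Real.pi) / coercivityConst a b α := by
    rw [le_div_iff₀ hc]
    rcases (norm_nonneg g).eq_or_lt with h0 | h0
    · rw [← h0, zero_mul]
      positivity
    · refine le_of_mul_le_mul_right ?_ h0
      linarith
  rw [← hg']
  have h5 : ‖g‖ₑ ≤ ENNReal.ofReal ((1 + 2 * Real.pi) / coercivityConst a b α) * dualNorm F := by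
    rw [← ofReal_norm, ← ENNReal.ofReal_toReal hF.ne, ← ENNReal.ofReal_mul (by positivity)]
    exact ENNReal.ofReal_le_ofReal (h4.trans_eq (by ring))
  refine (sobolevNorm_le_enorm g).trans ((mul_le_mul_right h5 _).trans_eq ?_)
  rw [← mul_assoc, ← ENNReal.ofReal_one, ← ENNReal.ofReal_add zero_le_one (by positivity),
    ← ENNReal.ofReal_mul (by positivity)]
  congr 2
  ring

/-! ### The functional `e^{λx} f` and the Petrov-Galerkin formulation -/

/-- The functional `e^{ρx} f` as a linear map. -/
def expMulDualLin {a b s : ℝ} (hs : 1 / 2 < s) (hs1 : s < 1) (rho : ℝ) (f : HNeg a b s) :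
    H0 a b s →ₗ[ℝ] ℝ :=
  f.toLin ∘ₗ (expMul a b rho).restrict fun _ hu => expMul_mem_H0 hs hs1 rho hu

theorem coe_expMulDualLin {a b s : ℝ} (hs : 1 / 2 < s) (hs1 : s < 1) (rho : ℝ) (f : HNeg a b s) :
    (expMulDualLin hs hs1 rho f : H0 a b s → ℝ) = expMulDual rho f := by
  funext v
  rw [expMulDual, HNeg.pair, dif_pos (expMul_mem_H0 hs hs1 rho v.2)]
  rfl

theorem dualNorm_expMulDual_lt_top {a b s : ℝ} (hs : 1 / 2 < s) (hs1 : s < 1) (rho : ℝ)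
    (f : HNeg a b s) : dualNorm (expMulDual rho f) < ⊤ := by
  obtain ⟨C, hC, h⟩ := exists_sobolevNorm_expMul_le hs hs1 a b |rho| (abs_nonneg _)
  have hf := f.bounded
  refine lt_of_le_of_lt (iSup₂_le fun v hv => ?_) (by finiteness : dualNorm f.toLin * C < ⊤)
  rw [← coe_expMulDualLin hs hs1]
  refine (enorm_le_dualNorm_mul (by linarith) hs1 f.toLin _).trans ?_
  gcongr
  exact (h rho le_rfl v v.2).trans (mul_le_of_le_one_right' hv)

theorem isPetrovGalerkinSolution_iff {a b α : ℝ} (hα₁ : 1 < α) (hα₂ : α < 2) {lam : ℝ}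
    (hlam : 0 ≤ lam) (f : HNeg a b (α / 2)) (u : L2 a b) :
    IsPetrovGalerkinSolution lam f u ↔ IsGalerkinSolution lam f (expMul a b lam u) := by
  have hneg : ∀ w : L2 a b, expMul a b lam (expMul a b (-lam) w) = w := fun w => by
    rw [expMul_expMul, add_neg_cancel, expMul_zero]
  constructor
  · rintro ⟨⟨u₁, hu₁, rfl⟩, h⟩
    rw [hneg]
    refine ⟨hu₁, fun v => ?_⟩
    rw [← formA1_expMul hα₁ hα₂ hlam hu₁ v.2]
    exact h _ (Submodule.mem_map_of_mem v.2)
  · rintro ⟨hu₁, h⟩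
    have e : expMul a b (-lam) (expMul a b lam u) = u := by
      rw [expMul_expMul, neg_add_cancel, expMul_zero]
    refine ⟨⟨_, hu₁, e⟩, ?_⟩
    rintro _ ⟨v, hv, rfl⟩
    have h1 := h ⟨v, hv⟩
    rw [← formA1_expMul hα₁ hα₂ hlam hu₁ hv, e] at h1
    exact h1

end

end TemperedFrac

/-! ### The main theorem -/

theorem mainTheorem8 (α a b : ℝ) (hα₁ : 1 < α) (hα₂ : α < 2) (hab : a < b) :
    ∃ C : NNReal, ∀ lam : ℝ, 0 ≤ lam →
      lam ^ α < |Real.cos (Real.pi * α / 2)| * Real.Gamma (α / 2 + 1) ^ 2 /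
        (2 * Real.pi * (α - 1) * (b - a) ^ α) →
      ∀ f : TemperedFrac.HNeg a b (α / 2),
        TemperedFrac.dualNorm (TemperedFrac.expMulDual lam f) < ⊤ ∧
        (∃! u : TemperedFrac.L2 a b, TemperedFrac.IsPetrovGalerkinSolution lam f u) ∧
        (∃! u₁ : TemperedFrac.L2 a b, TemperedFrac.IsGalerkinSolution lam f u₁) ∧
        (∀ u : TemperedFrac.L2 a b, TemperedFrac.IsPetrovGalerkinSolution lam f u →
          TemperedFrac.sobolevNorm a b (α / 2) u ≤
            C * TemperedFrac.dualNorm (TemperedFrac.expMulDual lam f)) ∧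
        (∀ u₁ : TemperedFrac.L2 a b, TemperedFrac.IsGalerkinSolution lam f u₁ →
          TemperedFrac.sobolevNorm a b (α / 2) u₁ ≤
            C * TemperedFrac.dualNorm (TemperedFrac.expMulDual lam f)) := by
  have hs : 1 / 2 < α / 2 := by linarith
  have hs1 : α / 2 < 1 := by linarith
  set T := |Real.cos (Real.pi * α / 2)| * Real.Gamma (α / 2 + 1) ^ 2 /
        (2 * Real.pi * (α - 1) * (b - a) ^ α)
  -- Since λ^α < T, every admissible λ is at most |T|^{1/α}; one constant D therefore bounds
  -- multiplication by e^{-λx} for all of them.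
  have hR : 0 ≤ |T| ^ α⁻¹ := by positivity
  obtain ⟨D, hD, hexp⟩ := TemperedFrac.exists_sobolevNorm_expMul_le hs hs1 a b _ hR
  set E := ENNReal.ofReal ((1 + 2 * Real.pi) ^ 2 / TemperedFrac.coercivityConst a b α)
  have hC : (((1 + D) * E).toNNReal : ENNReal) = (1 + D) * E :=
    ENNReal.coe_toNNReal (by finiteness)
  -- E bounds u₁ and D·E bounds u = e^{-λx}u₁; the factor 1 + D covers both.
  refine ⟨((1 + D) * E).toNNReal, fun lam hlam hlt f => ?_⟩
  rw [hC]
  have hdual := TemperedFrac.dualNorm_expMulDual_lt_top hs hs1 lam f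
  have hcoe := TemperedFrac.coe_expMulDualLin hs hs1 lam f
  have hF : TemperedFrac.dualNorm (TemperedFrac.expMulDualLin hs hs1 lam f) < ⊤ := by rwa [hcoe]
  have hG : ∃! u₁ : TemperedFrac.L2 a b, TemperedFrac.IsGalerkinSolution lam f u₁ := by
    have h := TemperedFrac.existsUnique_formA2 hα₁ hα₂ hab hlt hF
    rwa [hcoe] at h
  have hbound : ∀ u₁ : TemperedFrac.L2 a b, TemperedFrac.IsGalerkinSolution lam f u₁ →
      TemperedFrac.sobolevNorm a b (α / 2) u₁ ≤
        E * TemperedFrac.dualNorm (TemperedFrac.expMulDual lam f) := fun u₁ hu₁ => by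
    rw [← hcoe]
    exact TemperedFrac.sobolevNorm_le_of_formA2 hα₁ hα₂ hab hlt hF hu₁.1
      fun v => (hu₁.2 v).trans (congrFun hcoe v).symm
  have hinv : ∀ w : TemperedFrac.L2 a b,
      TemperedFrac.expMul a b (-lam) (TemperedFrac.expMul a b lam w) = w := fun w => by
    rw [TemperedFrac.expMul_expMul, neg_add_cancel, TemperedFrac.expMul_zero]
  have hiff := TemperedFrac.isPetrovGalerkinSolution_iff hα₁ hα₂ hlam f
  refine ⟨hdual, ?_, hG, fun u hu => ?_, fun u₁ hu₁ => ?_⟩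
  · obtain ⟨u₁, hu₁, huniq⟩ := hG
    refine ⟨TemperedFrac.expMul a b (-lam) u₁, (hiff _).2 ?_, fun u hu => ?_⟩
    · rw [TemperedFrac.expMul_expMul, add_neg_cancel, TemperedFrac.expMul_zero]
      exact hu₁
    · rw [← huniq _ ((hiff u).1 hu), hinv]
  · have hu₁ := (hiff u).1 hu
    have habs : |-lam| ≤ |T| ^ α⁻¹ := by
      rw [abs_neg, abs_of_nonneg hlam]
      refine (Real.le_rpow_inv_iff_of_pos hlam (abs_nonneg T) (by linarith)).2 ?_
      exact hlt.le.trans (le_abs_self T)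
    have h1 := hexp (-lam) habs _ hu₁.1
    rw [hinv] at h1
    refine h1.trans ?_
    rw [mul_assoc]
    gcongr
    · exact le_add_self
    · exact hbound _ hu₁
  · refine (hbound u₁ hu₁).trans ?_
    gcongr
    exact le_mul_of_one_le_left' le_self_add
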